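/- Let $k$ be a field of characteristic zero. A dg operad is a $\mathbb Z/2$-graded, non-unital symmetric operad $\mathcal O=\{\mathcal O(n)\}_{n\ge 0}$ in $k$-vector spaces with an odd differential $d_{\mathcal O}$, $d_{\mathcal O}^2=0$, that commutes with the symmetric groups and is a derivation of the operadic compositions. A map of dg operads is a quasi-isomorphism if it induces an isomorphism on homology in every arity. Let $L_\infty$ be the dg operad whose underlying graded operad is free on odd $S_n$-invariant operations $m_n\in L_\infty(n)$, $n\ge 1$, with $$d(m_n)=\sum_{j=1}^{n}\ \sum_{\sigma\in \mathrm{Sh}(n-j+1,j-1)}\sigma\,(m_j\circ_1 m_{n-j+1}),$$ where $\mathrm{Sh}(p,q)\subset S_{p+q}$ is the set of $(p,q)$-shuffles, and let $l_\infty$ be the quotient of $L_\infty$ by the dg operadic ideal generated by $m_1$. For a map of dg operads $\phi:l_\infty\to\mathcal O$, let $\mathcal O[x]$ be the graded operad obtained from $\mathcal O$ by freely adjoining an even element $x$ of arity $0$, and let $\mathcal O[[x]]=\varprojlim_N \mathcal O[x]/(x)^N$ be its completion, where $(x)^N$ is spanned by the composites with at least $N$ occurrences of $x$. The dg operad $\mathcal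 O_{\mathrm{MC}}$ is the graded operad $\mathcal O[[x]]$ with the ($x$-adically continuous) differential that restricts to $d_{\mathcal O}$ on $\mathcal O$ and satisfies $$d(x)=\sum_{n\ge 2}\frac1{n!}\,\phi(m_n)\circ x^{\otimes n}.$$ Let $\phi:l_\infty\to\mathcal O$, $\psi:l_\infty\to\mathcal P$ and $\rho:\mathcal O\to\mathcal P$ be maps of dg operads with $\rho\circ\phi=\psi$. If $\rho$ is a quasi-isomorphism, then the induced map $\rho_{\mathrm{MC}}:\mathcal O_{\mathrm{MC}}\to\mathcal P_{\mathrm{MC}}$ (the continuous map of dg operads that is $\rho$ on $\mathcal O$ and sends $x$ to $x$) is a quasi-isomorphism. -/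

import Mathlib

universe u v w

namespace OperadMC

/-- The sign `(-1) ^ p` of a parity `p`. -/
def psign (p : ZMod 2) : ℤ := if p = 0 then 1 else -1

/-- The position (counted from `0`) among the inputs of `f ∘_i g` of the input `s ≠ i` of `f`,
when `g` has `b` inputs. The input `t` of `g` has position `i + t`. -/
def outerPos (b i s : ℕ) : ℕ := if s < i then s else s + b - 1

/-- A `ℤ/2`-graded non-unital (symmetric) operad over `k`: the superspaces `Op n` with parity
components `Op n 0` (even) and `Op n 1` (odd), `n = 0, 1, 2, …`, a left action of the symmetric
group on `Op n`, and partial compositions `comp _ _ i f g = f ∘_i g` (inputs are counted from `0`;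
the two equations say that `f ∘_i g` has arity `a + b - 1` and parity `p + q`). -/
structure GradedOperad (k : Type u) [Field k] where
  Op : ℕ → ZMod 2 → Type v
  [addCommGroup : ∀ n p, AddCommGroup (Op n p)]
  [module : ∀ n p, Module k (Op n p)]
  act : ∀ {n : ℕ} {p : ZMod 2}, Equiv.Perm (Fin n) → Op n p →ₗ[k] Op n p
  comp : ∀ {a b c : ℕ} {p q r : ZMod 2}, a + b = c + 1 → p + q = r → Fin a →
    Op a p →ₗ[k] Op b q →ₗ[k] Op c r
  act_one : ∀ {n : ℕ} {p : ZMod 2} (f : Op n p), act 1 f = f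
  act_mul : ∀ {n : ℕ} {p : ZMod 2} (σ τ : Equiv.Perm (Fin n)) (f : Op n p),
    act (σ * τ) f = act σ (act τ f)
  /-- `(f ∘_i g) ∘_{i + j} h = f ∘_i (g ∘_j h)` -/
  comp_nested : ∀ {a b c ab bc abc : ℕ} {p q r pq qr pqr : ZMod 2}
    (hab : a + b = ab + 1) (hbc : b + c = bc + 1) (h₁ : ab + c = abc + 1) (h₂ : a + bc = abc + 1)
    (hpq : p + q = pq) (hqr : q + r = qr) (hp₁ : pq + r = pqr) (hp₂ : p + qr = pqr)
    (i : Fin a) (j : Fin b) (i' : Fin ab), (i' : ℕ) = i + j →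
    ∀ (f : Op a p) (g : Op b q) (h : Op c r),
    comp h₁ hp₁ i' (comp hab hpq i f g) h = comp h₂ hp₂ i f (comp hbc hqr j g h)
  /-- `(f ∘_i g) ∘_{j + b - 1} h = (-1) ^ (|g| |h|) (f ∘_j h) ∘_i g` for `i < j` -/
  comp_parallel : ∀ {a b c ab ac abc : ℕ} {p q r pq pr pqr : ZMod 2}
    (hab : a + b = ab + 1) (hac : a + c = ac + 1) (h₁ : ab + c = abc + 1) (h₂ : ac + b = abc + 1)
    (hpq : p + q = pq) (hpr : p + r = pr) (hp₁ : pq + r = pqr) (hp₂ : pr + q = pqr)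
    (i j : Fin a) (j' : Fin ab) (i' : Fin ac), i < j → (j' : ℕ) + 1 = j + b → (i' : ℕ) = i →
    ∀ (f : Op a p) (g : Op b q) (h : Op c r),
    comp h₁ hp₁ j' (comp hab hpq i f g) h =
      psign (q * r) • comp h₂ hp₂ i' (comp hac hpr j f h) g
  /-- `(σ f) ∘_{σ i} (τ g) = π (f ∘_i g)`, where `π` is the permutation of the inputs of the
  composition that is induced by `σ` and `τ` -/
  comp_act : ∀ {a b c : ℕ} {p q r : ZMod 2} (h : a + b = c + 1) (hp : p + q = r) (i : Fin a)
    (σ : Equiv.Perm (Fin a)) (τ : Equiv.Perm (Fin b)) (π : Equiv.Perm (Fin c)),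
    (∀ (t : Fin b) (s : Fin c), (s : ℕ) = i + t → (π s : ℕ) = σ i + τ t) →
    (∀ (t : Fin a) (s : Fin c), t ≠ i → (s : ℕ) = outerPos b i t →
      (π s : ℕ) = outerPos b (σ i) (σ t)) →
    ∀ (f : Op a p) (g : Op b q),
    comp h hp (σ i) (act σ f) (act τ g) = act π (comp h hp i f g)

attribute [instance] GradedOperad.addCommGroup GradedOperad.module

/-- A dg operad: a graded operad with an odd differential, which commutes with the symmetric
groups and is a derivation of the compositions. -/
structure DGOperad (k : Type u) [Field k] extends GradedOperad.{u, v} k where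
  d : ∀ {n : ℕ} {p q : ZMod 2}, p + 1 = q → Op n p →ₗ[k] Op n q
  d_d : ∀ {n : ℕ} {p q r : ZMod 2} (hq : p + 1 = q) (hr : q + 1 = r) (f : Op n p),
    d hr (d hq f) = 0
  d_act : ∀ {n : ℕ} {p q : ZMod 2} (hq : p + 1 = q) (σ : Equiv.Perm (Fin n)) (f : Op n p),
    d hq (act σ f) = act σ (d hq f)
  d_comp : ∀ {a b c : ℕ} {p q r p' q' r' : ZMod 2} (h : a + b = c + 1) (hr : p + q = r)
    (hp' : p + 1 = p') (hq' : q + 1 = q') (hr' : r + 1 = r') (h₁ : p' + q = r') (h₂ : p + q' = r')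
    (i : Fin a) (f : Op a p) (g : Op b q),
    d hr' (comp h hr i f g) =
      comp h h₁ i (d hp' f) g + psign p • comp h h₂ i f (d hq' g)

/-- Maps of graded operads. -/
structure GradedOperad.Hom {k : Type u} [Field k] (O : GradedOperad.{u, v} k)
    (P : GradedOperad.{u, w} k) where
  map : ∀ {n : ℕ} {p : ZMod 2}, O.Op n p →ₗ[k] P.Op n p
  map_act : ∀ {n : ℕ} {p : ZMod 2} (σ : Equiv.Perm (Fin n)) (f : O.Op n p),
    map (O.act σ f) = P.act σ (map f)
  map_comp : ∀ {a b c : ℕ} {p q r : ZMod 2} (h : a + b = c + 1) (hr : p + q = r) (i : Fin a)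
    (f : O.Op a p) (g : O.Op b q), map (O.comp h hr i f g) = P.comp h hr i (map f) (map g)

/-- Maps of dg operads. -/
structure DGOperad.Hom {k : Type u} [Field k] (O : DGOperad.{u, v} k) (P : DGOperad.{u, w} k)
    extends GradedOperad.Hom O.toGradedOperad P.toGradedOperad where
  map_d : ∀ {n : ℕ} {p q : ZMod 2} (hq : p + 1 = q) (f : O.Op n p),
    map (O.d hq f) = P.d hq (map f)

/-- Composition of maps of dg operads. -/
def DGOperad.Hom.comp {k : Type u} [Field k] {O : DGOperad.{u, v} k} {P : DGOperad.{u, w} k}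
    {Q : DGOperad k} (ρ : P.Hom Q) (φ : O.Hom P) : O.Hom Q where
  map := ρ.map ∘ₗ φ.map
  map_act σ f := by simp [φ.map_act, ρ.map_act]
  map_comp h hr i f g := by simp [φ.map_comp, ρ.map_comp]
  map_d hq f := by simp [φ.map_d, ρ.map_d]

/-- The cycles of parity `p` of the complex `O n`. -/
def DGOperad.cycles {k : Type u} [Field k] (O : DGOperad.{u, v} k) (n : ℕ) (p : ZMod 2) :
    Submodule k (O.Op n p) :=
  LinearMap.ker (O.d (n := n) (p := p) rfl)

/-- The boundaries of parity `p` of the complex `O n`, as a subspace of the cycles. -/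
def DGOperad.boundaries {k : Type u} [Field k] (O : DGOperad.{u, v} k) (n : ℕ) (p : ZMod 2) :
    Submodule k (O.cycles n p) :=
  (LinearMap.range (O.d (n := n) (p := p + 1) (q := p) (by revert p; decide))).comap
    (O.cycles n p).subtype

/-- The homology of the complex `O n` in parity `p`. -/
abbrev DGOperad.Homology {k : Type u} [Field k] (O : DGOperad.{u, v} k) (n : ℕ) (p : ZMod 2) :
    Type v :=
  O.cycles n p ⧸ O.boundaries n p

/-- The map induced by a map of dg operads on cycles. -/
def DGOperad.Hom.cyclesMap {k : Type u} [Field k] {O : DGOperad.{u, v} k} {P : DGOperad.{u, w} k}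
    (ρ : O.Hom P) (n : ℕ) (p : ZMod 2) : O.cycles n p →ₗ[k] P.cycles n p :=
  ρ.map.restrict fun f hf => by
    have hf' : O.d rfl f = 0 := hf
    change P.d rfl (ρ.map f) = 0
    rw [← ρ.map_d, hf', map_zero]

/-- The map induced by a map of dg operads on homology. -/
def DGOperad.Hom.homologyMap {k : Type u} [Field k] {O : DGOperad.{u, v} k}
    {P : DGOperad.{u, w} k} (ρ : O.Hom P) (n : ℕ) (p : ZMod 2) :
    O.Homology n p →ₗ[k] P.Homology n p :=
  Submodule.mapQ _ _ (ρ.cyclesMap n p) fun f hf => by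
    obtain ⟨g, hg⟩ := hf
    exact ⟨ρ.map g, by rw [← ρ.map_d, hg]; rfl⟩

/-- A quasi-isomorphism of dg operads: a map that induces an isomorphism on homology in every
arity. -/
def DGOperad.Hom.IsQuasiIso {k : Type u} [Field k] {O : DGOperad.{u, v} k}
    {P : DGOperad.{u, w} k} (ρ : O.Hom P) : Prop :=
  ∀ (n : ℕ) (p : ZMod 2), Function.Bijective (ρ.homologyMap n p)

/-! ### Graded operads given by generators and relations -/

/-- Formal expressions in generators, sums, multiples, permutations and compositions. -/
inductive Term (k : Type u) (G : ℕ → ZMod 2 → Type v) : ℕ → ZMod 2 → Type (max u v)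
  | gen {n : ℕ} {p : ZMod 2} : G n p → Term k G n p
  | zero {n : ℕ} {p : ZMod 2} : Term k G n p
  | add {n : ℕ} {p : ZMod 2} : Term k G n p → Term k G n p → Term k G n p
  | smul {n : ℕ} {p : ZMod 2} : k → Term k G n p → Term k G n p
  | act {n : ℕ} {p : ZMod 2} : Equiv.Perm (Fin n) → Term k G n p → Term k G n p
  | comp {a b c : ℕ} {p q r : ZMod 2} : a + b = c + 1 → p + q = r → Fin a →
      Term k G a p → Term k G b q → Term k G c r

/-- Generators, each with an arity and a parity, and relations between formal expressions. -/
structure Presentation (k : Type u) where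
  Gen : ℕ → ZMod 2 → Type v
  Rel : ∀ {n : ℕ} {p : ZMod 2}, Term k Gen n p → Term k Gen n p → Prop

/-- The smallest congruence on formal expressions which contains the relations and the axioms of
graded operads. -/
inductive Presentation.Eqv {k : Type u} [Field k] (X : Presentation.{u, v} k) :
    ∀ {n : ℕ} {p : ZMod 2}, Term k X.Gen n p → Term k X.Gen n p → Prop
  | rel {n : ℕ} {p : ZMod 2} {s t : Term k X.Gen n p} : X.Rel s t → Eqv X s t
  | refl {n : ℕ} {p : ZMod 2} (s : Term k X.Gen n p) : Eqv X s s
  | symm {n : ℕ} {p : ZMod 2} {s t : Term k X.Gen n p} : Eqv X s t → Eqv X t s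
  | trans {n : ℕ} {p : ZMod 2} {s t r : Term k X.Gen n p} : Eqv X s t → Eqv X t r → Eqv X s r
  | add_congr {n : ℕ} {p : ZMod 2} {s s' t t' : Term k X.Gen n p} :
      Eqv X s s' → Eqv X t t' → Eqv X (s.add t) (s'.add t')
  | smul_congr {n : ℕ} {p : ZMod 2} (c : k) {s s' : Term k X.Gen n p} :
      Eqv X s s' → Eqv X (s.smul c) (s'.smul c)
  | act_congr {n : ℕ} {p : ZMod 2} (σ : Equiv.Perm (Fin n)) {s s' : Term k X.Gen n p} :
      Eqv X s s' → Eqv X (s.act σ) (s'.act σ)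
  | comp_congr {a b c : ℕ} {p q r : ZMod 2} (h : a + b = c + 1) (hr : p + q = r) (i : Fin a)
      {s s' : Term k X.Gen a p} {t t' : Term k X.Gen b q} :
      Eqv X s s' → Eqv X t t' → Eqv X (.comp h hr i s t) (.comp h hr i s' t')
  | add_assoc {n : ℕ} {p : ZMod 2} (s t r : Term k X.Gen n p) :
      Eqv X ((s.add t).add r) (s.add (t.add r))
  | add_comm {n : ℕ} {p : ZMod 2} (s t : Term k X.Gen n p) : Eqv X (s.add t) (t.add s)
  | zero_add {n : ℕ} {p : ZMod 2} (s : Term k X.Gen n p) : Eqv X (Term.zero.add s) s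
  | neg_add {n : ℕ} {p : ZMod 2} (s : Term k X.Gen n p) :
      Eqv X ((s.smul (-1)).add s) Term.zero
  | smul_add {n : ℕ} {p : ZMod 2} (c : k) (s t : Term k X.Gen n p) :
      Eqv X ((s.add t).smul c) ((s.smul c).add (t.smul c))
  | add_smul {n : ℕ} {p : ZMod 2} (c c' : k) (s : Term k X.Gen n p) :
      Eqv X (s.smul (c + c')) ((s.smul c).add (s.smul c'))
  | mul_smul {n : ℕ} {p : ZMod 2} (c c' : k) (s : Term k X.Gen n p) :
      Eqv X (s.smul (c * c')) ((s.smul c').smul c)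
  | one_smul {n : ℕ} {p : ZMod 2} (s : Term k X.Gen n p) : Eqv X (s.smul 1) s
  | act_add {n : ℕ} {p : ZMod 2} (σ : Equiv.Perm (Fin n)) (s t : Term k X.Gen n p) :
      Eqv X ((s.add t).act σ) ((s.act σ).add (t.act σ))
  | act_smul {n : ℕ} {p : ZMod 2} (σ : Equiv.Perm (Fin n)) (c : k) (s : Term k X.Gen n p) :
      Eqv X ((s.smul c).act σ) ((s.act σ).smul c)
  | comp_add_left {a b c : ℕ} {p q r : ZMod 2} (h : a + b = c + 1) (hr : p + q = r) (i : Fin a)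
      (s s' : Term k X.Gen a p) (t : Term k X.Gen b q) :
      Eqv X (.comp h hr i (s.add s') t) ((Term.comp h hr i s t).add (.comp h hr i s' t))
  | comp_add_right {a b c : ℕ} {p q r : ZMod 2} (h : a + b = c + 1) (hr : p + q = r) (i : Fin a)
      (s : Term k X.Gen a p) (t t' : Term k X.Gen b q) :
      Eqv X (.comp h hr i s (t.add t')) ((Term.comp h hr i s t).add (.comp h hr i s t'))
  | comp_smul_left {a b c : ℕ} {p q r : ZMod 2} (h : a + b = c + 1) (hr : p + q = r) (i : Fin a)
      (x : k) (s : Term k X.Gen a p) (t : Term k X.Gen b q) :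
      Eqv X (.comp h hr i (s.smul x) t) ((Term.comp h hr i s t).smul x)
  | comp_smul_right {a b c : ℕ} {p q r : ZMod 2} (h : a + b = c + 1) (hr : p + q = r) (i : Fin a)
      (x : k) (s : Term k X.Gen a p) (t : Term k X.Gen b q) :
      Eqv X (.comp h hr i s (t.smul x)) ((Term.comp h hr i s t).smul x)
  | act_one {n : ℕ} {p : ZMod 2} (s : Term k X.Gen n p) : Eqv X (s.act 1) s
  | act_mul {n : ℕ} {p : ZMod 2} (σ τ : Equiv.Perm (Fin n)) (s : Term k X.Gen n p) :
      Eqv X (s.act (σ * τ)) ((s.act τ).act σ)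
  | comp_nested {a b c ab bc abc : ℕ} {p q r pq qr pqr : ZMod 2}
      (hab : a + b = ab + 1) (hbc : b + c = bc + 1) (h₁ : ab + c = abc + 1)
      (h₂ : a + bc = abc + 1)
      (hpq : p + q = pq) (hqr : q + r = qr) (hp₁ : pq + r = pqr) (hp₂ : p + qr = pqr)
      (i : Fin a) (j : Fin b) (i' : Fin ab) (hi' : (i' : ℕ) = i + j)
      (f : Term k X.Gen a p) (g : Term k X.Gen b q) (h : Term k X.Gen c r) :
      Eqv X (.comp h₁ hp₁ i' (.comp hab hpq i f g) h) (.comp h₂ hp₂ i f (.comp hbc hqr j g h))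
  | comp_parallel {a b c ab ac abc : ℕ} {p q r pq pr pqr : ZMod 2}
      (hab : a + b = ab + 1) (hac : a + c = ac + 1) (h₁ : ab + c = abc + 1)
      (h₂ : ac + b = abc + 1)
      (hpq : p + q = pq) (hpr : p + r = pr) (hp₁ : pq + r = pqr) (hp₂ : pr + q = pqr)
      (i j : Fin a) (j' : Fin ab) (i' : Fin ac) (hij : i < j) (hj' : (j' : ℕ) + 1 = j + b)
      (hi' : (i' : ℕ) = i)
      (f : Term k X.Gen a p) (g : Term k X.Gen b q) (h : Term k X.Gen c r) :
      Eqv X (.comp h₁ hp₁ j' (.comp hab hpq i f g) h)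
        ((Term.comp h₂ hp₂ i' (.comp hac hpr j f h) g).smul (psign (q * r) : k))
  | comp_act {a b c : ℕ} {p q r : ZMod 2} (h : a + b = c + 1) (hp : p + q = r) (i : Fin a)
      (σ : Equiv.Perm (Fin a)) (τ : Equiv.Perm (Fin b)) (π : Equiv.Perm (Fin c))
      (hτ : ∀ (t : Fin b) (s : Fin c), (s : ℕ) = i + t → (π s : ℕ) = σ i + τ t)
      (hσ : ∀ (t : Fin a) (s : Fin c), t ≠ i → (s : ℕ) = outerPos b i t →
        (π s : ℕ) = outerPos b (σ i) (σ t))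
      (f : Term k X.Gen a p) (g : Term k X.Gen b q) :
      Eqv X (.comp h hp (σ i) (f.act σ) (g.act τ)) ((Term.comp h hp i f g).act π)

section Presented

variable {k : Type u} [Field k] (X : Presentation.{u, v} k)

/-- Formal expressions up to the congruence. -/
def Presentation.setoid (n : ℕ) (p : ZMod 2) : Setoid (Term k X.Gen n p) where
  r := X.Eqv
  iseqv := ⟨.refl, .symm, .trans⟩

/-- The operations of the presented operad. -/
def Presentation.Carrier (n : ℕ) (p : ZMod 2) : Type (max u v) := Quotient (X.setoid n p)

/-- The class of a formal expression. -/
def Presentation.mkQ {n : ℕ} {p : ZMod 2} (t : Term k X.Gen n p) : X.Carrier n p :=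
  Quotient.mk (X.setoid n p) t

theorem Presentation.mkQ_eq {n : ℕ} {p : ZMod 2} {s t : Term k X.Gen n p} :
    X.mkQ s = X.mkQ t ↔ X.Eqv s t :=
  Quotient.eq (r := X.setoid n p)

instance (n : ℕ) (p : ZMod 2) : Zero (X.Carrier n p) where
  zero := X.mkQ .zero

instance (n : ℕ) (p : ZMod 2) : Add (X.Carrier n p) where
  add := Quotient.map₂ .add fun _ _ h _ _ h' => .add_congr h h'

instance (n : ℕ) (p : ZMod 2) : Neg (X.Carrier n p) where
  neg := Quotient.map (.smul (-1)) fun _ _ h => .smul_congr _ h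

instance (n : ℕ) (p : ZMod 2) : AddCommGroup (X.Carrier n p) where
  add_assoc := by rintro ⟨a⟩ ⟨b⟩ ⟨c⟩; exact X.mkQ_eq.2 (.add_assoc a b c)
  add_comm := by rintro ⟨a⟩ ⟨b⟩; exact X.mkQ_eq.2 (.add_comm a b)
  zero_add := by rintro ⟨a⟩; exact X.mkQ_eq.2 (.zero_add a)
  add_zero := by rintro ⟨a⟩; exact X.mkQ_eq.2 ((Presentation.Eqv.add_comm a .zero).trans (.zero_add a))
  neg_add_cancel := by rintro ⟨a⟩; exact X.mkQ_eq.2 (.neg_add a)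
  nsmul := nsmulRec
  zsmul := zsmulRec

instance (n : ℕ) (p : ZMod 2) : SMul k (X.Carrier n p) where
  smul c := Quotient.map (.smul c) fun _ _ h => .smul_congr _ h

instance (n : ℕ) (p : ZMod 2) : Module k (X.Carrier n p) :=
  Module.ofMinimalAxioms
    (by rintro c ⟨a⟩ ⟨b⟩; exact X.mkQ_eq.2 (.smul_add c a b))
    (by rintro c c' ⟨a⟩; exact X.mkQ_eq.2 (.add_smul c c' a))
    (by rintro c c' ⟨a⟩; exact X.mkQ_eq.2 (.mul_smul c c' a))
    (by rintro ⟨a⟩; exact X.mkQ_eq.2 (.one_smul a))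

/-- The graded operad with the given generators and relations. -/
def Presentation.operad : GradedOperad.{u, max u v} k where
  Op := X.Carrier
  act σ :=
    { toFun := Quotient.map (.act σ) fun _ _ h => .act_congr _ h
      map_add' := by rintro ⟨a⟩ ⟨b⟩; exact X.mkQ_eq.2 (.act_add σ a b)
      map_smul' := by rintro c ⟨a⟩; exact X.mkQ_eq.2 (.act_smul σ c a) }
  comp h hr i :=
    LinearMap.mk₂ k (Quotient.map₂ (.comp h hr i) fun _ _ e _ _ e' => .comp_congr h hr i e e')
      (by rintro ⟨a⟩ ⟨b⟩ ⟨c⟩; exact X.mkQ_eq.2 (.comp_add_left h hr i a b c))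
      (by rintro x ⟨a⟩ ⟨b⟩; exact X.mkQ_eq.2 (.comp_smul_left h hr i x a b))
      (by rintro ⟨a⟩ ⟨b⟩ ⟨c⟩; exact X.mkQ_eq.2 (.comp_add_right h hr i a b c))
      (by rintro x ⟨a⟩ ⟨b⟩; exact X.mkQ_eq.2 (.comp_smul_right h hr i x a b))
  act_one := by rintro n p ⟨a⟩; exact X.mkQ_eq.2 (.act_one a)
  act_mul := by rintro n p σ τ ⟨a⟩; exact X.mkQ_eq.2 (.act_mul σ τ a)
  comp_nested := by
    rintro a b c ab bc abc p q r pq qr pqr hab hbc h₁ h₂ hpq hqr hp₁ hp₂ i j i' hi' ⟨f⟩ ⟨g⟩ ⟨h⟩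
    exact X.mkQ_eq.2 (.comp_nested hab hbc h₁ h₂ hpq hqr hp₁ hp₂ i j i' hi' f g h)
  comp_parallel := by
    rintro a b c ab ac abc p q r pq pr pqr hab hac h₁ h₂ hpq hpr hp₁ hp₂ i j j' i' hij hj' hi'
      ⟨f⟩ ⟨g⟩ ⟨h⟩
    rw [← Int.cast_smul_eq_zsmul k]
    exact X.mkQ_eq.2 (.comp_parallel hab hac h₁ h₂ hpq hpr hp₁ hp₂ i j j' i' hij hj' hi' f g h)
  comp_act := by
    rintro a b c p q r h hp i σ τ π hτ hσ ⟨f⟩ ⟨g⟩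
    exact X.mkQ_eq.2 (.comp_act h hp i σ τ π hτ hσ f g)

end Presented

/-- Replacing the generators in a formal expression. -/
def Term.map {k : Type u} {G : ℕ → ZMod 2 → Type v} {G' : ℕ → ZMod 2 → Type w}
    (g : ∀ {n : ℕ} {p : ZMod 2}, G n p → G' n p) :
    ∀ {n : ℕ} {p : ZMod 2}, Term k G n p → Term k G' n p
  | _, _, .gen x => .gen (g x)
  | _, _, .zero => .zero
  | _, _, .add s t => (s.map g).add (t.map g)
  | _, _, .smul c s => (s.map g).smul c
  | _, _, .act σ s => (s.map g).act σ
  | _, _, .comp h hr i s t => .comp h hr i (s.map g) (t.map g)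

theorem Term.map_id {k : Type u} {G : ℕ → ZMod 2 → Type v} {n : ℕ} {p : ZMod 2} (t : Term k G n p) :
    t.map (fun x => x) = t := by
  induction t with
  | gen x => rfl
  | zero => rfl
  | add s t hs ht => simp only [Term.map, hs, ht]
  | smul c s hs => simp only [Term.map, hs]
  | act σ s hs => simp only [Term.map, hs]
  | comp h hr i s t hs ht => simp only [Term.map, hs, ht]

section Lift

variable {k : Type u} [Field k] (X : Presentation.{u, v} k)

/-- The operation which is given by a formal expression. -/
def Presentation.cls {n : ℕ} {p : ZMod 2} (t : Term k X.Gen n p) : X.operad.Op n p := X.mkQ t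

theorem Presentation.cls_eq {n : ℕ} {p : ZMod 2} {s t : Term k X.Gen n p} :
    X.cls s = X.cls t ↔ X.Eqv s t :=
  X.mkQ_eq

theorem Presentation.cls_surj {n : ℕ} {p : ZMod 2} (f : X.operad.Op n p) : ∃ t, X.cls t = f :=
  Quotient.exists_rep f

theorem Presentation.cls_zero {n : ℕ} {p : ZMod 2} :
    X.cls (.zero : Term k X.Gen n p) = 0 := rfl

theorem Presentation.cls_add {n : ℕ} {p : ZMod 2} (s t : Term k X.Gen n p) :
    X.cls (s.add t) = X.cls s + X.cls t := rfl

theorem Presentation.cls_smul {n : ℕ} {p : ZMod 2} (c : k) (s : Term k X.Gen n p) :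
    X.cls (s.smul c) = c • X.cls s := rfl

theorem Presentation.cls_act {n : ℕ} {p : ZMod 2} (σ : Equiv.Perm (Fin n))
    (s : Term k X.Gen n p) : X.cls (s.act σ) = X.operad.act σ (X.cls s) := rfl

theorem Presentation.cls_comp {a b c : ℕ} {p q r : ZMod 2} (h : a + b = c + 1) (hr : p + q = r)
    (i : Fin a) (s : Term k X.Gen a p) (t : Term k X.Gen b q) :
    X.cls (.comp h hr i s t) = X.operad.comp h hr i (X.cls s) (X.cls t) := rfl

/-- The value of a formal expression in a graded operad. -/
def Term.eval {G : ℕ → ZMod 2 → Type v} (Q : GradedOperad.{u, w} k)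
    (g : ∀ {n : ℕ} {p : ZMod 2}, G n p → Q.Op n p) :
    ∀ {n : ℕ} {p : ZMod 2}, Term k G n p → Q.Op n p
  | _, _, .gen x => g x
  | _, _, .zero => 0
  | _, _, .add s t => s.eval Q g + t.eval Q g
  | _, _, .smul c s => c • s.eval Q g
  | _, _, .act σ s => Q.act σ (s.eval Q g)
  | _, _, .comp h hr i s t => Q.comp h hr i (s.eval Q g) (t.eval Q g)

theorem Presentation.Eqv.eval_eq {X : Presentation.{u, v} k} {Q : GradedOperad.{u, w} k}
    {g : ∀ {n : ℕ} {p : ZMod 2}, X.Gen n p → Q.Op n p}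
    (hg : ∀ {n : ℕ} {p : ZMod 2} (s t : Term k X.Gen n p), X.Rel s t → s.eval Q g = t.eval Q g)
    {n : ℕ} {p : ZMod 2} {s t : Term k X.Gen n p} (h : X.Eqv s t) :
    s.eval Q g = t.eval Q g := by
  induction h with
  | rel h => exact hg _ _ h
  | refl => rfl
  | symm _ ih => exact ih.symm
  | trans _ _ ih ih' => exact ih.trans ih'
  | add_congr _ _ ih ih' => simp only [Term.eval, ih, ih']
  | smul_congr c _ ih => simp only [Term.eval, ih]
  | act_congr σ _ ih => simp only [Term.eval, ih]
  | comp_congr h hr i _ _ ih ih' => simp only [Term.eval, ih, ih']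
  | add_assoc s t r => simp only [Term.eval, _root_.add_assoc]
  | add_comm s t => exact _root_.add_comm _ _
  | zero_add s => exact _root_.zero_add _
  | neg_add s => simp [Term.eval]
  | smul_add c s t => exact _root_.smul_add _ _ _
  | add_smul c c' s => exact _root_.add_smul _ _ _
  | mul_smul c c' s => exact SemigroupAction.mul_smul _ _ _
  | one_smul s => exact _root_.one_smul _ _
  | act_add σ s t => simp [Term.eval]
  | act_smul σ c s => simp [Term.eval]
  | comp_add_left h hr i s s' t => simp [Term.eval]
  | comp_add_right h hr i s s' t => simp [Term.eval]
  | comp_smul_left h hr i x s t => simp [Term.eval]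
  | comp_smul_right h hr i x s t => simp [Term.eval]
  | act_one s => exact Q.act_one _
  | act_mul σ τ s => exact Q.act_mul _ _ _
  | comp_nested hab hbc h₁ h₂ hpq hqr hp₁ hp₂ i j i' hi' f g h =>
    exact Q.comp_nested hab hbc h₁ h₂ hpq hqr hp₁ hp₂ i j i' hi' _ _ _
  | comp_parallel hab hac h₁ h₂ hpq hpr hp₁ hp₂ i j j' i' hij hj' hi' f g h =>
    simp only [Term.eval, Int.cast_smul_eq_zsmul]
    exact Q.comp_parallel hab hac h₁ h₂ hpq hpr hp₁ hp₂ i j j' i' hij hj' hi' _ _ _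
  | comp_act h hp i σ τ π hτ hσ f g => exact Q.comp_act h hp i σ τ π hτ hσ _ _

/-- The map out of a presented operad which has given values on the generators. -/
def Presentation.lift (Q : GradedOperad.{u, w} k)
    (g : ∀ {n : ℕ} {p : ZMod 2}, X.Gen n p → Q.Op n p)
    (hg : ∀ {n : ℕ} {p : ZMod 2} (s t : Term k X.Gen n p), X.Rel s t →
      s.eval Q g = t.eval Q g) : X.operad.Hom Q where
  map :=
    { toFun := Quotient.lift (fun t => t.eval Q g) fun _ _ h => h.eval_eq hg
      map_add' := by rintro ⟨a⟩ ⟨b⟩; rfl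
      map_smul' := by rintro c ⟨a⟩; rfl }
  map_act := by rintro n p σ ⟨a⟩; rfl
  map_comp := by rintro a b c p q r h hr i ⟨f⟩ ⟨g⟩; rfl

theorem Presentation.lift_cls (Q : GradedOperad.{u, w} k)
    (g : ∀ {n : ℕ} {p : ZMod 2}, X.Gen n p → Q.Op n p)
    (hg : ∀ {n : ℕ} {p : ZMod 2} (s t : Term k X.Gen n p), X.Rel s t →
      s.eval Q g = t.eval Q g) {n : ℕ} {p : ZMod 2} (t : Term k X.Gen n p) :
    (X.lift Q g hg).map (X.cls t) = t.eval Q g := rfl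

/-- The odd derivation on formal expressions which has given values on the generators. -/
def Term.der {G : ℕ → ZMod 2 → Type v}
    (D : ∀ {n : ℕ} {p : ZMod 2}, G n p → Term k G n (p + 1)) :
    ∀ {n : ℕ} {p : ZMod 2}, Term k G n p → Term k G n (p + 1)
  | _, _, .gen x => D x
  | _, _, .zero => .zero
  | _, _, .add s t => (s.der D).add (t.der D)
  | _, _, .smul c s => (s.der D).smul c
  | _, _, .act σ s => (s.der D).act σ
  | _, _, .comp (p := p) (q := q) h hr i s t =>
    (Term.comp h (by rw [← hr, add_right_comm]) i (s.der D) t).add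
      ((Term.comp h (by rw [← hr, add_assoc]) i s (t.der D)).smul (psign p : k))

theorem Presentation.cls_der_comp (D : ∀ {n : ℕ} {p : ZMod 2}, X.Gen n p → Term k X.Gen n (p + 1))
    {a b c : ℕ} {p q r : ZMod 2} (h : a + b = c + 1) (hr : p + q = r)
    (i : Fin a) (s : Term k X.Gen a p) (t : Term k X.Gen b q) :
    X.cls ((Term.comp h hr i s t).der D) =
      X.operad.comp h (by rw [← hr, add_right_comm]) i (X.cls (s.der D)) (X.cls t) +
      psign p • X.operad.comp h (by rw [← hr, add_assoc]) i (X.cls s) (X.cls (t.der D)) := by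
  rw [← Int.cast_smul_eq_zsmul k]; rfl

theorem psign_par : ∀ p q r : ZMod 2, psign p * psign ((q + 1) * r) = psign (q * r) * psign (p + r) := by
  decide

theorem psign_par' : ∀ p q r : ZMod 2, psign (p + q) * psign (q * (r + 1)) = psign (q * r) * psign p := by
  decide

theorem psign_add : ∀ p q : ZMod 2, psign (p + q) = psign p * psign q := by
  decide

theorem Presentation.Eqv.der {X : Presentation.{u, v} k}
    {D : ∀ {n : ℕ} {p : ZMod 2}, X.Gen n p → Term k X.Gen n (p + 1)}
    (hD : ∀ {n : ℕ} {p : ZMod 2} (s t : Term k X.Gen n p), X.Rel s t →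
      X.Eqv (s.der D) (t.der D))
    {n : ℕ} {p : ZMod 2} {s t : Term k X.Gen n p} (h : X.Eqv s t) :
    X.Eqv (s.der D) (t.der D) := by
  induction h with
  | rel h => exact hD _ _ h
  | refl => exact .refl _
  | symm _ ih => exact ih.symm
  | trans _ _ ih ih' => exact ih.trans ih'
  | add_congr _ _ ih ih' => exact .add_congr ih ih'
  | smul_congr c _ ih => exact .smul_congr c ih
  | act_congr σ _ ih => exact .act_congr σ ih
  | comp_congr h hr i e e' ih ih' =>
    exact .add_congr (.comp_congr _ _ _ ih e') (.smul_congr _ (.comp_congr _ _ _ e ih'))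
  | add_assoc s t r => exact .add_assoc _ _ _
  | add_comm s t => exact .add_comm _ _
  | zero_add s => exact .zero_add _
  | neg_add s => exact .neg_add _
  | smul_add c s t => exact .smul_add _ _ _
  | add_smul c c' s => exact .add_smul _ _ _
  | mul_smul c c' s => exact .mul_smul _ _ _
  | one_smul s => exact .one_smul _
  | act_add σ s t => exact .act_add _ _ _
  | act_smul σ c s => exact .act_smul _ _ _
  | comp_add_left h hr i s s' t =>
    rw [← X.cls_eq]
    simp only [X.cls_add, Term.der, map_add, LinearMap.add_apply, _root_.smul_add, X.cls_smul,
      X.cls_comp]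
    exact add_add_add_comm _ _ _ _
  | comp_add_right h hr i s t t' =>
    rw [← X.cls_eq]
    simp only [X.cls_add, Term.der, map_add, _root_.smul_add, X.cls_smul, X.cls_comp]
    exact add_add_add_comm _ _ _ _
  | comp_smul_left h hr i x s t =>
    rw [← X.cls_eq]
    simp only [X.cls_add, Term.der, map_smul, LinearMap.smul_apply,
      _root_.smul_add, X.cls_smul, X.cls_comp]
    rw [smul_comm x]
  | comp_smul_right h hr i x s t =>
    rw [← X.cls_eq]
    simp only [X.cls_add, Term.der, map_smul, _root_.smul_add, X.cls_smul, X.cls_comp]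
    rw [smul_comm x]
  | act_one s => exact .act_one _
  | act_mul σ τ s => exact .act_mul _ _ _
  | @comp_nested a b c ab bc abc p q r pq qr pqr hab hbc h₁ h₂ hpq hqr hp₁ hp₂ i j i' hi' f g h =>
    subst hpq hqr hp₁
    rw [← X.cls_eq]
    simp only [X.cls_comp, map_add, LinearMap.add_apply, map_zsmul,
      LinearMap.smul_apply, _root_.smul_add, Term.der, X.cls_add, X.cls_smul,
      Int.cast_smul_eq_zsmul]
    rw [X.operad.comp_nested hab hbc h₁ h₂ _ rfl _ (by ring) i j i' hi',
      X.operad.comp_nested hab hbc h₁ h₂ (qr := q + r + 1) _ (by ring) _ (by ring) i j i' hi',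
      X.operad.comp_nested hab hbc h₁ h₂ (qr := q + r + 1) _ (by ring) _ (by ring) i j i' hi',
      psign_add,
      SemigroupAction.mul_smul]
    exact _root_.add_assoc _ _ _
  | @comp_parallel a b c ab ac abc p q r pq pr pqr hab hac h₁ h₂ hpq hpr hp₁ hp₂ i j j' i' hij hj'
      hi' f g h =>
    subst hpq hpr hp₁
    rw [← X.cls_eq]
    simp only [X.cls_comp, map_add, LinearMap.add_apply, map_zsmul,
      LinearMap.smul_apply, _root_.smul_add, Term.der, X.cls_add, X.cls_smul,
      Int.cast_smul_eq_zsmul]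
    rw [X.operad.comp_parallel hab hac h₁ h₂ (pr := p + r + 1) _ (by ring) _ (by ring) i j j' i' hij hj' hi',
      X.operad.comp_parallel hab hac h₁ h₂ _ rfl _ (by ring) i j j' i' hij hj' hi',
      X.operad.comp_parallel hab hac h₁ h₂ (pr := p + r + 1) _ (by ring) _ (by ring) i j j' i' hij hj' hi']
    simp only [← SemigroupAction.mul_smul, psign_par, psign_par']
    exact add_right_comm _ _ _
  | comp_act h hp i σ τ π hτ hσ f g =>
    rw [← X.cls_eq]
    simp only [X.cls_act, map_add, map_zsmul, Term.der, X.cls_add, X.cls_smul,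
      Int.cast_smul_eq_zsmul, X.cls_comp]
    rw [X.operad.comp_act _ _ i σ τ π hτ hσ, X.operad.comp_act _ _ i σ τ π hτ hσ]
theorem psign_succ : ∀ p : ZMod 2, psign (p + 1) = -psign p := by
  decide

theorem psign_mul_self : ∀ p : ZMod 2, psign p * psign p = 1 := by
  decide

theorem Presentation.der_der {D : ∀ {n : ℕ} {p : ZMod 2}, X.Gen n p → Term k X.Gen n (p + 1)}
    (hD : ∀ {n : ℕ} {p : ZMod 2} (x : X.Gen n p), X.cls ((D x).der D) = 0)
    {n : ℕ} {p : ZMod 2} (t : Term k X.Gen n p) : X.cls ((t.der D).der D) = 0 := by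
  induction t with
  | gen x => exact hD x
  | zero => rfl
  | add s t hs ht => simp only [Term.der, X.cls_add, hs, ht, add_zero]
  | smul c s hs => simp only [Term.der, X.cls_smul, hs, smul_zero]
  | act σ s hs => simp only [Term.der, X.cls_act, hs, map_zero]
  | @comp a b c p q r h hr i s t hs ht =>
    subst hr
    simp only [Term.der, X.cls_add, X.cls_smul, X.cls_comp, hs, ht, Int.cast_smul_eq_zsmul,
      psign_succ, map_zero, LinearMap.zero_apply, smul_zero, add_zero, zero_add, neg_smul]
    exact neg_add_cancel _

/-- The differential of a presented operad, from its values on the generators. -/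
def Presentation.diff (D : ∀ {n : ℕ} {p : ZMod 2}, X.Gen n p → Term k X.Gen n (p + 1))
    (hR : ∀ {n : ℕ} {p : ZMod 2} (s t : Term k X.Gen n p), X.Rel s t →
      X.Eqv (s.der D) (t.der D)) {n : ℕ} {p : ZMod 2} :
    X.operad.Op n p →ₗ[k] X.operad.Op n (p + 1) where
  toFun := Quotient.lift (fun t => X.cls (t.der D)) fun _ _ h => X.cls_eq.2 (h.der hR)
  map_add' := by rintro ⟨a⟩ ⟨b⟩; rfl
  map_smul' := by rintro c ⟨a⟩; rfl

/-- A presentation with a differential: the values of the differential on the generators, such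
that the resulting derivation respects the relations and squares to zero on the generators. -/
structure DGPresentation (k : Type u) [Field k] extends Presentation.{u, v} k where
  diffGen : ∀ {n : ℕ} {p : ZMod 2}, Gen n p → Term k Gen n (p + 1)
  diffGen_rel : ∀ {n : ℕ} {p : ZMod 2} (s t : Term k Gen n p), Rel s t →
    toPresentation.Eqv (s.der diffGen) (t.der diffGen)
  diffGen_diffGen : ∀ {n : ℕ} {p : ZMod 2} (x : Gen n p),
    toPresentation.cls ((diffGen x).der diffGen) = 0

/-- The presented dg operad: the presented graded operad, with the derivation which has the given
values on the generators. -/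
def DGPresentation.operad {k : Type u} [Field k] (X : DGPresentation.{u, v} k) :
    DGOperad.{u, max u v} k where
  toGradedOperad := X.toPresentation.operad
  d := fun {_ _ _} hq => hq ▸ X.diff X.diffGen X.diffGen_rel
  d_d := by
    rintro n p q r rfl rfl ⟨t⟩
    exact X.der_der X.diffGen_diffGen t
  d_act := by
    rintro n p q rfl σ ⟨t⟩
    rfl
  d_comp := by
    rintro a b c p q r _ _ _ h hr rfl rfl rfl _ _ i ⟨f⟩ ⟨g⟩
    exact X.cls_der_comp X.diffGen h hr i f g

theorem Presentation.eval_gen {G : ℕ → ZMod 2 → Type w}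
    (g : ∀ {n : ℕ} {p : ZMod 2}, G n p → X.Gen n p) {n : ℕ} {p : ZMod 2} (t : Term k G n p) :
    t.eval X.operad (fun x => X.cls (.gen (g x))) = X.cls (t.map g) := by
  induction t with
  | gen x => rfl
  | zero => rfl
  | add s t hs ht => simp only [Term.eval, Term.map, hs, ht, X.cls_add]
  | smul c s hs => simp only [Term.eval, Term.map, hs, X.cls_smul]
  | act σ s hs => simp only [Term.eval, Term.map, hs, X.cls_act]
  | comp h hr i s t hs ht => simp only [Term.eval, Term.map, hs, ht, X.cls_comp]

/-- The map of presented dg operads that is given by a map of generators. -/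
def DGPresentation.map (X : DGPresentation.{u, v} k) (Y : DGPresentation.{u, w} k)
    (g : ∀ {n : ℕ} {p : ZMod 2}, X.Gen n p → Y.Gen n p)
    (hg : ∀ {n : ℕ} {p : ZMod 2} (s t : Term k X.Gen n p), X.Rel s t →
      Y.Eqv (s.map g) (t.map g))
    (hd : ∀ {n : ℕ} {p : ZMod 2} (x : X.Gen n p),
      Y.cls ((X.diffGen x).map g) = Y.cls (Y.diffGen (g x))) :
    X.operad.Hom Y.operad where
  toHom := X.lift Y.toPresentation.operad (fun x => Y.cls (.gen (g x))) <| by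
    intro n p s t h
    rw [Y.eval_gen, Y.eval_gen, Y.cls_eq]
    exact hg s t h
  map_d := by
    rintro n p q rfl f
    obtain ⟨t, rfl⟩ := X.cls_surj f
    refine (Y.eval_gen g (t.der X.diffGen)).trans ?_
    refine Eq.trans ?_ (congrArg (Y.operad.d rfl) (Y.eval_gen g t)).symm
    change _ = Y.cls ((t.map g).der Y.diffGen)
    induction t with
    | gen x => exact hd x
    | zero => rfl
    | add s t hs ht => simp only [Term.der, Term.map, Y.cls_add, hs, ht]
    | smul c s hs => simp only [Term.der, Term.map, Y.cls_smul, hs]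
    | act σ s hs => simp only [Term.der, Term.map, Y.cls_act, hs]
    | comp h hr i s t hs ht =>
      simp only [Term.der, Term.map, Y.cls_add, Y.cls_smul, Y.cls_comp, hs, ht]

/-- A finite sum of formal expressions. -/
noncomputable def Term.sum {G : ℕ → ZMod 2 → Type v} {n : ℕ} {p : ZMod 2} {ι : Type*}
    (s : Finset ι) (f : ι → Term k G n p) : Term k G n p :=
  (s.toList.map f).foldr .add .zero

theorem Presentation.cls_sum {n : ℕ} {p : ZMod 2} {ι : Type*} (s : Finset ι)
    (f : ι → Term k X.Gen n p) : X.cls (Term.sum s f) = ∑ i ∈ s, X.cls (f i) := by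
  rw [← Finset.sum_map_toList, Term.sum]
  induction s.toList with
  | nil => rfl
  | cons a l ih => simp only [List.map_cons, List.foldr_cons, List.sum_cons, X.cls_add, ih]

end Lift

/-! ### The operads `L_∞` and `l_∞` -/

/-- The `(l, n - l)`-shuffles in the symmetric group of `n` letters. -/
def shuffles (n l : ℕ) : Finset (Equiv.Perm (Fin n)) :=
  Finset.univ.filter fun σ => (∀ a b : Fin n, a < b → (b : ℕ) < l → σ a < σ b) ∧
    (∀ a b : Fin n, a < b → l ≤ (a : ℕ) → σ a < σ b)

/-- Generators of `L_∞`, as a dg operad: `m n` stands for the odd operation `m_{n+1}` and `dm n`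
for its differential, `n = 0, 1, …`. -/
inductive LGen : ℕ → ZMod 2 → Type
  | m (n : ℕ) : LGen (n + 1) 1
  | dm (n : ℕ) : LGen (n + 1) 0

/-- The differential `m_{n+1} ↦ dm_{n+1}`, `dm_{n+1} ↦ 0` on generators. -/
def LGen.diff (k : Type u) : ∀ {n : ℕ} {p : ZMod 2}, LGen n p → Term k LGen n (p + 1)
  | _, _, .m n => .gen (.dm n)
  | _, _, .dm _ => .zero

/-- The value of the cobar differential on `m_{n+1}`, that is the sum of
`σ (m_{j+1} ∘_1 m_{n-j+1})` over `j = 0, …, n` and the `(n - j + 1, j)`-shuffles `σ`. -/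
noncomputable def cobar (k : Type u) [Field k] (n : ℕ) : Term k LGen (n + 1) 0 :=
  Term.sum Finset.univ fun j : Fin (n + 1) => Term.sum (shuffles (n + 1) (n - j + 1)) fun σ =>
    Term.act σ (Term.comp (p := 1) (q := 1) (by omega) (by decide) 0 (.gen (.m (j : ℕ)))
      (.gen (.m (n - j))))

/-- The relations of `L_∞`: all `m_{n+1}` are invariant under the symmetric group, and their
differential is the cobar differential. For `l_∞` (`reduced = True`) also `m_1 = 0`.
With each relation its differential is listed. (`d_cobar` says that the cobar differential squares
to zero, which it does already on the free graded operad on the invariant operations `m_{n+1}`;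
so `dm_{n+1}` can be eliminated, and `L_∞` is that free graded operad.) -/
inductive LRel (k : Type u) [Field k] (reduced : Prop) :
    ∀ {n : ℕ} {p : ZMod 2}, Term k LGen n p → Term k LGen n p → Prop
  | m_symm (n : ℕ) (σ : Equiv.Perm (Fin (n + 1))) :
      LRel k reduced (.act σ (.gen (.m n))) (.gen (.m n))
  | dm_symm (n : ℕ) (σ : Equiv.Perm (Fin (n + 1))) :
      LRel k reduced (.act σ (.gen (.dm n))) (.gen (.dm n))
  | cobar (n : ℕ) : LRel k reduced (.gen (.dm n)) (cobar k n)
  | d_cobar (n : ℕ) : LRel k reduced .zero ((cobar k n).der (LGen.diff k))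
  | unary : reduced → LRel k reduced (.gen (.m 0)) .zero
  | d_unary : reduced → LRel k reduced (.gen (.dm 0)) .zero

/-- The relations `LRel`. -/
abbrev LPres (k : Type u) [Field k] (reduced : Prop) : Presentation.{u, 0} k where
  Gen := LGen
  Rel := LRel k reduced

theorem LGen.diff_diff (k : Type u) [Field k] (reduced : Prop) {n : ℕ} {p : ZMod 2}
    (x : LGen n p) : (LPres k reduced).cls ((x.diff k).der (LGen.diff k)) = 0 := by
  cases x <;> rfl

theorem LRel.der (k : Type u) [Field k] (reduced : Prop) {n : ℕ} {p : ZMod 2}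
    (s t : Term k LGen n p) (h : LRel k reduced s t) :
    (LPres k reduced).Eqv (s.der (LGen.diff k)) (t.der (LGen.diff k)) := by
  cases h with
  | m_symm n σ => exact .rel (LRel.dm_symm n σ)
  | dm_symm n σ =>
    rw [← Presentation.cls_eq]
    exact map_zero ((LPres k reduced).operad.act σ)
  | cobar n => exact .rel (LRel.d_cobar n)
  | d_cobar n =>
    rw [← Presentation.cls_eq]
    exact ((LPres k reduced).der_der (LGen.diff_diff k reduced) _).symm
  | unary h => exact .rel (LRel.d_unary h)
  | d_unary h => exact .refl _

/-- The presentation of `L_∞` and of `l_∞`: the dg operad freely generated by the operations `m_n`,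
modulo the dg ideal generated by the relations. -/
abbrev LDGPres (k : Type u) [Field k] (reduced : Prop) : DGPresentation.{u, 0} k where
  toPresentation := LPres k reduced
  diffGen := LGen.diff k
  diffGen_rel := LRel.der k reduced
  diffGen_diffGen := LGen.diff_diff k reduced

/-- The dg operad `L_∞`. -/
def LInfty (k : Type u) [Field k] : DGOperad.{u, u} k := (LDGPres k False).operad

/-- The dg operad `l_∞`, the quotient of `L_∞` by the ideal generated by `m_1`. -/
def lInfty (k : Type u) [Field k] : DGOperad.{u, u} k := (LDGPres k True).operad

/-- The operation `m_{n+1}` of `L_∞`. -/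
def LInfty.m (k : Type u) [Field k] (n : ℕ) : (LInfty k).Op (n + 1) 1 :=
  (LPres k False).cls (.gen (.m n))

/-- The quotient map from `L_∞` to `l_∞`. -/
def lInfty.proj (k : Type u) [Field k] : (LInfty k).Hom (lInfty k) :=
  DGPresentation.map (LDGPres k False) (LDGPres k True) (fun x => x)
    (by
      intro n p s t h
      rw [Term.map_id, Term.map_id]
      cases h with
      | m_symm n σ => exact .rel (LRel.m_symm n σ)
      | dm_symm n σ => exact .rel (LRel.dm_symm n σ)
      | cobar n => exact .rel (LRel.cobar n)
      | d_cobar n => exact .rel (LRel.d_cobar n)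
      | unary h => exact h.elim
      | d_unary h => exact h.elim)
    (by
      intro n p x
      rw [Term.map_id])

theorem LInfty.act_m (k : Type u) [Field k] (n : ℕ) (σ : Equiv.Perm (Fin (n + 1))) :
    (LInfty k).act σ (LInfty.m k n) = LInfty.m k n :=
  (LPres k False).cls_eq.2 (.rel (LRel.m_symm n σ))

theorem LInfty.d_m (k : Type u) [Field k] (n : ℕ) :
    (LInfty k).d (by decide) (LInfty.m k n) =
      ∑ j : Fin (n + 1), ∑ σ ∈ shuffles (n + 1) (n - j + 1),
        (LInfty k).act σ ((LInfty k).comp (by omega) (by decide : (1 : ZMod 2) + 1 = 0) 0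
          (LInfty.m k (j : ℕ)) (LInfty.m k (n - j))) := by
  refine ((LPres k False).cls_eq.2 (.rel (LRel.cobar n))).trans ?_
  erw [cobar, (LPres k False).cls_sum]
  refine Finset.sum_congr rfl fun j _ => ?_
  erw [(LPres k False).cls_sum]
  rfl

/-! ### Inserting a fixed even operation of arity zero -/

theorem shuffle_ext {n l : ℕ} {σ τ : Equiv.Perm (Fin n)} (hσ : σ ∈ shuffles n l)
    (hτ : τ ∈ shuffles n l)
    (h : (Finset.univ.filter fun a : Fin n => (a : ℕ) < l).map σ.toEmbedding =
      (Finset.univ.filter fun a : Fin n => (a : ℕ) < l).map τ.toEmbedding) : σ = τ := by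
  simp only [shuffles, Finset.mem_filter, Finset.mem_univ, true_and] at hσ hτ
  have key : ∀ a : Fin n, (τ.symm (σ a) : ℕ) < l ↔ (a : ℕ) < l := by
    intro a
    have := Finset.ext_iff.1 h (σ a)
    simp only [Finset.mem_map, Finset.mem_filter, Finset.mem_univ, true_and,
      Equiv.coe_toEmbedding, EmbeddingLike.apply_eq_iff_eq, exists_eq_right] at this
    rw [this]
    constructor
    · intro h; exact ⟨_, h, by simp⟩
    · rintro ⟨b, hb, e⟩; rw [← e]; simpa using hb
  -- `ρ = τ⁻¹ σ` is monotone on both blocks and preserves them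
  have mono : ∀ a b : Fin n, a < b → τ.symm (σ a) < τ.symm (σ b) := by
    intro a b hab
    by_contra hcon
    have hne : τ.symm (σ b) ≠ τ.symm (σ a) := by
      intro e
      exact hab.ne' (σ.injective (τ.symm.injective e))
    have hlt : τ.symm (σ b) < τ.symm (σ a) := lt_of_le_of_ne (not_lt.1 hcon) hne
    by_cases hb : (b : ℕ) < l
    · have h1 := hσ.1 a b hab hb
      have h2 := hτ.1 _ _ hlt ((key a).2 (lt_trans hab hb))
      simp only [Equiv.apply_symm_apply] at h2
      exact absurd h1 (not_lt.2 h2.le)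
    · by_cases ha : (a : ℕ) < l
      · have h1 := (key a).2 ha
        have h2 : ¬ (τ.symm (σ b) : ℕ) < l := fun h => hb ((key b).1 h)
        have h3 : (τ.symm (σ b) : ℕ) < τ.symm (σ a) := hlt
        omega
      · have h1 := hσ.2 a b hab (not_lt.1 ha)
        have h2 := hτ.2 _ _ hlt (not_lt.1 fun h => hb ((key b).1 h))
        simp only [Equiv.apply_symm_apply] at h2
        exact absurd h1 (not_lt.2 h2.le)
  have hid : (σ.trans τ.symm : Fin n → Fin n) = id := by
    have : StrictMono (σ.trans τ.symm : Fin n → Fin n) := mono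
    have e : (this.orderIsoOfSurjective _ (σ.trans τ.symm).surjective) = OrderIso.refl (Fin n) :=
      Subsingleton.elim _ _
    funext a
    exact congrArg (fun f : Fin n ≃o Fin n => f a) e
  ext a
  have := congrFun hid a
  simp only [Equiv.trans_apply, id] at this
  rw [(Equiv.symm_apply_eq τ).1 this]

theorem card_shuffles {n l : ℕ} (hl : l ≤ n) : (shuffles n l).card = n.choose l := by
  have hcard : ((Finset.univ.filter fun a : Fin n => (a : ℕ) < l)).card = l := by
    rw [Fin.card_filter_val_lt]; omega
  have : n.choose l = (Finset.powersetCard l (Finset.univ : Finset (Fin n))).card := by simp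
  rw [this]
  refine Finset.card_bij
    (fun σ _ => (Finset.univ.filter fun a : Fin n => (a : ℕ) < l).map σ.toEmbedding) ?_ ?_ ?_
  · intro σ _
    simp [Finset.mem_powersetCard, hcard]
  · intro σ hσ τ hτ h
    exact shuffle_ext hσ hτ h
  · intro S hS
    have hSc : S.card = l := (Finset.mem_powersetCard.1 hS).2
    have hSc' : Sᶜ.card = n - l := by rw [Finset.card_compl, hSc, Fintype.card_fin]
    let e : Fin n ≃ Fin l ⊕ Fin (n - l) :=
      (finCongr (by omega)).trans finSumFinEquiv.symm
    let σ : Equiv.Perm (Fin n) := e.trans (finSumEquivOfFinset hSc hSc')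
    have e1 : ∀ (a : Fin n) (ha : (a : ℕ) < l), σ a = S.orderEmbOfFin hSc ⟨a, ha⟩ := by
      intro a ha
      have : e a = Sum.inl ⟨a, ha⟩ := by
        simp only [e, Equiv.trans_apply, Equiv.symm_apply_eq]
        ext; simp
      simp [σ, this]
    have e2 : ∀ (a : Fin n) (ha : l ≤ (a : ℕ)),
        σ a = Sᶜ.orderEmbOfFin hSc' ⟨a - l, by omega⟩ := by
      intro a ha
      have : e a = Sum.inr ⟨a - l, by omega⟩ := by
        simp only [e, Equiv.trans_apply, Equiv.symm_apply_eq]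
        ext; simp; omega
      simp [σ, this]
    refine ⟨σ, ?_, ?_⟩
    · simp only [shuffles, Finset.mem_filter, Finset.mem_univ, true_and]
      constructor
      · intro a b hab hb
        rw [e1 a (lt_trans hab hb), e1 b hb]
        exact (S.orderEmbOfFin hSc).strictMono hab
      · intro a b hab ha
        have hab' : (a : ℕ) < b := hab
        rw [e2 a ha, e2 b (by omega)]
        refine (Sᶜ.orderEmbOfFin hSc').strictMono ?_
        simp only [Fin.mk_lt_mk]; omega
    · refine Finset.eq_of_subset_of_card_le ?_ (by simp [hSc, hcard])
      intro y hy
      obtain ⟨a, ha, rfl⟩ := Finset.mem_map.1 hy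
      have ha' : (a : ℕ) < l := (Finset.mem_filter.1 ha).2
      change σ a ∈ S
      rw [e1 a ha']
      exact Finset.orderEmbOfFin_mem _ _ _

section Plug

variable {k : Type u} [Field k] (Q : GradedOperad.{u, v} k) (x : Q.Op 0 0)

/-- The operation `f ∘ (x ⊗ … ⊗ x)` with `x` inserted into all inputs of `f`, from the last one to
the first one. -/
def GradedOperad.plug (x : Q.Op 0 0) : ∀ (n : ℕ) {p : ZMod 2}, Q.Op n p →ₗ[k] Q.Op 0 p
  | 0, _ => LinearMap.id
  | n + 1, p => GradedOperad.plug x n ∘ₗ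
      (Q.comp (add_zero (n + 1)) (add_zero p) (Fin.last n)).flip x

theorem GradedOperad.plug_comp (n : ℕ) {p : ZMod 2} (i : Fin (n + 1)) (f : Q.Op (n + 1) p) :
    Q.plug x n (Q.comp (add_zero _) (add_zero p) i f x) = Q.plug x (n + 1) f := by
  induction n with
  | zero => rw [Fin.fin_one_eq_zero i]; rfl
  | succ n ih =>
    rcases (Fin.le_last i).eq_or_lt with rfl | hi
    · rfl
    · change Q.plug x n (Q.comp (add_zero _) (add_zero p) (Fin.last n) (Q.comp (add_zero _) (add_zero p) i f x) x) = _
      rw [Q.comp_parallel (ac := n + 1) (add_zero _) (add_zero _) (add_zero _) (add_zero _) _ (add_zero p) _ (add_zero p) i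
        (Fin.last (n + 1)) (Fin.last n) ⟨i, hi⟩ hi rfl rfl]
      have : psign (0 * 0) = 1 := by decide
      rw [this, one_smul, ih]
      rfl

theorem GradedOperad.exists_perm (n : ℕ) (σ : Equiv.Perm (Fin (n + 1))) (i : Fin (n + 1)) :
    ∃ π : Equiv.Perm (Fin n), ∀ {p q r : ZMod 2} (hr : p + q = r) (f : Q.Op (n + 1) p)
      (y : Q.Op 0 q), Q.comp (add_zero _) hr (σ i) (Q.act σ f) y = Q.act π (Q.comp (add_zero _) hr i f y) := by
  let π : Equiv.Perm (Fin n) := (finSuccAboveEquiv i).trans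
    ((σ.subtypeEquiv (p := fun a => a ≠ i) (q := fun a => a ≠ σ i) (by simp)).trans
      (finSuccAboveEquiv (σ i)).symm)
  have hπ : ∀ s, (σ i).succAbove (π s) = σ (i.succAbove s) := by
    intro s
    have := congrArg Subtype.val ((finSuccAboveEquiv (σ i)).apply_symm_apply
      ((σ.subtypeEquiv (p := fun a => a ≠ i) (q := fun a => a ≠ σ i) (by simp))
        (finSuccAboveEquiv i s)))
    exact this
  have hout : ∀ (j : Fin (n + 1)) (s : Fin n), outerPos 0 j (j.succAbove s) = s := by
    intro j s
    rcases Fin.castSucc_lt_or_lt_succ j s with h | h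
    · rw [Fin.succAbove_of_castSucc_lt _ _ h]
      have : (s : ℕ) < j := h
      simp [outerPos, this]
    · rw [Fin.succAbove_of_lt_succ _ _ h]
      have : (j : ℕ) < s + 1 := h
      simp only [outerPos, Fin.val_succ]
      split_ifs <;> omega
  refine ⟨π, fun {p q r} hr f y => ?_⟩
  rw [← Q.comp_act (add_zero _) hr i σ 1 π (fun t => t.elim0) ?_ f y, Q.act_one]
  intro t s ht hs
  obtain ⟨s', rfl⟩ := Fin.exists_succAbove_eq ht
  rw [hout] at hs
  rw [Fin.ext hs, ← hπ, hout]

theorem GradedOperad.plug_act (n : ℕ) {p : ZMod 2} (σ : Equiv.Perm (Fin n)) (f : Q.Op n p) :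
    Q.plug x n (Q.act σ f) = Q.plug x n f := by
  induction n with
  | zero => rw [Subsingleton.elim σ 1, Q.act_one]
  | succ n ih =>
    obtain ⟨π, hπ⟩ := Q.exists_perm n σ 0
    rw [← Q.plug_comp x n (σ 0), hπ, ih, Q.plug_comp]

theorem GradedOperad.comp_plug {a b c : ℕ} {p q r : ZMod 2} (h : a + 1 + b = c + 1)
    (hr : p + q = r) (i : Fin (a + 1)) (f : Q.Op (a + 1) p) (g : Q.Op b q) :
    Q.plug x c (Q.comp h hr i f g) = Q.plug x a (Q.comp (add_zero _) hr i f (Q.plug x b g)) := by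
  induction b generalizing c with
  | zero =>
    obtain rfl : a = c := by omega
    rfl
  | succ b ih =>
    obtain rfl : c = a + b + 1 := by omega
    rw [← Q.plug_comp x (a + b) ⟨i + b, by omega⟩,
      Q.comp_nested (b := b + 1) (c := 0) (bc := b) _ (add_zero _) _ (by omega) hr (add_zero q) _ hr i (Fin.last b) _ rfl, ih]
    rfl

theorem GradedOperad.plug_comp_symm (n : ℕ) {p q r : ZMod 2} (hr : p + q = r)
    (f : Q.Op (n + 1) p) (hf : ∀ σ, Q.act σ f = f) (y : Q.Op 0 q) (i : Fin (n + 1)) :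
    Q.plug x n (Q.comp (add_zero _) hr i f y) = Q.plug x n (Q.comp (add_zero _) hr 0 f y) := by
  obtain ⟨π, hπ⟩ := Q.exists_perm n (Equiv.swap 0 i) 0
  have := hπ hr f y
  rw [hf, Equiv.swap_apply_left] at this
  rw [this, Q.plug_act]

theorem GradedOperad.der_plug
    (δ : ∀ {n : ℕ} {p : ZMod 2}, Q.Op n p →ₗ[k] Q.Op n (p + 1))
    (hδ : ∀ {a b c : ℕ} {p q r : ZMod 2} (h : a + b = c + 1) (hr : p + q = r)
      (h₁ : p + 1 + q = r + 1) (h₂ : p + (q + 1) = r + 1) (i : Fin a) (f : Q.Op a p)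
      (g : Q.Op b q), δ (Q.comp h hr i f g) =
        Q.comp h h₁ i (δ f) g + psign p • Q.comp h h₂ i f (δ g))
    (n : ℕ) {p : ZMod 2} (f : Q.Op (n + 1) p) :
    δ (Q.plug x (n + 1) f) = Q.plug x (n + 1) (δ f) +
      psign p • ∑ i : Fin (n + 1), Q.plug x n (Q.comp (add_zero _) (by ring) i f (δ x)) := by
  induction n with
  | zero =>
    rw [Fin.sum_univ_one]
    exact hδ _ _ _ (by ring) _ f x
  | succ n ih =>
    change δ (Q.plug x (n + 1) (Q.comp (add_zero _) (add_zero p) (Fin.last (n + 1)) f x)) = _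
    rw [ih, hδ _ _ (add_zero _) (by ring), map_add, map_zsmul, Fin.sum_univ_castSucc (n := n + 1),
      smul_add, add_assoc, add_comm (psign p • _)]
    congr 1
    congr 1
    congr 1
    refine Finset.sum_congr rfl fun i _ => ?_
    have e := Q.comp_parallel (ab := n + 1) (ac := n + 1) (pr := p) (add_zero _) (add_zero _)
      (add_zero _) (add_zero _) (p := p) (q := 0 + 1) (r := 0) (pq := p + 1) (by ring) (add_zero _)
      (pqr := p + 1) (add_zero _) (by ring) i.castSucc (Fin.last (n + 1)) (Fin.last n) i
      (Fin.castSucc_lt_last i) rfl rfl f (δ x) x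
    have hs : psign ((0 + 1) * 0) = 1 := by decide
    rw [hs, one_smul] at e
    rw [← e]
    rfl
end Plug

/-- The curvature series squares to zero, if it is truncated where its terms vanish. -/
theorem GradedOperad.der_der_series {k : Type u} [Field k] [CharZero k] (Q : GradedOperad.{u, v} k)
    (x : Q.Op 0 0)
    (δ : ∀ {n : ℕ} {p : ZMod 2}, Q.Op n p →ₗ[k] Q.Op n (p + 1))
    (hδ : ∀ {a b c : ℕ} {p q r : ZMod 2} (h : a + b = c + 1) (hr : p + q = r)
      (h₁ : p + 1 + q = r + 1) (h₂ : p + (q + 1) = r + 1) (i : Fin a) (f : Q.Op a p)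
      (g : Q.Op b q), δ (Q.comp h hr i f g) =
        Q.comp h h₁ i (δ f) g + psign p • Q.comp h h₂ i f (δ g))
    (μ : ∀ n : ℕ, Q.Op (n + 1) 1) (hμ : ∀ (n : ℕ) (σ : Equiv.Perm (Fin (n + 1))),
      Q.act σ (μ n) = μ n)
    (hdμ : ∀ n : ℕ, δ (μ n) = ∑ j : Fin (n + 1), ∑ σ ∈ shuffles (n + 1) (n - j + 1),
      Q.act σ (Q.comp (by omega) rfl 0 (μ (j : ℕ)) (μ (n - j))))
    (N : ℕ) (hx : δ x = ∑ n ∈ Finset.range N, (((n + 1).factorial : k)⁻¹) • Q.plug x (n + 1) (μ n))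
    (hN : ∀ j l : ℕ, N ≤ j + l →
      Q.plug x j (Q.comp (add_zero _) rfl 0 (μ j) (Q.plug x (l + 1) (μ l))) = 0) :
    δ (δ x) = 0 := by
  set E : ℕ → ℕ → Q.Op 0 (1 + 1) := fun j l =>
    Q.plug x j (Q.comp (add_zero _) rfl 0 (μ j) (Q.plug x (l + 1) (μ l))) with hE
  have h1 : ∀ n, δ (Q.plug x (n + 1) (μ n)) =
      (∑ p ∈ Finset.HasAntidiagonal.antidiagonal n, ((n + 1).choose (p.2 + 1) : k) • E p.1 p.2) -
        ∑ l ∈ Finset.range N, (((n + 1 : ℕ) : k) * ((l + 1).factorial : k)⁻¹) • E n l := by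
    intro n
    have hs : psign 1 = -1 := by decide
    rw [Q.der_plug x δ hδ, hdμ, hs, neg_one_smul, ← sub_eq_add_neg]
    congr 1
    · rw [Finset.Nat.sum_antidiagonal_eq_sum_range_succ
        (fun a b => ((n + 1).choose (b + 1) : k) • E a b), ← Fin.sum_univ_eq_sum_range
        (fun j => ((n + 1).choose (n - j + 1) : k) • E j (n - j)), map_sum]
      refine Finset.sum_congr rfl fun j _ => ?_
      rw [map_sum]
      simp only [Q.plug_act]
      rw [Finset.sum_const, card_shuffles (by omega), Nat.cast_smul_eq_nsmul, Q.comp_plug]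
    · simp only [Q.plug_comp_symm x n _ (μ n) (hμ n)]
      rw [Finset.sum_const, Finset.card_univ, Fintype.card_fin, hx, map_sum, map_sum,
        Finset.smul_sum]
      refine Finset.sum_congr rfl fun l _ => ?_
      rw [map_smul, map_smul, ← Nat.cast_smul_eq_nsmul k, smul_smul]
  have h2 : δ (δ x) = ∑ n ∈ Finset.range N, (((n + 1).factorial : k)⁻¹) •
      δ (Q.plug x (n + 1) (μ n)) := by
    conv_lhs => rw [hx]
    erw [map_sum]
    refine Finset.sum_congr rfl fun n _ => ?_
    erw [map_smul]
  rw [h2]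
  simp only [h1, smul_sub, Finset.sum_sub_distrib, Finset.smul_sum, smul_smul]
  rw [sub_eq_zero]
  have h3 : ∀ n, ∀ p ∈ Finset.HasAntidiagonal.antidiagonal n,
      (((n + 1).factorial : k)⁻¹ * ((n + 1).choose (p.2 + 1) : k)) • E p.1 p.2 =
        ((p.1.factorial : k)⁻¹ * ((p.2 + 1).factorial : k)⁻¹) • E p.1 p.2 := by
    rintro n ⟨a, b⟩ hp
    obtain rfl : a + b = n := by simpa using hp
    congr 1
    have hc := Nat.add_choose_mul_factorial_mul_factorial a (b + 1)
    have hc' : ((a + b + 1).choose (b + 1) : k) * a.factorial * (b + 1).factorial =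
        (a + b + 1).factorial := by
      rw [← add_assoc] at hc
      exact_mod_cast hc
    have f1 : (a.factorial : k) ≠ 0 := by exact_mod_cast a.factorial_ne_zero
    have f2 : ((b + 1).factorial : k) ≠ 0 := by exact_mod_cast (b + 1).factorial_ne_zero
    have f3 : ((a + b + 1).factorial : k) ≠ 0 := by exact_mod_cast (a + b + 1).factorial_ne_zero
    field_simp
    rw [← hc']
  have h4 : ∀ n, ((n + 1).factorial : k)⁻¹ * ((n + 1 : ℕ) : k) = ((n.factorial : k)⁻¹) := by
    intro n
    have f1 : ((n + 1 : ℕ) : k) ≠ 0 := by exact_mod_cast n.succ_ne_zero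
    rw [Nat.factorial_succ, Nat.cast_mul, mul_inv, mul_comm, ← mul_assoc, mul_inv_cancel₀ f1,
      one_mul]
  simp only [← mul_assoc, h4]
  rw [Finset.sum_congr rfl fun n _ => Finset.sum_congr rfl (h3 n), Finset.sum_sigma',
    ← Finset.sum_product']
  refine Finset.sum_of_injOn (fun s => s.2) ?_ ?_ ?_ ?_
  · rintro ⟨n, p⟩ h ⟨n', p'⟩ h' e
    simp only [Finset.coe_sigma, Finset.mem_coe, Set.mem_sigma_iff, Finset.HasAntidiagonal.mem_antidiagonal]
      at h h' e
    subst e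
    have : n = n' := h.2.symm.trans h'.2
    subst this
    rfl
  · rintro ⟨n, p⟩ h
    simp only [Finset.coe_sigma, Set.mem_sigma_iff, Finset.mem_coe, Finset.HasAntidiagonal.mem_antidiagonal,
      Finset.mem_range] at h
    simp only [Finset.coe_product, Set.mem_prod, Finset.mem_coe, Finset.mem_range]
    omega
  · rintro ⟨a, b⟩ h hn
    simp only [E]
    rw [hN a b, smul_zero]
    by_contra hlt
    refine hn ⟨⟨a + b, (a, b)⟩, ?_, rfl⟩
    refine Finset.mem_coe.2 (Finset.mem_sigma.2 ⟨Finset.mem_range.2 (not_le.1 hlt), ?_⟩)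
    exact Finset.HasAntidiagonal.mem_antidiagonal.2 rfl
  · rintro ⟨n, p⟩ _
    rfl

/-! ### Adjoining a variable, and the Maurer–Cartan construction -/

/-- Generators of `O[x]`: all operations of `O` and an even operation `x` of arity zero. -/
inductive AdjGen {k : Type u} [Field k] (O : GradedOperad.{u, v} k) : ℕ → ZMod 2 → Type v
  | incl {n : ℕ} {p : ZMod 2} (f : O.Op n p) : AdjGen O n p
  | x : AdjGen O 0 0

theorem Term.map_sum {k : Type u} {G : ℕ → ZMod 2 → Type v} {G' : ℕ → ZMod 2 → Type w}
    (g : ∀ {n : ℕ} {p : ZMod 2}, G n p → G' n p) {n : ℕ} {p : ZMod 2} {ι : Type*}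
    (s : Finset ι) (f : ι → Term k G n p) :
    (Term.sum s f).map g = Term.sum s fun i => (f i).map g := by
  simp only [Term.sum]
  induction s.toList with
  | nil => rfl
  | cons a l ih => simp only [List.map_cons, List.foldr_cons, Term.map, ih]

section Adjoin

variable {k : Type u} [Field k] {O : GradedOperad.{u, v} k} {P : GradedOperad.{u, w} k}

/-- The number of occurrences of `x` in a formal expression; the smallest such number among the
summands for a sum. -/
noncomputable def xOrder : ∀ {n : ℕ} {p : ZMod 2}, Term k (AdjGen O) n p → ℕ∞
  | _, _, .gen (.incl _) => 0
  | _, _, .gen .x => 1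
  | _, _, .zero => ⊤
  | _, _, .add s t => min (xOrder s) (xOrder t)
  | _, _, .smul _ s => xOrder s
  | _, _, .act _ s => xOrder s
  | _, _, .comp _ _ _ s t => xOrder s + xOrder t

/-- The relations of the operad `O[x] / (x)^N`. The first four relations identify the formal
operations on elements of `O` with those of the graded operad `O`; together they present the operad
`O[x]` that is obtained from `O` by freely adjoining `x`. The last one divides by the `N`-th power
of the operadic ideal `(x)`, which consists of the expressions with at least `N` occurrences
of `x`. -/
inductive AdjRel (O : GradedOperad.{u, v} k) (N : ℕ) :
    ∀ {n : ℕ} {p : ZMod 2}, Term k (AdjGen O) n p → Term k (AdjGen O) n p → Prop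
  | incl_add {n : ℕ} {p : ZMod 2} (f g : O.Op n p) :
      AdjRel O N (.gen (.incl (f + g))) ((Term.gen (.incl f)).add (.gen (.incl g)))
  | incl_smul {n : ℕ} {p : ZMod 2} (c : k) (f : O.Op n p) :
      AdjRel O N (.gen (.incl (c • f))) ((Term.gen (.incl f)).smul c)
  | incl_act {n : ℕ} {p : ZMod 2} (σ : Equiv.Perm (Fin n)) (f : O.Op n p) :
      AdjRel O N (.gen (.incl (O.act σ f))) ((Term.gen (.incl f)).act σ)
  | incl_comp {a b c : ℕ} {p q r : ZMod 2} (h : a + b = c + 1) (hr : p + q = r) (i : Fin a)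
      (f : O.Op a p) (g : O.Op b q) :
      AdjRel O N (.gen (.incl (O.comp h hr i f g)))
        (.comp h hr i (.gen (.incl f)) (.gen (.incl g)))
  | power {n : ℕ} {p : ZMod 2} (t : Term k (AdjGen O) n p) : N ≤ xOrder t → AdjRel O N t .zero

/-- The presentation of the graded operad `O[x] / (x)^N`. -/
abbrev AdjPres (O : GradedOperad.{u, v} k) (N : ℕ) : Presentation.{u, v} k where
  Gen := AdjGen O
  Rel := AdjRel O N

/-- The inclusion of `O` into `O[x] / (x)^N`. -/
def AdjPres.incl (O : GradedOperad.{u, v} k) (N : ℕ) {n : ℕ} {p : ZMod 2} :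
    O.Op n p →ₗ[k] (AdjPres O N).operad.Op n p where
  toFun f := (AdjPres O N).cls (.gen (.incl f))
  map_add' f g := (AdjPres O N).cls_eq.2 (.rel (AdjRel.incl_add f g))
  map_smul' c f := (AdjPres O N).cls_eq.2 (.rel (AdjRel.incl_smul c f))

theorem AdjPres.cls_eq_zero (O : GradedOperad.{u, v} k) (N : ℕ) {n : ℕ} {p : ZMod 2}
    (t : Term k (AdjGen O) n p) (h : N ≤ xOrder t) : (AdjPres O N).cls t = 0 :=
  (AdjPres O N).cls_eq.2 (.rel (AdjRel.power t h))

theorem xOrder_sum {n : ℕ} {p : ZMod 2} {ι : Type*} (s : Finset ι)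
    (f : ι → Term k (AdjGen O) n p) (N : ℕ∞) (h : ∀ i, N ≤ xOrder (f i)) :
    N ≤ xOrder (Term.sum s f) := by
  rw [Term.sum]
  induction s.toList with
  | nil => exact le_top
  | cons a l ih => exact le_min (h a) ih

/-- The formal expression `t ∘ (x ⊗ … ⊗ x)`, with `x` inserted into all inputs of `t`, from the
last one to the first one. -/
def plugX : ∀ (n : ℕ) {p : ZMod 2}, Term k (AdjGen O) n p → Term k (AdjGen O) 0 p
  | 0, _, t => t
  | n + 1, p, t =>
    plugX n (.comp (add_zero (n + 1)) (add_zero p) (Fin.last n) t (.gen .x))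

theorem xOrder_plugX (n : ℕ) {p : ZMod 2} (t : Term k (AdjGen O) n p) :
    xOrder (plugX n t) = xOrder t + n := by
  induction n with
  | zero => simp [plugX]
  | succ n ih =>
    rw [plugX, ih]
    simp only [xOrder, Nat.cast_add, Nat.cast_one]
    ring

theorem AdjPres.cls_plugX (N n : ℕ) {p : ZMod 2} (t : Term k (AdjGen O) n p) :
    (AdjPres O N).cls (plugX n t) =
      (AdjPres O N).operad.plug ((AdjPres O N).cls (.gen .x)) n ((AdjPres O N).cls t) := by
  induction n with
  | zero => rfl
  | succ n ih => rw [plugX, ih]; rfl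

/-- The map of generators that is given by a map `O → P` and `x ↦ x`. -/
def AdjGen.map (ρ : O.Hom P) : ∀ {n : ℕ} {p : ZMod 2}, AdjGen O n p → AdjGen P n p
  | _, _, .incl f => .incl (ρ.map f)
  | _, _, .x => .x

theorem xOrder_map (ρ : O.Hom P) {n : ℕ} {p : ZMod 2} (t : Term k (AdjGen O) n p) :
    xOrder (t.map (AdjGen.map ρ)) = xOrder t := by
  induction t with
  | gen y => cases y <;> rfl
  | zero => rfl
  | add s t hs ht => simp only [xOrder, Term.map, hs, ht]
  | smul c s hs => simp only [xOrder, Term.map, hs]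
  | act σ s hs => simp only [xOrder, Term.map, hs]
  | comp h hr i s t hs ht => simp only [xOrder, Term.map, hs, ht]

theorem map_plugX (ρ : O.Hom P) (n : ℕ) {p : ZMod 2} (t : Term k (AdjGen O) n p) :
    (plugX n t).map (AdjGen.map ρ) = plugX n (t.map (AdjGen.map ρ)) := by
  induction n with
  | zero => rfl
  | succ n ih => rw [plugX, ih]; rfl

end Adjoin

section MC

variable {k : Type u} [Field k] {O : DGOperad.{u, v} k} {P : DGOperad.{u, w} k}

/-- The partial sum `∑ (1 / n!) φ(m_n) ∘ (x ⊗ … ⊗ x)` over `n = 1, …, N`. -/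
noncomputable def curvature (φ : (LInfty k).Hom O) (N : ℕ) :
    Term k (AdjGen O.toGradedOperad) 0 1 :=
  Term.sum (Finset.range N) fun n =>
    (plugX (n + 1) (.gen (.incl (φ.map (LInfty.m k n))))).smul (((n + 1).factorial : k)⁻¹)

/-- The differential of `O_MC`, modulo `(x)^N`, on generators. -/
noncomputable def AdjGen.diff (φ : (LInfty k).Hom O) (N : ℕ) : ∀ {n : ℕ} {p : ZMod 2},
    AdjGen O.toGradedOperad n p → Term k (AdjGen O.toGradedOperad) n (p + 1)
  | _, _, .incl f => .gen (.incl (O.d rfl f))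
  | _, _, .x => curvature φ N

theorem xOrder_der (φ : (LInfty k).Hom O) (N : ℕ) {n : ℕ} {p : ZMod 2}
    (t : Term k (AdjGen O.toGradedOperad) n p) :
    xOrder t ≤ xOrder (t.der (AdjGen.diff φ N)) := by
  induction t with
  | gen y =>
    cases y with
    | incl f => exact zero_le
    | x =>
      refine xOrder_sum _ _ _ fun n => ?_
      change 1 ≤ xOrder (plugX (n + 1) _)
      rw [xOrder_plugX]
      refine le_add_left ?_
      exact_mod_cast Nat.le_add_left 1 n
  | zero => exact le_top
  | add s t hs ht => exact min_le_min hs ht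
  | smul c s hs => exact hs
  | act σ s hs => exact hs
  | comp h hr i s t hs ht =>
    exact le_min (add_le_add_left hs _) (add_le_add_right ht _)

theorem AdjRel.der (φ : (LInfty k).Hom O) (N : ℕ) {n : ℕ} {p : ZMod 2}
    (s t : Term k (AdjGen O.toGradedOperad) n p) (h : AdjRel O.toGradedOperad N s t) :
    (AdjPres O.toGradedOperad N).Eqv (s.der (AdjGen.diff φ N)) (t.der (AdjGen.diff φ N)) := by
  rw [← Presentation.cls_eq]
  cases h with
  | incl_add f g =>
    change AdjPres.incl _ N (O.d rfl (f + g)) =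
      AdjPres.incl _ N (O.d rfl f) + AdjPres.incl _ N (O.d rfl g)
    rw [map_add, map_add]
  | incl_smul c f =>
    change AdjPres.incl _ N (O.d rfl (c • f)) = c • AdjPres.incl _ N (O.d rfl f)
    rw [map_smul, map_smul]
  | incl_act σ f =>
    change AdjPres.incl _ N (O.d rfl (O.act σ f)) = _
    rw [O.d_act]
    exact Presentation.cls_eq _ |>.2 (.rel (AdjRel.incl_act σ _))
  | @incl_comp a b c p q r h hr i f g =>
    subst hr
    change AdjPres.incl _ N (O.d rfl (O.comp h rfl i f g)) = _
    rw [O.d_comp h rfl rfl rfl rfl (add_right_comm p 1 q) (add_assoc p q 1).symm, map_add,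
      map_zsmul, Presentation.cls_der_comp]
    congr 1
    · exact Presentation.cls_eq _ |>.2 (.rel (AdjRel.incl_comp _ _ _ _ _))
    · congr 1
      exact Presentation.cls_eq _ |>.2 (.rel (AdjRel.incl_comp _ _ _ _ _))
  | power t h => exact AdjPres.cls_eq_zero _ N _ (h.trans (xOrder_der φ N _))

theorem AdjGen.diff_diff [CharZero k] (φ : (LInfty k).Hom O) (N : ℕ) {n : ℕ} {p : ZMod 2}
    (y : AdjGen O.toGradedOperad n p) :
    (AdjPres O.toGradedOperad N).cls ((y.diff φ N).der (AdjGen.diff φ N)) = 0 := by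
  cases y with
  | incl f =>
    change AdjPres.incl _ N (O.d rfl (O.d rfl f)) = 0
    rw [O.d_d, map_zero]
  | x =>
    let X := AdjPres O.toGradedOperad N
    let δ : ∀ {n : ℕ} {p : ZMod 2}, X.operad.Op n p →ₗ[k] X.operad.Op n (p + 1) :=
      X.diff (AdjGen.diff φ N) (AdjRel.der φ N)
    have hδ : ∀ {a b c : ℕ} {p q r : ZMod 2} (h : a + b = c + 1) (hr : p + q = r)
        (h₁ : p + 1 + q = r + 1) (h₂ : p + (q + 1) = r + 1) (i : Fin a) (f : X.operad.Op a p)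
        (g : X.operad.Op b q), δ (X.operad.comp h hr i f g) =
          X.operad.comp h h₁ i (δ f) g + psign p • X.operad.comp h h₂ i f (δ g) := by
      rintro a b c p q r h hr h₁ h₂ i ⟨f⟩ ⟨g⟩
      exact X.cls_der_comp (AdjGen.diff φ N) h hr i f g
    refine X.operad.der_der_series (X.cls (.gen .x)) δ hδ
      (fun n => AdjPres.incl _ N (φ.map (LInfty.m k n))) ?_ ?_ N ?_ ?_
    · intro n σ
      refine ((Presentation.cls_eq _).2 (.rel (AdjRel.incl_act σ _))).symm.trans ?_
      change AdjPres.incl _ N _ = _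
      rw [← φ.map_act, LInfty.act_m]
    · intro n
      change AdjPres.incl _ N (O.d rfl (φ.map (LInfty.m k n))) = _
      rw [← φ.map_d]
      refine (congrArg (fun f => AdjPres.incl _ N (φ.map f)) (LInfty.d_m k n)).trans ?_
      simp only [map_sum]
      refine Finset.sum_congr rfl fun j _ => Finset.sum_congr rfl fun σ _ => ?_
      rw [φ.map_act, φ.map_comp]
      refine ((Presentation.cls_eq _).2 (.rel (AdjRel.incl_act σ _))).trans ?_
      change X.operad.act σ (X.cls (.gen (.incl _))) = _
      refine congrArg (X.operad.act σ) ?_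
      exact (Presentation.cls_eq _).2 (.rel (AdjRel.incl_comp _ _ _ _ _))
    · change X.cls (curvature φ N) = _
      rw [curvature, X.cls_sum]
      refine Finset.sum_congr rfl fun n _ => ?_
      rw [X.cls_smul, AdjPres.cls_plugX]
      rfl
    · intro j l hjl
      have := AdjPres.cls_eq_zero O.toGradedOperad N
        (plugX j (.comp (add_zero _) rfl 0 (.gen (.incl (φ.map (LInfty.m k j))))
          (plugX (l + 1) (.gen (.incl (φ.map (LInfty.m k l))))))) (by
            rw [xOrder_plugX, xOrder, xOrder_plugX]
            simp only [xOrder, zero_add]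
            norm_cast
            omega)
      rw [AdjPres.cls_plugX, Presentation.cls_comp, AdjPres.cls_plugX] at this
      exact this

/-- The presentation of the dg operad `O_MC / (x)^N`. -/
noncomputable abbrev MCPres [CharZero k] (φ : (LInfty k).Hom O) (N : ℕ) :
    DGPresentation.{u, v} k where
  toPresentation := AdjPres O.toGradedOperad N
  diffGen := AdjGen.diff φ N
  diffGen_rel := AdjRel.der φ N
  diffGen_diffGen := AdjGen.diff_diff φ N

/-- The projection from `O_MC / (x)^(N + 1)` to `O_MC / (x)^N`. -/
noncomputable def MCPres.proj [CharZero k] (φ : (LInfty k).Hom O) (N : ℕ) :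
    (MCPres φ (N + 1)).operad.Hom (MCPres φ N).operad :=
  DGPresentation.map _ _ (fun y => y)
    (by
      intro n p s t h
      rw [Term.map_id, Term.map_id]
      cases h with
      | incl_add f g => exact .rel (AdjRel.incl_add f g)
      | incl_smul c f => exact .rel (AdjRel.incl_smul c f)
      | incl_act σ f => exact .rel (AdjRel.incl_act σ f)
      | incl_comp h hr i f g => exact .rel (AdjRel.incl_comp h hr i f g)
      | power t h => exact .rel (AdjRel.power _ (le_trans (by exact_mod_cast N.le_succ) h)))
    (by
      intro n p y
      rw [Term.map_id]
      cases y with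
      | incl f => rfl
      | x =>
        change (AdjPres O.toGradedOperad N).cls (curvature φ (N + 1)) =
          (AdjPres O.toGradedOperad N).cls (curvature φ N)
        rw [curvature, curvature, Presentation.cls_sum, Presentation.cls_sum,
          Finset.sum_range_succ, AdjPres.cls_eq_zero _ N (Term.smul _ _), add_zero]
        rw [xOrder, xOrder_plugX]
        exact le_add_left (by exact_mod_cast N.le_succ))

theorem MCPres.proj_cls [CharZero k] (φ : (LInfty k).Hom O) (N : ℕ) {n : ℕ} {p : ZMod 2}
    (t : Term k (AdjGen O.toGradedOperad) n p) :
    (MCPres.proj φ N).map ((MCPres φ (N + 1)).cls t) = (MCPres φ N).cls t := by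
  refine ((AdjPres O.toGradedOperad N).eval_gen (fun y => y) t).trans ?_
  rw [Term.map_id]

/-- The map from `O_MC / (x)^N` to `P_MC / (x)^N` that is induced by a map `ρ : O → P` under
`L_∞`: it is `ρ` on `O`, and `x ↦ x`. -/
noncomputable def MCPres.map [CharZero k] (φ : (LInfty k).Hom O) (ψ : (LInfty k).Hom P)
    (ρ : O.Hom P) (h : ρ.comp φ = ψ) (N : ℕ) : (MCPres φ N).operad.Hom (MCPres ψ N).operad :=
  DGPresentation.map _ _ (AdjGen.map ρ.toHom)
    (by
      intro n p s t h
      cases h with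
      | incl_add f g =>
        simp only [Term.map, AdjGen.map, map_add]
        exact .rel (AdjRel.incl_add _ _)
      | incl_smul c f =>
        simp only [Term.map, AdjGen.map, map_smul]
        exact .rel (AdjRel.incl_smul _ _)
      | incl_act σ f =>
        simp only [Term.map, AdjGen.map, ρ.map_act]
        exact .rel (AdjRel.incl_act _ _)
      | incl_comp h hr i f g =>
        simp only [Term.map, AdjGen.map, ρ.map_comp]
        exact .rel (AdjRel.incl_comp _ _ _ _ _)
      | power t h => exact .rel (AdjRel.power _ (by rwa [xOrder_map])))
    (by
      subst h
      intro n p y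
      cases y with
      | incl f =>
        change AdjPres.incl _ N (ρ.map (O.d rfl f)) = AdjPres.incl _ N (P.d rfl (ρ.map f))
        rw [ρ.map_d]
      | x =>
        change (AdjPres P.toGradedOperad N).cls ((curvature φ N).map (AdjGen.map ρ.toHom)) =
          (AdjPres P.toGradedOperad N).cls (curvature (ρ.comp φ) N)
        rw [curvature, curvature, Term.map_sum]
        simp only [Term.map, map_plugX]
        rfl)

theorem MCPres.map_cls [CharZero k] (φ : (LInfty k).Hom O) (ψ : (LInfty k).Hom P)
    (ρ : O.Hom P) (h : ρ.comp φ = ψ) (N : ℕ) {n : ℕ} {p : ZMod 2}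
    (t : Term k (AdjGen O.toGradedOperad) n p) :
    (MCPres.map φ ψ ρ h N).map ((MCPres φ N).cls t) =
      (MCPres ψ N).cls (t.map (AdjGen.map ρ.toHom)) :=
  (AdjPres P.toGradedOperad N).eval_gen (AdjGen.map ρ.toHom) t

end MC

section Limit

variable {k : Type u} [Field k]

/-- The compatible families of operations of a tower `⋯ → T 2 → T 1 → T 0` of dg operads. -/
def limOp (T : ℕ → DGOperad.{u, v} k) (π : ∀ N, (T (N + 1)).Hom (T N)) (n : ℕ) (p : ZMod 2) :
    Submodule k (∀ N, (T N).Op n p) where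
  carrier := {f | ∀ N, (π N).map (f (N + 1)) = f N}
  add_mem' := by
    intro f g hf hg N
    rw [Pi.add_apply, map_add, hf, hg, Pi.add_apply]
  zero_mem' := by
    intro N
    rw [Pi.zero_apply, map_zero, Pi.zero_apply]
  smul_mem' := by
    intro c f hf N
    rw [Pi.smul_apply, map_smul, hf, Pi.smul_apply]

/-- The inverse limit of a tower of dg operads. -/
def DGOperad.lim (T : ℕ → DGOperad.{u, v} k) (π : ∀ N, (T (N + 1)).Hom (T N)) :
    DGOperad.{u, v} k where
  Op n p := limOp T π n p
  act σ :=
    { toFun := fun f => ⟨fun N => (T N).act σ (f.1 N), fun N => by rw [(π N).map_act, f.2]⟩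
      map_add' := fun f g => Subtype.ext (funext fun N => map_add _ _ _)
      map_smul' := fun c f => Subtype.ext (funext fun N => map_smul _ _ _) }
  comp h hr i :=
    LinearMap.mk₂ k
      (fun f g => ⟨fun N => (T N).comp h hr i (f.1 N) (g.1 N), fun N => by
        rw [(π N).map_comp, f.2, g.2]⟩)
      (fun f f' g => Subtype.ext (funext fun N => LinearMap.map_add₂ _ _ _ _))
      (fun c f g => Subtype.ext (funext fun N => LinearMap.map_smul₂ _ _ _ _))
      (fun f g g' => Subtype.ext (funext fun N => map_add _ _ _))
      (fun c f g => Subtype.ext (funext fun N => map_smul _ _ _))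
  act_one f := Subtype.ext (funext fun N => (T N).act_one _)
  act_mul σ τ f := Subtype.ext (funext fun N => (T N).act_mul σ τ _)
  comp_nested hab hbc h₁ h₂ hpq hqr hp₁ hp₂ i j i' hi' f g h :=
    Subtype.ext (funext fun N =>
      (T N).comp_nested hab hbc h₁ h₂ hpq hqr hp₁ hp₂ i j i' hi' _ _ _)
  comp_parallel hab hac h₁ h₂ hpq hpr hp₁ hp₂ i j j' i' hij hj' hi' f g h :=
    Subtype.ext (funext fun N =>
      (T N).comp_parallel hab hac h₁ h₂ hpq hpr hp₁ hp₂ i j j' i' hij hj' hi' _ _ _)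
  comp_act h hp i σ τ π hτ hσ f g :=
    Subtype.ext (funext fun N => (T N).comp_act h hp i σ τ π hτ hσ _ _)
  d hq :=
    { toFun := fun f => ⟨fun N => (T N).d hq (f.1 N), fun N => by rw [(π N).map_d, f.2]⟩
      map_add' := fun f g => Subtype.ext (funext fun N => map_add _ _ _)
      map_smul' := fun c f => Subtype.ext (funext fun N => map_smul _ _ _) }
  d_d hq hr f := Subtype.ext (funext fun N => (T N).d_d hq hr _)
  d_act hq σ f := Subtype.ext (funext fun N => (T N).d_act hq σ _)
  d_comp h hr hp' hq' hr' h₁ h₂ i f g :=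
    Subtype.ext (funext fun N => (T N).d_comp h hr hp' hq' hr' h₁ h₂ i _ _)

/-- The map of inverse limits that is induced by a map of towers. -/
def DGOperad.limMap (T : ℕ → DGOperad.{u, v} k) (π : ∀ N, (T (N + 1)).Hom (T N))
    (T' : ℕ → DGOperad.{u, w} k) (π' : ∀ N, (T' (N + 1)).Hom (T' N)) (ρ : ∀ N, (T N).Hom (T' N))
    (h : ∀ (N n : ℕ) (p : ZMod 2) (f : (T (N + 1)).Op n p),
      (π' N).map ((ρ (N + 1)).map f) = (ρ N).map ((π N).map f)) :
    (DGOperad.lim T π).Hom (DGOperad.lim T' π') where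
  map :=
    { toFun := fun f => ⟨fun N => (ρ N).map (f.1 N), fun N => by rw [h, f.2]⟩
      map_add' := fun f g => Subtype.ext (funext fun N => map_add _ _ _)
      map_smul' := fun c f => Subtype.ext (funext fun N => map_smul _ _ _) }
  map_act σ f := Subtype.ext (funext fun N => (ρ N).map_act σ _)
  map_comp h hr i f g := Subtype.ext (funext fun N => (ρ N).map_comp h hr i _ _)
  map_d hq f := Subtype.ext (funext fun N => (ρ N).map_d hq _)

end Limit

/-- The dg operad `O_MC` of a dg operad map `φ : L_∞ → O`. Its underlying graded operad is
`O[[x]]`, the inverse limit of the operads `O[x] / (x)^N`. Its differential restricts to the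
differential of `O`, and `d x = ∑ (1 / n!) φ(m_n) ∘ (x ⊗ … ⊗ x)` over `n = 1, 2, …`. -/
noncomputable def MC {k : Type u} [Field k] [CharZero k] (O : DGOperad.{u, v} k)
    (φ : (LInfty k).Hom O) : DGOperad.{u, max u v} k :=
  DGOperad.lim (fun N => (MCPres φ N).operad) (MCPres.proj φ)

/-- The map of dg operads `O_MC → P_MC` that is induced by a map `ρ : O → P` under `L_∞`: it is `ρ`
on `O`, and `x ↦ x`. -/
noncomputable def MC.map {k : Type u} [Field k] [CharZero k] {O : DGOperad.{u, v} k}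
    {P : DGOperad.{u, w} k} (φ : (LInfty k).Hom O) (ψ : (LInfty k).Hom P) (ρ : O.Hom P)
    (h : ρ.comp φ = ψ) : (MC O φ).Hom (MC P ψ) :=
  DGOperad.limMap _ _ _ _ (MCPres.map φ ψ ρ h) <| by
    intro N n p f
    obtain ⟨t, rfl⟩ := Presentation.cls_surj _ f
    rw [MCPres.map_cls, MCPres.proj_cls, MCPres.proj_cls, MCPres.map_cls]

/-- The dg operad `O_MC` of a dg operad map `φ : l_∞ → O`, that is of the composite of `φ` with the
quotient map `L_∞ → l_∞`. -/
noncomputable def MCl {k : Type u} [Field k] [CharZero k] (O : DGOperad.{u, v} k)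
    (φ : (lInfty k).Hom O) : DGOperad.{u, max u v} k :=
  MC O (φ.comp (lInfty.proj k))

/-- The map of dg operads `O_MC → P_MC` that is induced by a map `ρ : O → P` under `l_∞`: it is `ρ`
on `O`, and `x ↦ x`. -/
noncomputable def MCl.map {k : Type u} [Field k] [CharZero k] {O : DGOperad.{u, v} k}
    {P : DGOperad.{u, w} k} (φ : (lInfty k).Hom O) (ψ : (lInfty k).Hom P) (ρ : O.Hom P)
    (h : ρ.comp φ = ψ) : (MCl O φ).Hom (MCl P ψ) :=
  MC.map (φ.comp (lInfty.proj k)) (ψ.comp (lInfty.proj k)) ρ (by rw [← h]; rfl)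

end OperadMC

namespace OperadMC

/-! ### Positions of the inputs of a composition -/

/-! Filter `O_MC` by the number of occurrences of `x`. In arity `n` the layer with exactly `N`
occurrences consists of the operations of `O(n + N)` with `x` inserted into the last `N` inputs. It
is the space of coinvariants of `S_N` on `O(n + N)`. For `N = 1` and `n = 0` there is in addition
the line spanned by `x`, which is not an insertion into an operation because operads have no unit.
Since `m_1` acts by zero, `d x` lies in `(x)^2`, so each layer carries only the differential of `O`,
and `x` is a cycle in its layer. In characteristic zero coinvariants agree with invariants and form
an exact functor, so `ρ` is a quasi-isomorphism on each layer. `O_MC` is the limit of a tower of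
surjections that starts at zero, whence the quasi-isomorphism passes to the limit, one layer at a
time.

The main work is to identify the layers, because `O[x] / (x)^N` is given by generators and
relations. That the normal forms span (`AdjPres.exists_eq_sum_tail`) is a matter of moving all
insertions of `x` outwards and then to the last inputs. That they do not collapse needs a model. A
monomial is an operation together with an embedding that marks the inputs left open; linear
combinations of monomials satisfy the operad axioms modulo an explicit ideal
(`Presentation.Eqv.monomials_sub_mem`), so each functional that kills the ideal descends to `O[x] /
(x)^N`. Two kinds of functionals suffice: the symmetrised coefficient of a given weight, and the
coefficient of `x`. They give `AdjPres.eq_zero_of_sum_tail`.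

The homological part is elementwise. A quasi-isomorphism is a map whose mapping cone is acyclic
(`DGOperad.Hom.isQuasiIso_iff_coneAcyclic`). Acyclic cones on the kernels of a tower give an acyclic
cone on the limit (`DGOperad.limMap_coneAcyclic`), and the kernels are the layers
(`MCPres.kernel_coneAcyclic`). -/

theorem outerPos_lt {a b c : ℕ} (h : a + b = c + 1) (i t : Fin a) (ht : t ≠ i) :
    outerPos b i t < c := by
  have := Fin.val_ne_of_ne ht
  unfold outerPos
  split_ifs <;> omega

/-- The inputs `i, …, i + b - 1` come from `g`, all others from `f`. With `outerPos_inj` and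
`inner_ne_outerPos` the inputs of `f ∘_i g` become a disjoint union, and identities between
embeddings can be checked case by case. -/
theorem inner_or_outer {a b c : ℕ} (h : a + b = c + 1) (i : Fin a) (s : Fin c) :
    (∃ t : Fin b, (s : ℕ) = i + t) ∨ ∃ t : Fin a, t ≠ i ∧ (s : ℕ) = outerPos b i t := by
  by_cases h1 : (s : ℕ) < i
  · refine .inr ⟨⟨s, by omega⟩, ?_, ?_⟩
    · intro e
      have := congrArg Fin.val e
      simp only at this
      omega
    · simp [outerPos, h1]
  · by_cases h2 : (s : ℕ) < i + b
    · exact .inl ⟨⟨s - i, by omega⟩, by simp only; omega⟩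
    · refine .inr ⟨⟨s + 1 - b, by omega⟩, ?_, ?_⟩
      · intro e
        have := congrArg Fin.val e
        simp only at this
        omega
      · simp only [outerPos]
        split_ifs <;> omega

theorem outerPos_inj {a b : ℕ} {i t t' : Fin a} (ht : t ≠ i) (ht' : t' ≠ i)
    (e : outerPos b i t = outerPos b i t') : t = t' := by
  have := Fin.val_ne_of_ne ht
  have := Fin.val_ne_of_ne ht'
  unfold outerPos at e
  ext
  split_ifs at e <;> omega

theorem inner_ne_outerPos {a b : ℕ} {i t : Fin a} (ht : t ≠ i) (s : Fin b) :
    (i : ℕ) + s ≠ outerPos b i t := by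
  have := Fin.val_ne_of_ne ht
  unfold outerPos
  split_ifs <;> omega

theorem outerPos_one {n : ℕ} {i t : Fin n} (ht : t ≠ i) : outerPos 1 i t = t := by
  have := Fin.val_ne_of_ne ht
  unfold outerPos
  split_ifs <;> omega

theorem outerPos_zero_succAbove {n : ℕ} (i : Fin (n + 1)) (s : Fin n) :
    outerPos 0 i (i.succAbove s) = s := by
  rcases Fin.castSucc_lt_or_lt_succ i s with hlt | hlt
  · rw [Fin.succAbove_of_castSucc_lt _ _ hlt]
    have : (s : ℕ) < i := hlt
    simp [outerPos, this]
  · rw [Fin.succAbove_of_lt_succ _ _ hlt]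
    have : (i : ℕ) < s + 1 := hlt
    simp only [outerPos, Fin.val_succ]
    split_ifs <;> omega

/-- The embedding `e''` of the inputs of `f ∘_i g` that is induced by embeddings `e` and `e'` of the
inputs of `f` and of `g` (into the inputs of operations with more inputs). -/
structure IsGraft {a b c m m' M : ℕ} (i : Fin a) (e : Fin a ↪ Fin m) (e' : Fin b ↪ Fin m')
    (e'' : Fin c ↪ Fin M) : Prop where
  inner : ∀ (t : Fin b) (s : Fin c), (s : ℕ) = i + t → (e'' s : ℕ) = e i + e' t
  outer : ∀ (t : Fin a) (s : Fin c), t ≠ i → (s : ℕ) = outerPos b i t →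
    (e'' s : ℕ) = outerPos m' (e i) (e t)

/-- Each input is inner or outer in exactly one way, so the two clauses prescribe one value; the
same dichotomy in the target gives injectivity. -/
theorem exists_isGraft {a b c m m' M : ℕ} (h : a + b = c + 1) (H : m + m' = M + 1) (i : Fin a)
    (e : Fin a ↪ Fin m) (e' : Fin b ↪ Fin m') :
    ∃ e'' : Fin c ↪ Fin M, IsGraft i e e' e'' := by
  have key : ∀ s : Fin c, ∃ y : Fin M, (∀ t : Fin b, (s : ℕ) = i + t → (y : ℕ) = e i + e' t) ∧
      ∀ t : Fin a, t ≠ i → (s : ℕ) = outerPos b i t → (y : ℕ) = outerPos m' (e i) (e t) := by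
    intro s
    rcases inner_or_outer h i s with ⟨t, ht⟩ | ⟨t, ht, hs⟩
    · refine ⟨⟨e i + e' t, by omega⟩, fun t' ht' => ?_, fun t' ht' hs => ?_⟩
      · obtain rfl : t = t' := Fin.ext (by omega)
        rfl
      · exact absurd (ht.symm.trans hs) (inner_ne_outerPos ht' t)
    · refine ⟨⟨outerPos m' (e i) (e t), outerPos_lt H _ _ (e.injective.ne ht)⟩,
        fun t' ht' => ?_, fun t' ht' hs' => ?_⟩
      · exact absurd (ht'.symm.trans hs) (inner_ne_outerPos ht t')
      · obtain rfl := outerPos_inj ht ht' (hs.symm.trans hs')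
        rfl
  choose y h1 h2 using key
  refine ⟨⟨y, fun s s' hy => ?_⟩, ⟨fun t s => h1 s t, fun t s => h2 s t⟩⟩
  have hy' := congrArg Fin.val hy
  rcases inner_or_outer h i s with ⟨t, ht⟩ | ⟨t, ht, hs⟩ <;>
    rcases inner_or_outer h i s' with ⟨t', ht'⟩ | ⟨t', ht', hs'⟩
  · rw [h1 s t ht, h1 s' t' ht'] at hy'
    obtain rfl : t = t' := e'.injective (Fin.ext (by omega))
    exact Fin.ext (by omega)
  · rw [h1 s t ht, h2 s' t' ht' hs'] at hy'
    exact absurd hy' (inner_ne_outerPos (e.injective.ne ht') _)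
  · rw [h1 s' t' ht', h2 s t ht hs] at hy'
    exact absurd hy'.symm (inner_ne_outerPos (e.injective.ne ht) _)
  · rw [h2 s t ht hs, h2 s' t' ht' hs'] at hy'
    obtain rfl := e.injective (outerPos_inj (e.injective.ne ht) (e.injective.ne ht') hy')
    exact Fin.ext (by omega)

/-- The induced embedding of the inputs of a composition. -/
noncomputable def graft {a b c m m' M : ℕ} (h : a + b = c + 1) (H : m + m' = M + 1) (i : Fin a)
    (e : Fin a ↪ Fin m) (e' : Fin b ↪ Fin m') : Fin c ↪ Fin M :=
  (exists_isGraft h H i e e').choose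

theorem isGraft_graft {a b c m m' M : ℕ} (h : a + b = c + 1) (H : m + m' = M + 1) (i : Fin a)
    (e : Fin a ↪ Fin m) (e' : Fin b ↪ Fin m') : IsGraft i e e' (graft h H i e e') :=
  (exists_isGraft h H i e e').choose_spec

/-- The two clauses cover all inputs. Every identity between grafts below is proved by checking the
clauses for the other side. -/
theorem IsGraft.unique {a b c m m' M : ℕ} (h : a + b = c + 1) {i : Fin a}
    {e : Fin a ↪ Fin m} {e' : Fin b ↪ Fin m'} {e₁ e₂ : Fin c ↪ Fin M} (h₁ : IsGraft i e e' e₁)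
    (h₂ : IsGraft i e e' e₂) : e₁ = e₂ := by
  ext s
  rcases inner_or_outer h i s with ⟨t, ht⟩ | ⟨t, ht, hs⟩
  · rw [h₁.inner t s ht, h₂.inner t s ht]
  · rw [h₁.outer t s ht hs, h₂.outer t s ht hs]

theorem outerPos_outerPos_nested {a b ab c : ℕ} (hab : a + b = ab + 1) {i t : Fin a} (ht : t ≠ i)
    (j : Fin b) : outerPos c (i + j) (outerPos b i t) = outerPos (b + c - 1) i t := by
  have := Fin.val_ne_of_ne ht
  unfold outerPos
  split_ifs <;> omega

theorem outerPos_nested {a b c : ℕ} (i : Fin a) {j t : Fin b} (ht : t ≠ j) :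
    outerPos c (i + j) (i + t) = i + outerPos c j t := by
  have := Fin.val_ne_of_ne ht
  unfold outerPos
  split_ifs <;> omega

/-- `(f ∘_i g) ∘_{i + j} h = f ∘_i (g ∘_j h)` for embeddings. -/
theorem graft_nested {a b c ab bc abc m n l mn nl mnl : ℕ}
    (hab : a + b = ab + 1) (hbc : b + c = bc + 1) (h₁ : ab + c = abc + 1) (h₂ : a + bc = abc + 1)
    (hmn : m + n = mn + 1) (hnl : n + l = nl + 1) (H₁ : mn + l = mnl + 1) (H₂ : m + nl = mnl + 1)
    (i : Fin a) (j : Fin b) (i' : Fin ab) (hi' : (i' : ℕ) = i + j)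
    (e : Fin a ↪ Fin m) (e' : Fin b ↪ Fin n) (e'' : Fin c ↪ Fin l) :
    graft h₁ H₁ i' (graft hab hmn i e e') e'' = graft h₂ H₂ i e (graft hbc hnl j e' e'') := by
  have A := isGraft_graft hab hmn i e e'
  have B := isGraft_graft hbc hnl j e' e''
  have C := isGraft_graft h₁ H₁ i' (graft hab hmn i e e') e''
  refine IsGraft.unique h₂ ⟨fun s x hx => ?_, fun t x ht hx => ?_⟩ (isGraft_graft h₂ H₂ i e _)
  · rcases inner_or_outer hbc j s with ⟨t, hs⟩ | ⟨t, ht, hs⟩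
    · rw [C.inner t x (by omega), A.inner j i' hi', B.inner t s hs]
      omega
    · have hu : (i : ℕ) + t < ab := by omega
      rw [C.outer ⟨i + t, hu⟩ x (fun E => ht (Fin.ext (by have := congrArg Fin.val E; simp only at this; omega)))
        (by rw [hi', outerPos_nested i ht]; omega), A.inner j i' hi', A.inner t _ rfl,
        B.outer t s ht hs, outerPos_nested _ (e'.injective.ne ht)]
  · have hu := outerPos_lt hab i t ht
    rw [C.outer ⟨outerPos b i t, hu⟩ x
      (fun E => inner_ne_outerPos ht j (by rw [← hi', ← E]))
      (by rw [hi', outerPos_outerPos_nested hab ht, hx]; congr 1; omega),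
      A.inner j i' hi', A.outer t _ ht rfl, outerPos_outerPos_nested hmn (e.injective.ne ht)]
    congr 1
    omega

theorem outerPos_outerPos_parallel {a b c : ℕ} {i j t : Fin a} (hij : i ≠ j) (hi : t ≠ i)
    (hj : t ≠ j) : outerPos c (outerPos b i j) (outerPos b i t) =
      outerPos b (outerPos c j i) (outerPos c j t) := by
  have := Fin.val_ne_of_ne hi
  have := Fin.val_ne_of_ne hj
  have := Fin.val_ne_of_ne hij
  unfold outerPos
  split_ifs <;> omega

theorem outerPos_add {a b c : ℕ} {i j : Fin a} (hij : i ≠ j) (t : Fin b) :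
    outerPos c (outerPos b i j) (i + t) = outerPos c j i + t := by
  have := Fin.val_ne_of_ne hij
  unfold outerPos
  split_ifs <;> omega

/-- `(f ∘_i g) ∘_j h = (f ∘_j h) ∘_i g` for embeddings. -/
theorem graft_parallel {a b c ab ac abc m n l mn ml mnl : ℕ}
    (hab : a + b = ab + 1) (hac : a + c = ac + 1) (h₁ : ab + c = abc + 1) (h₂ : ac + b = abc + 1)
    (hmn : m + n = mn + 1) (hml : m + l = ml + 1) (H₁ : mn + l = mnl + 1) (H₂ : ml + n = mnl + 1)
    (i j : Fin a) (hij : i ≠ j) (j' : Fin ab) (i' : Fin ac) (hj' : (j' : ℕ) = outerPos b i j)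
    (hi' : (i' : ℕ) = outerPos c j i)
    (e : Fin a ↪ Fin m) (e' : Fin b ↪ Fin n) (e'' : Fin c ↪ Fin l) :
    graft h₁ H₁ j' (graft hab hmn i e e') e'' = graft h₂ H₂ i' (graft hac hml j e e'') e' := by
  have A := isGraft_graft hab hmn i e e'
  have B := isGraft_graft hac hml j e e''
  have C := isGraft_graft h₁ H₁ j' (graft hab hmn i e e') e''
  have hji := hij.symm
  have ne := e.injective.ne hij
  have ej := A.outer j j' hji hj'
  have ei := B.outer i i' hij hi'
  refine IsGraft.unique h₂ ⟨fun t x hx => ?_, fun s x hs hx => ?_⟩ (isGraft_graft h₂ H₂ i' _ e')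
  · have hu : (i : ℕ) + t < ab := by omega
    rw [C.outer ⟨i + t, hu⟩ x
      (fun E => inner_ne_outerPos hji t (by rw [← hj', ← E]))
      (by rw [hj', outerPos_add hij, hx, hi']), ej, A.inner t _ rfl, ei, outerPos_add ne]
  · rcases inner_or_outer hac j s with ⟨t, ht⟩ | ⟨t, ht, hs'⟩
    · rw [C.inner t x (by rw [hx, hi', ht, hj', outerPos_add hji]), B.inner t s ht, ej, ei,
        outerPos_add ne.symm]
    · have hti : t ≠ i := by
        rintro rfl
        exact hs (Fin.ext (hs'.trans hi'.symm))
      have hu := outerPos_lt hab i t hti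
      rw [C.outer ⟨outerPos b i t, hu⟩ x
        (fun E => ht (outerPos_inj hti hji (by rw [← hj', ← E])))
        (by rw [hj', outerPos_outerPos_parallel hij hti ht, hx, hi', hs']), ej, ei,
        A.outer t _ hti rfl, B.outer t s ht hs',
        outerPos_outerPos_parallel ne (e.injective.ne hti) (e.injective.ne ht)]

/-- Renumbering the inputs of the large operations. The conditions on `π` are those of the
equivariance axiom, so this shows that composition respects `MonRel.perm`. -/
theorem IsGraft.perm_comp {a b c m m' M : ℕ} {i : Fin a}
    {e : Fin a ↪ Fin m} {e' : Fin b ↪ Fin m'} {e'' : Fin c ↪ Fin M} (h₁ : IsGraft i e e' e'')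
    {σ : Equiv.Perm (Fin m)} {τ : Equiv.Perm (Fin m')} {π : Equiv.Perm (Fin M)}
    (hτ : ∀ (t : Fin m') (s : Fin M), (s : ℕ) = e i + t → (π s : ℕ) = σ (e i) + τ t)
    (hσ : ∀ (t : Fin m) (s : Fin M), t ≠ e i → (s : ℕ) = outerPos m' (e i) t →
      (π s : ℕ) = outerPos m' (σ (e i)) (σ t)) :
    IsGraft i (e.trans σ.toEmbedding) (e'.trans τ.toEmbedding) (e''.trans π.toEmbedding) where
  inner t s hs := hτ _ _ (h₁.inner t s hs)
  outer t s ht hs := hσ _ _ (e.injective.ne ht) (h₁.outer t s ht hs)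

/-- Renumbering the open inputs instead; this gives the equivariance of the composition of
monomials. -/
theorem IsGraft.comp_perm {a b c m m' M : ℕ} {i : Fin a}
    {σ : Equiv.Perm (Fin a)} {τ : Equiv.Perm (Fin b)} {π : Equiv.Perm (Fin c)}
    {e : Fin a ↪ Fin m} {e' : Fin b ↪ Fin m'} {e'' : Fin c ↪ Fin M} (h₁ : IsGraft (σ i) e e' e'')
    (hτ : ∀ (t : Fin b) (s : Fin c), (s : ℕ) = i + t → (π s : ℕ) = σ i + τ t)
    (hσ : ∀ (t : Fin a) (s : Fin c), t ≠ i → (s : ℕ) = outerPos b i t →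
      (π s : ℕ) = outerPos b (σ i) (σ t)) :
    IsGraft i (σ.toEmbedding.trans e) (τ.toEmbedding.trans e') (π.toEmbedding.trans e'') where
  inner t s hs := h₁.inner _ _ (hτ _ _ hs)
  outer t s ht hs := h₁.outer _ _ (σ.injective.ne ht) (hσ _ _ ht hs)

theorem bijective_of_injective {n : ℕ} (e : Fin n ↪ Fin n) : Function.Bijective e :=
  Finite.injective_iff_bijective.1 e.injective

/-- The permutation of the inputs of a composition that is induced by permutations of the inputs of
its factors. -/
theorem exists_graft_perm {a b c : ℕ} (h : a + b = c + 1) (i : Fin a) (σ : Equiv.Perm (Fin a))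
    (τ : Equiv.Perm (Fin b)) : ∃ π : Equiv.Perm (Fin c),
      (∀ (t : Fin b) (s : Fin c), (s : ℕ) = i + t → (π s : ℕ) = σ i + τ t) ∧
      ∀ (t : Fin a) (s : Fin c), t ≠ i → (s : ℕ) = outerPos b i t →
        (π s : ℕ) = outerPos b (σ i) (σ t) :=
  have A := isGraft_graft h h i σ.toEmbedding τ.toEmbedding
  ⟨.ofBijective _ (bijective_of_injective (graft h h i σ.toEmbedding τ.toEmbedding)),
    A.inner, A.outer⟩

/-! ### A model of the operad with a freely adjoined variable -/

/-- Monomials in an adjoined variable `x`: `op e f` is the operation `f` with `x` inserted into the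
inputs that are not in the image of `e`, and `var` is `x` itself. -/
inductive Mon {k : Type u} [Field k] (O : GradedOperad.{u, v} k) : ℕ → ZMod 2 → Type v
  | op {n m : ℕ} {p : ZMod 2} (e : Fin n ↪ Fin m) (f : O.Op m p) : Mon O n p
  | var : Mon O 0 0

section Monomials

variable {k : Type u} [Field k] {O : GradedOperad.{u, v} k}

/-- The number of occurrences of the variable. -/
def Mon.weight : ∀ {n : ℕ} {p : ZMod 2}, Mon O n p → ℕ
  | n, _, .op (m := m) _ _ => m - n
  | _, _, .var => 1

/-- Permutations of the inputs of a monomial. -/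
def Mon.act : ∀ {n : ℕ} {p : ZMod 2}, Equiv.Perm (Fin n) → Mon O n p → Mon O n p
  -- Input `t` becomes input `σ t`; the inverse makes this a left action.
  | _, _, σ, .op e f => .op (σ.symm.toEmbedding.trans e) f
  | _, _, _, .var => .var

/-- Partial composition of monomials. -/
noncomputable def Mon.comp {a b c : ℕ} {p q r : ZMod 2} (h : a + b = c + 1) (hr : p + q = r)
    (i : Fin a) : Mon O a p → Mon O b q → Mon O c r
  | .op (m := m) e f, .op (m := m') e' g =>
    .op (graft (M := m + m' - 1) h (by have := (e i).pos; omega) i e e')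
      (O.comp (by have := (e i).pos; omega) hr (e i) f g)
  -- Inserting `x` leaves `f` unchanged and only closes the input `e i`. For the embeddings `x`
  -- behaves like an identity operation whose single input is closed, hence the empty embedding into
  -- `Fin 1`.
  | .op (m := m) e f, .var =>
    .op (graft h (rfl : m + 1 = m + 1) i e (.ofIsEmpty : Fin 0 ↪ Fin 1))
      ((by simpa using hr : p = r) ▸ f)
  | .var, _ => i.elim0

/-- Allows any expression for the total arity in place of the truncated subtraction. -/
theorem Mon.comp_op {a b c m m' M : ℕ} {p q r : ZMod 2} (h : a + b = c + 1) (hr : p + q = r)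
    (i : Fin a) (H : m + m' = M + 1) (e : Fin a ↪ Fin m) (f : O.Op m p) (e' : Fin b ↪ Fin m')
    (g : O.Op m' q) : Mon.comp h hr i (.op e f) (.op e' g) =
      .op (graft h H i e e') (O.comp H hr (e i) f g) := by
  obtain rfl : M = m + m' - 1 := by omega
  rfl

theorem Mon.comp_var {a c m : ℕ} {p : ZMod 2} (h : a + 0 = c + 1) (hr : p + 0 = p)
    (i : Fin a) (e : Fin a ↪ Fin m) (f : O.Op m p) :
    Mon.comp h hr i (.op e f) .var =
      .op (graft h (rfl : m + 1 = m + 1) i e (.ofIsEmpty : Fin 0 ↪ Fin 1)) f := rfl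

theorem embedding_le {n m : ℕ} (e : Fin n ↪ Fin m) : n ≤ m := by
  simpa using Fintype.card_le_of_embedding e

theorem Mon.weight_act {n : ℕ} {p : ZMod 2} (σ : Equiv.Perm (Fin n)) (y : Mon O n p) :
    (y.act σ).weight = y.weight := by
  cases y <;> rfl

theorem Mon.weight_comp {a b c : ℕ} {p q r : ZMod 2} (h : a + b = c + 1) (hr : p + q = r)
    (i : Fin a) (y : Mon O a p) (z : Mon O b q) :
    (Mon.comp h hr i y z).weight = y.weight + z.weight := by
  cases y with
  | op e f =>
    have := embedding_le e
    cases z with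
    | op e' g =>
      have := embedding_le e'
      have := i.pos
      simp only [Mon.comp, Mon.weight]
      omega
    | var =>
      simp only [Mon.comp, Mon.weight]
      omega
  | var => exact i.elim0

theorem Mon.act_one {n : ℕ} {p : ZMod 2} (y : Mon O n p) : y.act 1 = y := by
  cases y <;> rfl

theorem Mon.act_mul {n : ℕ} {p : ZMod 2} (σ τ : Equiv.Perm (Fin n)) (y : Mon O n p) :
    y.act (σ * τ) = (y.act τ).act σ := by
  cases y <;> rfl

/-- This axiom involves no sign, so it holds for single monomials and not only modulo the relations.
-/
theorem Mon.comp_nested {a b c ab bc abc : ℕ} {p q r pq qr pqr : ZMod 2}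
    (hab : a + b = ab + 1) (hbc : b + c = bc + 1) (h₁ : ab + c = abc + 1) (h₂ : a + bc = abc + 1)
    (hpq : p + q = pq) (hqr : q + r = qr) (hp₁ : pq + r = pqr) (hp₂ : p + qr = pqr)
    (i : Fin a) (j : Fin b) (i' : Fin ab) (hi' : (i' : ℕ) = i + j)
    (f : Mon O a p) (g : Mon O b q) (h : Mon O c r) :
    Mon.comp h₁ hp₁ i' (Mon.comp hab hpq i f g) h =
      Mon.comp h₂ hp₂ i f (Mon.comp hbc hqr j g h) := by
  cases f with
  | @op _ m _ e f =>
    cases g with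
    | @op _ m' _ e' g =>
      have hm := (e i).pos
      have hm' := (e' j).pos
      have hi := (isGraft_graft hab (M := m + m' - 1) (by omega) i e e').inner j i' hi'
      cases h with
      | @op _ m'' _ e'' h =>
        rw [Mon.comp_op hab hpq i (M := m + m' - 1) (by omega),
          Mon.comp_op hbc hqr j (M := m' + m'' - 1) (by omega),
          Mon.comp_op h₁ hp₁ i' (M := m + m' + m'' - 2) (by omega),
          Mon.comp_op h₂ hp₂ i (M := m + m' + m'' - 2) (by omega),
          graft_nested hab hbc h₁ h₂ _ _ _ _ i j i' hi',
          O.comp_nested _ _ _ _ hpq hqr hp₁ hp₂ _ _ _ hi]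
      | var =>
        obtain rfl : q = qr := by simpa using hqr
        obtain rfl : pq = pqr := by simpa using hp₁
        rw [Mon.comp_op hab hpq i (M := m + m' - 1) (by omega), Mon.comp_var, Mon.comp_var,
          Mon.comp_op h₂ hpq i (M := m + m' - 1) (by omega),
          graft_nested hab hbc h₁ h₂ _ _ _ _ i j i' hi']
    | var => exact j.elim0
  | var => exact i.elim0

theorem Mon.comp_act {a b c : ℕ} {p q r : ZMod 2} (h : a + b = c + 1) (hp : p + q = r) (i : Fin a)
    (σ : Equiv.Perm (Fin a)) (τ : Equiv.Perm (Fin b)) (π : Equiv.Perm (Fin c))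
    (hτ : ∀ (t : Fin b) (s : Fin c), (s : ℕ) = i + t → (π s : ℕ) = σ i + τ t)
    (hσ : ∀ (t : Fin a) (s : Fin c), t ≠ i → (s : ℕ) = outerPos b i t →
      (π s : ℕ) = outerPos b (σ i) (σ t))
    (f : Mon O a p) (g : Mon O b q) :
    Mon.comp h hp (σ i) (f.act σ) (g.act τ) = (Mon.comp h hp i f g).act π := by
  have key : ∀ {m m' M : ℕ} (H : m + m' = M + 1) (e : Fin a ↪ Fin m) (e' : Fin b ↪ Fin m'),
      graft h H (σ i) (σ.symm.toEmbedding.trans e) (τ.symm.toEmbedding.trans e') =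
        π.symm.toEmbedding.trans (graft h H i e e') := by
    intro m m' M H e e'
    have := (isGraft_graft h H (σ i) (σ.symm.toEmbedding.trans e)
      (τ.symm.toEmbedding.trans e')).comp_perm hτ hσ
    have e1 : σ.toEmbedding.trans (σ.symm.toEmbedding.trans e) = e := by ext; simp
    have e2 : τ.toEmbedding.trans (τ.symm.toEmbedding.trans e') = e' := by ext; simp
    rw [e1, e2] at this
    rw [(isGraft_graft h H i e e').unique h this]
    ext
    simp
  cases f with
  | @op _ m _ e f =>
    have hm := (e i).pos
    have hi : (σ.symm.toEmbedding.trans e) (σ i) = e i := by simp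
    cases g with
    | @op _ m' _ e' g =>
      simp only [Mon.act]
      rw [Mon.comp_op h hp i (M := m + m' - 1) (by omega),
        Mon.comp_op h hp (σ i) (M := m + m' - 1) (by omega), key, hi]
    | var =>
      obtain rfl : p = r := by simpa using hp
      simp only [Mon.act]
      rw [Mon.comp_var, Mon.comp_var]
      simp only
      rw [← key]
      congr 2
  | var => exact i.elim0

/-- Linear combinations of monomials. -/
abbrev MonSpace (O : GradedOperad.{u, v} k) (n : ℕ) (p : ZMod 2) : Type (max u v) := Mon O n p →₀ k

/-- The bilinear extension of the composition of monomials. -/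
noncomputable def MonSpace.comp {a b c : ℕ} {p q r : ZMod 2} (h : a + b = c + 1) (hr : p + q = r)
    (i : Fin a) : MonSpace O a p →ₗ[k] MonSpace O b q →ₗ[k] MonSpace O c r :=
  Finsupp.linearCombination k fun y => Finsupp.lmapDomain k k (Mon.comp h hr i y)

/-- The linear extension of the action of permutations on monomials. -/
noncomputable def MonSpace.act {n : ℕ} {p : ZMod 2} (σ : Equiv.Perm (Fin n)) :
    MonSpace O n p →ₗ[k] MonSpace O n p :=
  Finsupp.lmapDomain k k (Mon.act σ)

@[simp] theorem MonSpace.comp_single {a b c : ℕ} {p q r : ZMod 2} (h : a + b = c + 1)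
    (hr : p + q = r) (i : Fin a) (y : Mon O a p) (z : Mon O b q) (s t : k) :
    MonSpace.comp h hr i (.single y s) (.single z t) = .single (Mon.comp h hr i y z) (s * t) := by
  simp [MonSpace.comp]

@[simp] theorem MonSpace.act_single {n : ℕ} {p : ZMod 2} (σ : Equiv.Perm (Fin n)) (y : Mon O n p)
    (s : k) : MonSpace.act σ (.single y s) = .single (y.act σ) s := by
  simp [MonSpace.act]

/-- The relations between linear combinations of monomials, modulo `x ^ N`. -/
inductive MonRel (O : GradedOperad.{u, v} k) (N : ℕ) : ∀ {n : ℕ} {p : ZMod 2}, MonSpace O n p → Prop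
  | add {n m : ℕ} {p : ZMod 2} (e : Fin n ↪ Fin m) (f g : O.Op m p) :
      MonRel O N (.single (.op e (f + g)) 1 - .single (.op e f) 1 - .single (.op e g) 1)
  | smul {n m : ℕ} {p : ZMod 2} (e : Fin n ↪ Fin m) (c : k) (f : O.Op m p) :
      MonRel O N (.single (.op e (c • f)) 1 - .single (.op e f) c)
  | perm {n m : ℕ} {p : ZMod 2} (e : Fin n ↪ Fin m) (σ : Equiv.Perm (Fin m)) (f : O.Op m p) :
      MonRel O N (.single (.op (e.trans σ.toEmbedding) (O.act σ f)) 1 - .single (.op e f) 1)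
  | power {n : ℕ} {p : ZMod 2} (y : Mon O n p) (h : N ≤ y.weight) : MonRel O N (.single y 1)

/-- The subspace of relations. -/
noncomputable def monIdeal (O : GradedOperad.{u, v} k) (N n : ℕ) (p : ZMod 2) : Submodule k (MonSpace O n p) :=
  Submodule.span k {y | MonRel O N y}

/-! ### The relations between monomials form an operadic ideal. -/

theorem monIdeal_act {N n : ℕ} {p : ZMod 2} (σ : Equiv.Perm (Fin n)) {y : MonSpace O n p}
    (hy : y ∈ monIdeal O N n p) : MonSpace.act σ y ∈ monIdeal O N n p := by
  suffices h : monIdeal O N n p ≤ (monIdeal O N n p).comap (MonSpace.act σ) from h hy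
  refine Submodule.span_le.2 ?_
  intro y hy
  refine Submodule.subset_span ?_
  change MonRel O N _
  cases hy with
  | add e f g => simp only [map_sub, MonSpace.act_single]; exact MonRel.add _ f g
  | smul e c f => simp only [map_sub, MonSpace.act_single]; exact MonRel.smul _ c f
  | perm e τ f => simp only [map_sub, MonSpace.act_single]; exact MonRel.perm _ τ f
  | power y h => simpa only [MonSpace.act_single] using MonRel.power _ (h.trans (y.weight_act σ).ge)

/-- Renumbering the inputs of `g` renumbers those of `f ∘ g` by the induced permutation `π`, and the
embedding follows along; the difference is again a relation of type `perm`. -/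
theorem Mon.comp_perm_right {a b c m m' : ℕ} {p q r : ZMod 2} (h : a + b = c + 1) (hr : p + q = r)
    (N : ℕ) (i : Fin a) (e : Fin a ↪ Fin m) (f : O.Op m p) (e' : Fin b ↪ Fin m')
    (τ : Equiv.Perm (Fin m')) (g : O.Op m' q) :
    (.single (Mon.comp h hr i (.op e f) (.op (e'.trans τ.toEmbedding) (O.act τ g))) 1 -
      .single (Mon.comp h hr i (.op e f) (.op e' g)) 1 : MonSpace O c r) ∈ monIdeal O N c r := by
  have hm := (e i).pos
  have H : m + m' = m + m' - 1 + 1 := by omega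
  obtain ⟨π, h1, h2⟩ := exists_graft_perm H (e i) 1 τ
  rw [Mon.comp_op h hr i H, Mon.comp_op h hr i H]
  have A := (isGraft_graft h H i e e').perm_comp h1 h2
  have B := isGraft_graft h H i (e.trans (1 : Equiv.Perm (Fin m)).toEmbedding)
    (e'.trans τ.toEmbedding)
  have C := O.comp_act H hr (e i) 1 τ π h1 h2 f g
  rw [O.act_one] at C
  refine Submodule.subset_span ?_
  have := MonRel.perm (N := N) (graft h H i e e') π (O.comp H hr (e i) f g)
  rwa [A.unique h B, ← C] at this

theorem Mon.comp_perm_left {a b c m : ℕ} {p q r : ZMod 2} (h : a + b = c + 1) (hr : p + q = r)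
    (N : ℕ) (i : Fin a) (e : Fin a ↪ Fin m) (σ : Equiv.Perm (Fin m)) (f : O.Op m p)
    (z : Mon O b q) :
    (.single (Mon.comp h hr i (.op (e.trans σ.toEmbedding) (O.act σ f)) z) 1 -
      .single (Mon.comp h hr i (.op e f) z) 1 : MonSpace O c r) ∈ monIdeal O N c r := by
  have hm := (e i).pos
  refine Submodule.subset_span ?_
  cases z with
  | @op _ m' _ e' g =>
    have H : m + m' = m + m' - 1 + 1 := by omega
    obtain ⟨π, h1, h2⟩ := exists_graft_perm H (e i) σ 1
    rw [Mon.comp_op h hr i H, Mon.comp_op h hr i H]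
    have A := (isGraft_graft h H i e e').perm_comp h1 h2
    have B := isGraft_graft h H i (e.trans σ.toEmbedding)
      (e'.trans (1 : Equiv.Perm (Fin m')).toEmbedding)
    have C := O.comp_act H hr (e i) σ 1 π h1 h2 f g
    rw [O.act_one] at C
    have := MonRel.perm (N := N) (graft h H i e e') π (O.comp H hr (e i) f g)
    rwa [A.unique h B, ← C] at this
  | var =>
    obtain rfl : p = r := by simpa using hr
    rw [Mon.comp_var, Mon.comp_var]
    have A := isGraft_graft h (rfl : m + 1 = m + 1) i e (.ofIsEmpty : Fin 0 ↪ Fin 1)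
    have B := isGraft_graft h (rfl : m + 1 = m + 1) i (e.trans σ.toEmbedding)
      (.ofIsEmpty : Fin 0 ↪ Fin 1)
    -- Since `f` is unchanged by the insertion of `x`, the renumbering of the composite is `σ`
    -- itself.
    have C : IsGraft i (e.trans σ.toEmbedding) (.ofIsEmpty : Fin 0 ↪ Fin 1)
        ((graft h (rfl : m + 1 = m + 1) i e (.ofIsEmpty : Fin 0 ↪ Fin 1)).trans σ.toEmbedding) := by
      refine ⟨fun t => t.elim0, fun t s ht hs => ?_⟩
      have D := A.outer t s ht hs
      rw [outerPos_one (e.injective.ne ht)] at D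
      rw [outerPos_one ((e.trans σ.toEmbedding).injective.ne ht)]
      exact congrArg (fun y => (σ y : ℕ)) (Fin.ext D)
    rw [B.unique h C]
    exact MonRel.perm _ σ f

/-- By linearity `z` may be taken to be a monomial. Composition then sends each type of relation to
a relation of the same type, and additivity of the weight takes care of the powers. -/
theorem monIdeal_comp_left {a b c : ℕ} {p q r : ZMod 2} (h : a + b = c + 1) (hr : p + q = r)
    (N : ℕ) (i : Fin a) {y : MonSpace O a p} (hy : y ∈ monIdeal O N a p) (z : MonSpace O b q) :
    MonSpace.comp h hr i y z ∈ monIdeal O N c r := by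
  induction z using Finsupp.induction_linear with
  | zero => simp
  | add z z' h h' => rw [map_add]; exact add_mem h h'
  | single z t =>
    rw [← mul_one t, ← smul_eq_mul, ← Finsupp.smul_single, map_smul]
    refine Submodule.smul_mem _ _ ?_
    suffices h : monIdeal O N a p ≤
        (monIdeal O N c r).comap ((MonSpace.comp h hr i).flip (.single z 1)) from h hy
    refine Submodule.span_le.2 ?_
    intro y hy
    change MonSpace.comp _ hr i y _ ∈ monIdeal O N c r
    cases hy with
    | add e f g =>
      refine Submodule.subset_span ?_
      simp only [map_sub, LinearMap.sub_apply, MonSpace.comp_single, mul_one]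
      cases z with
      | op e' z =>
        simp only [Mon.comp, map_add, LinearMap.add_apply]
        exact MonRel.add _ _ _
      | var =>
        obtain rfl : p = r := by simpa using hr
        exact MonRel.add _ _ _
    | smul e s f =>
      refine Submodule.subset_span ?_
      simp only [map_sub, LinearMap.sub_apply, MonSpace.comp_single, mul_one]
      cases z with
      | op e' z =>
        simp only [Mon.comp, map_smul, LinearMap.smul_apply]
        exact MonRel.smul _ _ _
      | var =>
        obtain rfl : p = r := by simpa using hr
        exact MonRel.smul _ _ _
    | perm e τ f =>
      simp only [map_sub, LinearMap.sub_apply, MonSpace.comp_single, mul_one]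
      exact Mon.comp_perm_left h hr N i e τ f z
    | power y hN =>
      refine Submodule.subset_span ?_
      simp only [MonSpace.comp_single, mul_one]
      exact MonRel.power _ (by rw [Mon.weight_comp]; omega)

theorem monIdeal_comp_right {a b c : ℕ} {p q r : ZMod 2} (h : a + b = c + 1) (hr : p + q = r)
    (N : ℕ) (i : Fin a) (y : MonSpace O a p) {z : MonSpace O b q} (hz : z ∈ monIdeal O N b q) :
    MonSpace.comp h hr i y z ∈ monIdeal O N c r := by
  induction y using Finsupp.induction_linear with
  | zero => simp
  | add z z' h h' => rw [map_add]; exact add_mem h h'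
  | single y t =>
    rw [← mul_one t, ← smul_eq_mul, ← Finsupp.smul_single, map_smul]
    refine Submodule.smul_mem _ _ ?_
    suffices h : monIdeal O N b q ≤
        (monIdeal O N c r).comap (MonSpace.comp h hr i (.single y 1)) from h hz
    refine Submodule.span_le.2 ?_
    intro z hz
    change MonSpace.comp _ hr i _ z ∈ monIdeal O N c r
    cases y with
    | var => exact i.elim0
    | op e y =>
      cases hz with
      | add e' f g =>
        refine Submodule.subset_span ?_
        simp only [map_sub, MonSpace.comp_single, mul_one, Mon.comp, map_add]
        exact MonRel.add _ _ _
      | smul e' s f =>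
        refine Submodule.subset_span ?_
        simp only [map_sub, MonSpace.comp_single, mul_one, one_mul, Mon.comp, map_smul]
        exact MonRel.smul _ _ _
      | perm e' τ f =>
        simp only [map_sub, MonSpace.comp_single, mul_one]
        exact Mon.comp_perm_right h hr N i e y e' τ f
      | power z hN =>
        refine Submodule.subset_span ?_
        simp only [MonSpace.comp_single, mul_one]
        exact MonRel.power _ (by rw [Mon.weight_comp]; omega)

end Monomials

/-! ### The operad axioms in the monomial model, and functionals on `O[x] / (x)^N`. -/

section MonomialsEval

variable {k : Type u} [Field k] {O : GradedOperad.{u, v} k}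

theorem GradedOperad.comp_parallel_of_ne (O : GradedOperad.{u, v} k) {a b c ab ac abc : ℕ}
    {p q r pq pr pqr : ZMod 2}
    (hab : a + b = ab + 1) (hac : a + c = ac + 1) (h₁ : ab + c = abc + 1) (h₂ : ac + b = abc + 1)
    (hpq : p + q = pq) (hpr : p + r = pr) (hp₁ : pq + r = pqr) (hp₂ : pr + q = pqr)
    (i j : Fin a) (hij : i ≠ j) (j' : Fin ab) (i' : Fin ac) (hj' : (j' : ℕ) = outerPos b i j)
    (hi' : (i' : ℕ) = outerPos c j i) (f : O.Op a p) (g : O.Op b q) (h : O.Op c r) :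
    O.comp h₁ hp₁ j' (O.comp hab hpq i f g) h =
      psign (q * r) • O.comp h₂ hp₂ i' (O.comp hac hpr j f h) g := by
  rcases lt_or_gt_of_ne hij with hlt | hlt
  · have : (i : ℕ) < j := hlt
    refine O.comp_parallel hab hac h₁ h₂ hpq hpr hp₁ hp₂ i j j' i' hlt ?_ ?_ f g h
    · rw [hj', outerPos]; split_ifs <;> omega
    · rw [hi', outerPos]; split_ifs; omega
  · have : (j : ℕ) < i := hlt
    -- For `j < i` the axiom is applied with the roles of `g` and `h` exchanged; the two equal signs
    -- cancel.
    rw [O.comp_parallel hac hab h₂ h₁ hpr hpq hp₂ hp₁ j i i' j' hlt ?_ ?_ f h g, smul_smul,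
      mul_comm r q, psign_mul_self, one_smul]
    · rw [hi', outerPos]; split_ifs <;> omega
    · rw [hj', outerPos]; split_ifs; omega

/-- The only axiom that fails for single monomials: the sign appears inside the operation and has to
be taken out by the relation `smul`. If `g` or `h` is `x`, the sign is `1` as `x` is even, and the
two sides agree. -/
theorem Mon.comp_parallel {a b c ab ac abc : ℕ} {p q r pq pr pqr : ZMod 2} (N : ℕ)
    (hab : a + b = ab + 1) (hac : a + c = ac + 1) (h₁ : ab + c = abc + 1) (h₂ : ac + b = abc + 1)
    (hpq : p + q = pq) (hpr : p + r = pr) (hp₁ : pq + r = pqr) (hp₂ : pr + q = pqr)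
    (i j : Fin a) (hij : i ≠ j) (j' : Fin ab) (i' : Fin ac) (hj' : (j' : ℕ) = outerPos b i j)
    (hi' : (i' : ℕ) = outerPos c j i) (f : Mon O a p) (g : Mon O b q) (h : Mon O c r) :
    (.single (Mon.comp h₁ hp₁ j' (Mon.comp hab hpq i f g) h) 1 -
      .single (Mon.comp h₂ hp₂ i' (Mon.comp hac hpr j f h) g) (psign (q * r) : k) :
      MonSpace O abc pqr) ∈ monIdeal O N abc pqr := by
  cases f with
  | var => exact i.elim0
  | @op _ m _ e f =>
    have hm := (e i).pos
    have hm' : (e i : ℕ) ≠ e j := Fin.val_ne_of_ne (e.injective.ne hij)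
    have hm'' := (e j).isLt
    have hm''' := (e i).isLt
    cases g with
    | @op _ m' _ e' g =>
      have H₁ : m + m' = m + m' - 1 + 1 := by omega
      have hj := (isGraft_graft hab H₁ i e e').outer j j' hij.symm hj'
      cases h with
      | @op _ m'' _ e'' h =>
        have H₂ : m + m'' = m + m'' - 1 + 1 := by omega
        have hi := (isGraft_graft hac H₂ j e e'').outer i i' hij hi'
        rw [Mon.comp_op hab hpq i H₁, Mon.comp_op hac hpr j H₂,
          Mon.comp_op h₁ hp₁ j' (M := m + m' + m'' - 2) (by omega),
          Mon.comp_op h₂ hp₂ i' (M := m + m' + m'' - 2) (by omega),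
          graft_parallel hab hac h₁ h₂ H₁ H₂ (by omega) (by omega) i j hij j' i' hj' hi',
          O.comp_parallel_of_ne _ H₂ _ (by omega) hpq hpr hp₁ hp₂ (e i) (e j)
            (e.injective.ne hij) _ _ hj hi, ← Int.cast_smul_eq_zsmul k]
        exact Submodule.subset_span (MonRel.smul _ _ _)
      | var =>
        obtain rfl : p = pr := by simpa using hpr
        obtain rfl : pq = pqr := by simpa using hp₁
        have hi := (isGraft_graft hac (rfl : m + 1 = m + 1) j e (.ofIsEmpty : Fin 0 ↪ Fin 1)).outer
          i i' hij hi'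
        rw [outerPos_one (e.injective.ne hij)] at hi
        rw [Mon.comp_op hab hpq i H₁, Mon.comp_var, Mon.comp_var,
          Mon.comp_op h₂ hp₂ i' H₁,
          graft_parallel hab hac h₁ h₂ H₁ rfl rfl H₁ i j hij j' i' hj' hi', Fin.ext hi,
          mul_zero, psign, if_pos rfl, Int.cast_one, sub_self]
        exact zero_mem _
    | var =>
      obtain rfl : p = pq := by simpa using hpq
      have hj := (isGraft_graft hab (rfl : m + 1 = m + 1) i e (.ofIsEmpty : Fin 0 ↪ Fin 1)).outer
          j j' hij.symm hj'
      rw [outerPos_one (e.injective.ne hij.symm)] at hj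
      cases h with
      | @op _ m'' _ e'' h =>
        have H₂ : m + m'' = m + m'' - 1 + 1 := by omega
        obtain rfl : pr = pqr := by simpa using hp₂
        rw [Mon.comp_op hac hpr j H₂, Mon.comp_var, Mon.comp_var,
          Mon.comp_op h₁ hp₁ j' H₂,
          graft_parallel hab hac h₁ h₂ rfl H₂ H₂ rfl i j hij j' i' hj' hi', Fin.ext hj,
          zero_mul, psign, if_pos rfl, Int.cast_one, sub_self]
        exact zero_mem _
      | var =>
        obtain rfl : p = pr := by simpa using hpr
        obtain rfl : p = pqr := by simpa using hp₂
        rw [Mon.comp_var, Mon.comp_var, Mon.comp_var, Mon.comp_var,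
          graft_parallel hab hac h₁ h₂ rfl rfl rfl rfl i j hij j' i' hj' hi',
          zero_mul, psign, if_pos rfl, Int.cast_one, sub_self]
        exact zero_mem _

theorem MonSpace.act_one {n : ℕ} {p : ZMod 2} (y : MonSpace O n p) : MonSpace.act 1 y = y := by
  induction y using Finsupp.induction_linear with
  | zero => simp
  | add y z hy hz => rw [map_add, hy, hz]
  | single y t => rw [MonSpace.act_single, Mon.act_one]

theorem MonSpace.act_mul {n : ℕ} {p : ZMod 2} (σ τ : Equiv.Perm (Fin n)) (y : MonSpace O n p) :
    MonSpace.act (σ * τ) y = MonSpace.act σ (MonSpace.act τ y) := by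
  induction y using Finsupp.induction_linear with
  | zero => simp
  | add y z hy hz => simp only [map_add, hy, hz]
  | single y t => simp only [MonSpace.act_single, Mon.act_mul]

theorem MonSpace.comp_nested {a b c ab bc abc : ℕ} {p q r pq qr pqr : ZMod 2}
    (hab : a + b = ab + 1) (hbc : b + c = bc + 1) (h₁ : ab + c = abc + 1) (h₂ : a + bc = abc + 1)
    (hpq : p + q = pq) (hqr : q + r = qr) (hp₁ : pq + r = pqr) (hp₂ : p + qr = pqr)
    (i : Fin a) (j : Fin b) (i' : Fin ab) (hi' : (i' : ℕ) = i + j)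
    (f : MonSpace O a p) (g : MonSpace O b q) (h : MonSpace O c r) :
    MonSpace.comp h₁ hp₁ i' (MonSpace.comp hab hpq i f g) h =
      MonSpace.comp h₂ hp₂ i f (MonSpace.comp hbc hqr j g h) := by
  induction f using Finsupp.induction_linear with
  | zero => simp
  | add y z hy hz => simp only [map_add, LinearMap.add_apply, hy, hz]
  | single f s =>
    induction g using Finsupp.induction_linear with
    | zero => simp
    | add y z hy hz => simp only [map_add, LinearMap.add_apply, hy, hz]
    | single g t =>
      induction h using Finsupp.induction_linear with
      | zero => simp
      | add y z hy hz => simp only [map_add, hy, hz]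
      | single h u =>
        simp only [MonSpace.comp_single, mul_assoc,
          Mon.comp_nested hab hbc h₁ h₂ hpq hqr hp₁ hp₂ i j i' hi']

theorem MonSpace.comp_act {a b c : ℕ} {p q r : ZMod 2} (h : a + b = c + 1) (hp : p + q = r)
    (i : Fin a) (σ : Equiv.Perm (Fin a)) (τ : Equiv.Perm (Fin b)) (π : Equiv.Perm (Fin c))
    (hτ : ∀ (t : Fin b) (s : Fin c), (s : ℕ) = i + t → (π s : ℕ) = σ i + τ t)
    (hσ : ∀ (t : Fin a) (s : Fin c), t ≠ i → (s : ℕ) = outerPos b i t →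
      (π s : ℕ) = outerPos b (σ i) (σ t))
    (f : MonSpace O a p) (g : MonSpace O b q) :
    MonSpace.comp h hp (σ i) (MonSpace.act σ f) (MonSpace.act τ g) =
      MonSpace.act π (MonSpace.comp h hp i f g) := by
  induction f using Finsupp.induction_linear with
  | zero => simp
  | add y z hy hz => simp only [map_add, LinearMap.add_apply, hy, hz]
  | single f s =>
    induction g using Finsupp.induction_linear with
    | zero => simp
    | add y z hy hz => simp only [map_add, hy, hz]
    | single g t =>
      simp only [MonSpace.comp_single, MonSpace.act_single, Mon.comp_act h hp i σ τ π hτ hσ]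

theorem MonSpace.comp_parallel {a b c ab ac abc : ℕ} {p q r pq pr pqr : ZMod 2} (N : ℕ)
    (hab : a + b = ab + 1) (hac : a + c = ac + 1) (h₁ : ab + c = abc + 1) (h₂ : ac + b = abc + 1)
    (hpq : p + q = pq) (hpr : p + r = pr) (hp₁ : pq + r = pqr) (hp₂ : pr + q = pqr)
    (i j : Fin a) (hij : i ≠ j) (j' : Fin ab) (i' : Fin ac) (hj' : (j' : ℕ) = outerPos b i j)
    (hi' : (i' : ℕ) = outerPos c j i) (f : MonSpace O a p) (g : MonSpace O b q)
    (h : MonSpace O c r) :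
    MonSpace.comp h₁ hp₁ j' (MonSpace.comp hab hpq i f g) h -
      (psign (q * r) : k) • MonSpace.comp h₂ hp₂ i' (MonSpace.comp hac hpr j f h) g ∈
      monIdeal O N abc pqr := by
  induction f using Finsupp.induction_linear with
  | zero => simp
  | add y z hy hz =>
    convert add_mem hy hz using 1
    simp only [map_add, LinearMap.add_apply, smul_add]
    abel
  | single f s =>
    induction g using Finsupp.induction_linear with
    | zero => simp
    | add y z hy hz =>
      convert add_mem hy hz using 1
      simp only [map_add, LinearMap.add_apply, smul_add]
      abel
    | single g t =>
      induction h using Finsupp.induction_linear with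
      | zero => simp
      | add y z hy hz =>
        convert add_mem hy hz using 1
        simp only [map_add, LinearMap.add_apply, smul_add]
        abel
      | single h u =>
        convert Submodule.smul_mem _ (s * t * u) (Mon.comp_parallel N hab hac h₁ h₂ hpq hpr hp₁ hp₂
          i j hij j' i' hj' hi' f g h) using 1
        simp only [MonSpace.comp_single, smul_sub, Finsupp.smul_single, smul_eq_mul, mul_one]
        congr 2
        ring

/-- The linear combination of monomials that is given by a formal expression. -/
noncomputable def Term.monomials : ∀ {n : ℕ} {p : ZMod 2}, Term k (AdjGen O) n p → MonSpace O n p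
  | _, _, .gen (.incl f) => .single (.op (.refl _) f) 1
  | _, _, .gen .x => .single .var 1
  | _, _, .zero => 0
  | _, _, .add s t => s.monomials + t.monomials
  | _, _, .smul c s => c • s.monomials
  | _, _, .act σ s => MonSpace.act σ s.monomials
  | _, _, .comp h hr i s t => MonSpace.comp h hr i s.monomials t.monomials

/-- The linear combinations of monomials of weight at least `K`. -/
noncomputable def monFiltration (O : GradedOperad.{u, v} k) (K n : ℕ) (p : ZMod 2) :
    Submodule k (MonSpace O n p) :=
  Submodule.span k ((fun y => .single y 1) '' {y | K ≤ y.weight})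

theorem monFiltration_act {K n : ℕ} {p : ZMod 2} (σ : Equiv.Perm (Fin n)) {y : MonSpace O n p}
    (hy : y ∈ monFiltration O K n p) : MonSpace.act σ y ∈ monFiltration O K n p := by
  suffices h : monFiltration O K n p ≤ (monFiltration O K n p).comap (MonSpace.act σ) from h hy
  refine Submodule.span_le.2 ?_
  rintro _ ⟨y, hy, rfl⟩
  refine Submodule.subset_span ⟨y.act σ, ?_, ?_⟩
  · simpa only [Set.mem_ofPred_eq, Mon.weight_act] using hy
  · exact (MonSpace.act_single σ y 1).symm

theorem monFiltration_comp {a b c : ℕ} {p q r : ZMod 2} (h : a + b = c + 1) (hr : p + q = r)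
    (i : Fin a) {K L : ℕ} {y : MonSpace O a p} {z : MonSpace O b q}
    (hy : y ∈ monFiltration O K a p) (hz : z ∈ monFiltration O L b q) :
    MonSpace.comp h hr i y z ∈ monFiltration O (K + L) c r := by
  refine Submodule.span_induction (p := fun y _ => MonSpace.comp h hr i y z ∈ _) ?_ ?_ ?_ ?_ hy
  · rintro _ ⟨y, hy, rfl⟩
    refine Submodule.span_induction (p := fun z _ => MonSpace.comp h hr i _ z ∈ _) ?_ ?_ ?_ ?_ hz
    · rintro _ ⟨z, hz, rfl⟩
      refine Submodule.subset_span ⟨Mon.comp h hr i y z, ?_, ?_⟩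
      · simp only [Set.mem_ofPred_eq, Mon.weight_comp] at hy hz ⊢
        omega
      · simp
    · simp
    · intro y z _ _ hy hz
      rw [map_add]
      exact add_mem hy hz
    · intro s y _ hy
      rw [map_smul]
      exact Submodule.smul_mem _ _ hy
  · simp
  · intro y z _ _ hy hz
    rw [map_add]
    exact add_mem hy hz
  · intro s y _ hy
    rw [map_smul]
    exact Submodule.smul_mem _ _ hy

/-- Evaluation does not lower the number of occurrences of `x`, so the relations `power` of the
presentation land in the ideal. -/
theorem Term.monomials_mem_filtration {n : ℕ} {p : ZMod 2} (t : Term k (AdjGen O) n p) (K : ℕ)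
    (hK : K ≤ xOrder t) : t.monomials ∈ monFiltration O K n p := by
  induction t generalizing K with
  | gen y =>
    cases y with
    | incl f =>
      have : K = 0 := by simpa [xOrder] using hK
      exact Submodule.subset_span ⟨_, by simp [this], rfl⟩
    | x =>
      have : K ≤ 1 := by simpa [xOrder] using hK
      exact Submodule.subset_span ⟨_, this, rfl⟩
  | zero => exact zero_mem _
  | add s t hs ht =>
    rw [xOrder, le_min_iff] at hK
    exact add_mem (hs K hK.1) (ht K hK.2)
  | smul c s hs => exact Submodule.smul_mem _ _ (hs K hK)
  | act σ s hs => exact monFiltration_act σ (hs K hK)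
  | comp h hr i s t hs ht =>
    -- The orders may be infinite and their sum may exceed `K`, so `K` is distributed over the
    -- factors: as much as possible to `s`, the rest to `t`.
    obtain ⟨L, M, rfl, hL, hM⟩ : ∃ L M : ℕ, K = L + M ∧ L ≤ xOrder s ∧ M ≤ xOrder t := by
      rw [xOrder] at hK
      rcases eq_or_ne (xOrder s) ⊤ with e | e
      · exact ⟨K, 0, rfl, by simp [e], by simp⟩
      · obtain ⟨L, hL⟩ := ENat.ne_top_iff_exists.1 e
        rcases le_total K L with hKL | hKL
        · exact ⟨K, 0, rfl, by rw [← hL]; exact_mod_cast hKL, by simp⟩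
        · obtain ⟨M, rfl⟩ := Nat.exists_eq_add_of_le hKL
          refine ⟨L, M, rfl, hL.le, ?_⟩
          rw [← hL, Nat.cast_add] at hK
          exact (ENat.add_le_add_iff_left (ENat.natCast_ne_top L)).1 hK
    exact monFiltration_comp h hr i (hs L hL) (ht M hM)

theorem monFiltration_le_monIdeal (N n : ℕ) (p : ZMod 2) :
    monFiltration O N n p ≤ monIdeal O N n p := by
  refine Submodule.span_le.2 ?_
  rintro _ ⟨y, hy, rfl⟩
  exact Submodule.subset_span (MonRel.power y hy)

theorem AdjRel.monomials_sub_mem {N n : ℕ} {p : ZMod 2} {s t : Term k (AdjGen O) n p}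
    (h : AdjRel O N s t) : s.monomials - t.monomials ∈ monIdeal O N n p := by
  cases h with
  | incl_add f g =>
    rw [Term.monomials, Term.monomials, Term.monomials, Term.monomials, ← sub_sub]
    exact Submodule.subset_span (MonRel.add _ f g)
  | incl_smul c f =>
    rw [Term.monomials, Term.monomials, Term.monomials, Finsupp.smul_single, smul_eq_mul, mul_one]
    exact Submodule.subset_span (MonRel.smul _ c f)
  | incl_act σ f =>
    rw [Term.monomials, Term.monomials, Term.monomials, MonSpace.act_single]
    -- The action on the monomial of `f` only changes its embedding, to `σ⁻¹`; renumbering by `σ`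
    -- turns it back into the identity and `f` into `σ f`.
    have := MonRel.perm (N := N) (σ.symm.toEmbedding.trans (.refl _)) σ f
    have e : (σ.symm.toEmbedding.trans (.refl _)).trans σ.toEmbedding = .refl _ := by ext; simp
    rw [e] at this
    exact Submodule.subset_span this
  | incl_comp h hr i f g =>
    rw [Term.monomials, Term.monomials, Term.monomials, Term.monomials, MonSpace.comp_single,
      Mon.comp_op h hr i h, mul_one]
    have : graft h h i (.refl _) (.refl _) = .refl _ :=
      (isGraft_graft h h i (.refl _) (.refl _)).unique h ⟨fun t s hs => hs, fun t s _ hs => hs⟩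
    rw [this]
    simp
  | power t h =>
    rw [Term.monomials, sub_zero]
    exact monFiltration_le_monIdeal _ _ _ (Term.monomials_mem_filtration _ N h)

theorem monIdeal_comp_sub {a b c : ℕ} {p q r : ZMod 2} (h : a + b = c + 1) (hr : p + q = r)
    (N : ℕ) (i : Fin a) {y y' : MonSpace O a p} {z z' : MonSpace O b q}
    (hy : y - y' ∈ monIdeal O N a p) (hz : z - z' ∈ monIdeal O N b q) :
    MonSpace.comp h hr i y z - MonSpace.comp h hr i y' z' ∈ monIdeal O N c r := by
  have := add_mem (monIdeal_comp_left h hr N i hy z) (monIdeal_comp_right h hr N i y' hz)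
  rwa [map_sub, LinearMap.sub_apply, map_sub, sub_add_sub_cancel] at this

/-- Soundness of the model. By induction on the congruence: the ideal absorbs the congruence rules,
and the axioms hold strictly, except for the parallel one, which holds modulo the ideal. -/
theorem Presentation.Eqv.monomials_sub_mem {N n : ℕ} {p : ZMod 2}
    {s t : Term k (AdjPres O N).Gen n p} (h : (AdjPres O N).Eqv s t) : s.monomials - t.monomials ∈ monIdeal O N n p := by
  have of_eq : ∀ {n : ℕ} {p : ZMod 2} {y z : MonSpace O n p}, y = z → y - z ∈ monIdeal O N n p := by
    rintro n p y z rfl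
    simp
  induction h with
  | rel h => exact h.monomials_sub_mem
  | refl => exact of_eq rfl
  | symm _ ih => simpa using neg_mem ih
  | trans _ _ ih ih' => simpa using add_mem ih ih'
  | add_congr _ _ ih ih' =>
    simp only [Term.monomials]
    rw [add_sub_add_comm]
    exact add_mem ih ih'
  | smul_congr c _ ih =>
    simp only [Term.monomials]
    rw [← smul_sub]
    exact Submodule.smul_mem _ c ih
  | act_congr σ _ ih =>
    simp only [Term.monomials]
    rw [← map_sub]
    exact monIdeal_act σ ih
  | comp_congr h hr i _ _ ih ih' =>
    simp only [Term.monomials]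
    exact monIdeal_comp_sub h hr N i ih ih'
  | add_assoc s t r => refine of_eq ?_; simp only [Term.monomials, _root_.add_assoc]
  | add_comm s t => refine of_eq ?_; simp only [Term.monomials]; rw [_root_.add_comm]
  | zero_add s => refine of_eq ?_; simp only [Term.monomials, _root_.zero_add]
  | neg_add s => refine of_eq ?_; simp only [Term.monomials, neg_smul, _root_.one_smul,
      neg_add_cancel]
  | smul_add c s t => refine of_eq ?_; simp only [Term.monomials, _root_.smul_add]
  | add_smul c c' s => refine of_eq ?_; simp only [Term.monomials, _root_.add_smul]
  | mul_smul c c' s => refine of_eq ?_; simp only [Term.monomials, smul_smul]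
  | one_smul s => refine of_eq ?_; simp only [Term.monomials, _root_.one_smul]
  | act_add σ s t => refine of_eq ?_; simp only [Term.monomials, map_add]
  | act_smul σ c s => refine of_eq ?_; simp only [Term.monomials, map_smul]
  | comp_add_left h hr i s s' t =>
    refine of_eq ?_; simp only [Term.monomials, map_add, LinearMap.add_apply]
  | comp_add_right h hr i s s' t => refine of_eq ?_; simp only [Term.monomials, map_add]
  | comp_smul_left h hr i x s t =>
    refine of_eq ?_; simp only [Term.monomials, map_smul, LinearMap.smul_apply]
  | comp_smul_right h hr i x s t => refine of_eq ?_; simp only [Term.monomials, map_smul]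
  | act_one s => refine of_eq ?_; simp only [Term.monomials, MonSpace.act_one]
  | act_mul σ τ s => refine of_eq ?_; simp only [Term.monomials, MonSpace.act_mul]
  | comp_nested hab hbc h₁ h₂ hpq hqr hp₁ hp₂ i j i' hi' f g h =>
    exact of_eq (MonSpace.comp_nested hab hbc h₁ h₂ hpq hqr hp₁ hp₂ i j i' hi' _ _ _)
  | comp_parallel hab hac h₁ h₂ hpq hpr hp₁ hp₂ i j j' i' hij hj' hi' f g h =>
    have : (i : ℕ) < j := hij
    refine MonSpace.comp_parallel N hab hac h₁ h₂ hpq hpr hp₁ hp₂ i j hij.ne j' i' ?_ ?_ _ _ _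
    · rw [outerPos]; split_ifs <;> omega
    · rw [outerPos]; split_ifs; omega
  | comp_act h hp i σ τ π hτ hσ f g =>
    exact of_eq (MonSpace.comp_act h hp i σ τ π hτ hσ _ _)

/-- The functional on `O[x] / (x)^N` that is given by a functional on linear combinations of
monomials. -/
noncomputable def AdjPres.functional {N n : ℕ} {p : ZMod 2} {V : Type*} [AddCommGroup V] [Module k V]
    (D : MonSpace O n p →ₗ[k] V) (hD : ∀ y, MonRel O N y → D y = 0) :
    (AdjPres O N).operad.Op n p →ₗ[k] V where
  toFun := Quotient.lift (fun t => D t.monomials) fun s t h => by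
    have : monIdeal O N n p ≤ LinearMap.ker D := Submodule.span_le.2 hD
    have := this (Presentation.Eqv.monomials_sub_mem h)
    rwa [LinearMap.mem_ker, map_sub, sub_eq_zero] at this
  map_add' := by rintro ⟨a⟩ ⟨b⟩; exact map_add D _ _
  map_smul' := by rintro c ⟨a⟩; exact map_smul D _ _

theorem AdjPres.functional_cls {N n : ℕ} {p : ZMod 2} {V : Type*} [AddCommGroup V] [Module k V]
    (D : MonSpace O n p →ₗ[k] V) (hD : ∀ y, MonRel O N y → D y = 0) (t : Term k (AdjGen O) n p) :
    AdjPres.functional D hD ((AdjPres O N).cls t) = D t.monomials := rfl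

/-- The coefficient of the variable. -/
def Mon.varCoeff : ∀ {n : ℕ} {p : ZMod 2}, Mon O n p → k
  | _, _, .op _ _ => 0
  | _, _, .var => 1

/-- Only `power` could involve `x`, whose weight is `1`; this is why `2 ≤ N` is needed. -/
theorem MonRel.varCoeff_eq_zero {N : ℕ} (hN : 2 ≤ N) {n : ℕ} {p : ZMod 2} (y : MonSpace O n p)
    (h : MonRel O N y) : Finsupp.linearCombination k Mon.varCoeff y = 0 := by
  cases h with
  | add e f g => simp [Mon.varCoeff]
  | smul e c f => simp [Mon.varCoeff]
  | perm e σ f => simp [Mon.varCoeff]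
  | power y h =>
    cases y with
    | op e f => simp [Mon.varCoeff]
    | var =>
      simp only [Mon.weight] at h
      omega

open Classical in
/-- The sum of `σ f` over all permutations `σ` with `σ e = e₀`. -/
noncomputable def Mon.orbitSum {n M : ℕ} {p : ZMod 2} (e₀ : Fin n ↪ Fin M) : Mon O n p → O.Op M p
  -- The case `m ≠ M` is sent to zero, so that only the monomials of weight `M - n` are detected.
  | .op (m := m) e f => if h : m = M then
      ∑ σ : Equiv.Perm (Fin M), if ∀ t, σ ((e t).cast h) = e₀ t then O.act σ (h ▸ f) else 0 else 0
  | .var => 0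

open Classical in
theorem Mon.orbitSum_op {n M : ℕ} {p : ZMod 2} (e₀ : Fin n ↪ Fin M) (e : Fin n ↪ Fin M)
    (f : O.Op M p) : Mon.orbitSum e₀ (.op e f) =
      ∑ σ : Equiv.Perm (Fin M), if ∀ t, σ (e t) = e₀ t then O.act σ f else 0 := by
  simp [Mon.orbitSum]

theorem Mon.orbitSum_of_ne {n m M : ℕ} {p : ZMod 2} (e₀ : Fin n ↪ Fin M) (e : Fin n ↪ Fin m)
    (f : O.Op m p) (h : m ≠ M) : Mon.orbitSum e₀ (.op e f) = 0 := by
  simp [Mon.orbitSum, h]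

/-- Summing over all `σ` that carry `e` to `e₀` removes the choice of a numbering. The bound on `M`
says that the detected weight `M - n` is less than `N`, so the relations `power` are not seen. -/
theorem MonRel.orbitSum_eq_zero {N n M : ℕ} (hN : M < n + N) (e₀ : Fin n ↪ Fin M) {p : ZMod 2}
    (y : MonSpace O n p) (h : MonRel O N y) :
    Finsupp.linearCombination k (Mon.orbitSum e₀) y = 0 := by
  cases h with
  | @add m _ e f g =>
    by_cases h : m = M
    · subst h
      simp only [map_sub, Finsupp.linearCombination_single, one_smul, Mon.orbitSum_op, map_add,
        ← Finset.sum_sub_distrib]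
      refine Finset.sum_eq_zero fun σ _ => ?_
      split_ifs <;> simp
    · simp [Mon.orbitSum_of_ne _ _ _ h]
  | @smul m _ e c f =>
    by_cases h : m = M
    · subst h
      simp only [map_sub, Finsupp.linearCombination_single, one_smul, Mon.orbitSum_op, map_smul,
        Finset.smul_sum, ← Finset.sum_sub_distrib]
      refine Finset.sum_eq_zero fun σ _ => ?_
      split_ifs <;> simp
    · simp [Mon.orbitSum_of_ne _ _ _ h]
  | @perm m _ e τ f =>
    by_cases h : m = M
    · subst h
      simp only [map_sub, Finsupp.linearCombination_single, one_smul, Mon.orbitSum_op]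
      rw [sub_eq_zero]
      -- Reindexing by `σ ↦ σ τ`: the condition for `τ e` and `σ` is the condition for `e` and `σ
      -- τ`.
      refine Fintype.sum_equiv (Equiv.mulRight τ) _ _ fun σ => ?_
      simp [O.act_mul]
    · simp [Mon.orbitSum_of_ne _ _ _ h]
  | power y h =>
    rw [Finsupp.linearCombination_single, one_smul]
    cases y with
    | @op _ m _ e f =>
      have := embedding_le e₀
      simp only [Mon.weight] at h
      exact Mon.orbitSum_of_ne _ _ _ (by omega)
    | var => rfl

end MonomialsEval

/-! ### Inserting an even operation of arity zero into the last inputs -/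

section PlugTail

variable {k : Type u} [Field k] (Q : GradedOperad.{u, v} k) (x : Q.Op 0 0)

/-- The operation `f ∘ (id ⊗ … ⊗ id ⊗ x ⊗ … ⊗ x)` with `x` inserted into the last `j` inputs. -/
def GradedOperad.plugTail (x : Q.Op 0 0) : ∀ (j : ℕ) {n : ℕ} {p : ZMod 2},
    Q.Op (n + j) p →ₗ[k] Q.Op n p
  | 0, _, _ => LinearMap.id
  | j + 1, n, p => GradedOperad.plugTail x j ∘ₗ
      (Q.comp (add_zero (n + j + 1)) (add_zero p) (Fin.last (n + j))).flip x

theorem GradedOperad.plugTail_succ (j : ℕ) {n : ℕ} {p : ZMod 2} (f : Q.Op (n + (j + 1)) p) :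
    Q.plugTail x (j + 1) f =
      Q.plugTail x j (Q.comp (add_zero (n + j + 1)) (add_zero p) (Fin.last (n + j)) f x) := rfl

theorem GradedOperad.Hom.map_plugTail {Q : GradedOperad.{u, v} k} {R : GradedOperad.{u, w} k}
    (ρ : Q.Hom R) (x : Q.Op 0 0) (j : ℕ) {n : ℕ} {p : ZMod 2} (f : Q.Op (n + j) p) :
    ρ.map (Q.plugTail x j f) = R.plugTail (ρ.map x) j (ρ.map f) := by
  induction j with
  | zero => rfl
  | succ j ih => rw [Q.plugTail_succ, ih, ρ.map_comp]; rfl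

theorem GradedOperad.comp_comp_last {m : ℕ} {p : ZMod 2} (f : Q.Op (m + 2) p) (i : Fin (m + 1)) :
    Q.comp (add_zero (m + 1)) (add_zero p) i
        (Q.comp (add_zero (m + 2)) (add_zero p) (Fin.last (m + 1)) f x) x =
      Q.comp (add_zero (m + 1)) (add_zero p) (Fin.last m)
        (Q.comp (add_zero (m + 2)) (add_zero p) i.castSucc f x) x := by
  rw [Q.comp_parallel (ac := m + 1) (add_zero _) (add_zero _) (add_zero _) (add_zero _) (add_zero p)
    (add_zero p) (add_zero p) (add_zero p) i.castSucc (Fin.last (m + 1)) (Fin.last m) i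
    (Fin.castSucc_lt_last i) rfl rfl]
  have : psign (0 * 0) = 1 := by decide
  rw [this, one_smul]

/-- Insertions into different inputs commute, without sign as `x` is even. -/
theorem GradedOperad.plugTail_comp (j : ℕ) {n : ℕ} {p : ZMod 2} (f : Q.Op (n + 1 + j) p)
    (i : Fin (n + 1)) (i' : Fin (n + 1 + j)) (hi : (i' : ℕ) = i) (h : n + 1 + j + 0 = n + j + 1) :
    Q.comp (add_zero _) (add_zero p) i (Q.plugTail x j f) x =
      Q.plugTail x j (Q.comp h (add_zero p) i' f x) := by
  induction j with
  | zero => rw [Fin.ext hi]; rfl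
  | succ j ih =>
    rw [Q.plugTail_succ, ih _ ⟨i, by omega⟩ rfl (by omega), Q.plugTail_succ]
    congr 1
    rw [Q.comp_parallel (ac := n + 1 + j) h (add_zero _) (add_zero _)
      (show n + 1 + j + 0 = n + j + 1 by omega) (add_zero p)
      (add_zero p) (add_zero p) (add_zero p) i' (Fin.last (n + 1 + j)) (Fin.last (n + j))
      ⟨i, by omega⟩ (by rw [Fin.lt_def, hi, Fin.val_last]; omega)
      (by simp only [Fin.val_last]; omega) hi.symm]
    have : psign (0 * 0) = 1 := by decide
    rw [this, one_smul]

/-- The order of the insertions does not matter, so any of the last inputs may be filled first. -/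
theorem GradedOperad.plugTail_succ_of_le (j : ℕ) {n : ℕ} {p : ZMod 2} (f : Q.Op (n + (j + 1)) p)
    (i : Fin (n + j + 1)) (hi : n ≤ i) :
    Q.plugTail x (j + 1) f =
      Q.plugTail x j (Q.comp (add_zero (n + j + 1)) (add_zero p) i f x) := by
  induction j with
  | zero =>
    obtain rfl : i = Fin.last (n + 0) := Fin.ext (by simp only [Fin.val_last]; omega)
    rfl
  | succ j ih =>
    rcases (Fin.le_last i).eq_or_lt with rfl | hlt
    · rfl
    · obtain ⟨i, rfl⟩ := Fin.exists_castSucc_eq.2 hlt.ne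
      rw [Q.plugTail_succ, ih _ i hi, Q.plugTail_succ]
      congr 1
      exact Q.comp_comp_last x f i

/-- Inputs that receive the same even element are interchangeable. If the input `σ (last)` of `σ f`
is filled first, equivariance leaves a permutation `π` of one input fewer that still fixes the first
`n`. -/
theorem GradedOperad.plugTail_act (j : ℕ) {n : ℕ} {p : ZMod 2} (f : Q.Op (n + j) p)
    (σ : Equiv.Perm (Fin (n + j))) (hσ : ∀ t : Fin n, σ (t.castAdd j) = t.castAdd j) :
    Q.plugTail x j (Q.act σ f) = Q.plugTail x j f := by
  induction j with
  | zero =>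
    have : σ = 1 := Equiv.ext hσ
    rw [this, Q.act_one]
  | succ j ih =>
    -- `σ` fixes the first `n` inputs, so it cannot send the last one there.
    have hlast : n ≤ (σ (Fin.last (n + j)) : ℕ) := by
      by_contra hlt
      have h1 := hσ ⟨σ (Fin.last (n + j)), not_le.1 hlt⟩
      have h2 := congrArg Fin.val (σ.injective (a₂ := Fin.last (n + j)) (Fin.ext (congrArg Fin.val h1)))
      have h3 : (σ (Fin.last (n + j)) : ℕ) = n + j := h2
      omega
    obtain ⟨π, h1, h2⟩ := exists_graft_perm (b := 0) (add_zero (n + j + 1)) (Fin.last (n + j)) σ 1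
    rw [Q.plugTail_succ_of_le x j _ (σ (Fin.last (n + j))) hlast, Q.plugTail_succ]
    refine Eq.trans (congrArg _ ?_) (ih _ π ?_)
    · have := Q.comp_act (add_zero (n + j + 1)) (add_zero p) (Fin.last (n + j)) σ 1 π h1 h2 f x
      rwa [Q.act_one] at this
    · intro t
      have ht : (t.castAdd (j + 1) : Fin (n + j + 1)) ≠ Fin.last (n + j) := by
        intro e
        have h3 : (t : ℕ) = n + j := congrArg Fin.val e
        omega
      have h4 : outerPos 0 (n + j) t = t := by
        unfold outerPos
        rw [if_pos (by omega)]
      ext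
      rw [h2 (t.castAdd (j + 1)) _ ht h4.symm]
      have h5 : (σ (t.castAdd (j + 1)) : ℕ) = t := congrArg Fin.val (hσ t)
      rw [h5]
      unfold outerPos
      rw [if_pos (by omega)]
      rfl

/-- An insertion of `x` can be moved to the last input. -/
theorem GradedOperad.exists_act_comp_last {M m : ℕ} (h : M + 0 = m + 1) (i : Fin M) :
    ∃ (e : M = m + 1) (σ : Equiv.Perm (Fin (m + 1))), ∀ {p : ZMod 2} (f : Q.Op M p),
      Q.comp h (add_zero p) i f x =
        Q.comp (add_zero (m + 1)) (add_zero p) (Fin.last m) (Q.act σ (e ▸ f)) x := by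
  obtain rfl : M = m + 1 := h
  -- This permutation moves `i` to the end and keeps the order of the other inputs, so no
  -- permutation of the composite remains.
  refine ⟨rfl, (finSuccEquiv' i).trans (finSuccEquiv' (Fin.last m)).symm, fun {p} f => ?_⟩
  set σ := (finSuccEquiv' i).trans (finSuccEquiv' (Fin.last m)).symm with hσ
  have hi : σ i = Fin.last m := by simp [hσ]
  have := Q.comp_act (add_zero (m + 1)) (add_zero p) i σ 1 1 (fun t => t.elim0) ?_ f x
  · rw [Q.act_one, Q.act_one, hi] at this
    exact this.symm
  · intro t s ht hs
    obtain ⟨t, rfl⟩ := Fin.exists_succAbove_eq ht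
    have h1 : σ (i.succAbove t) = t.castSucc := by simp [hσ]
    rw [h1, hi]
    have h2 : (s : ℕ) = t := hs.trans (outerPos_zero_succAbove i t)
    simp [outerPos, h2]

end PlugTail

/-! ### The normal form of the elements of `O[x] / (x)^N` -/

section NormalForm

variable {k : Type u} [Field k] {O : GradedOperad.{u, v} k}

/-- The formal expression `t ∘ (id ⊗ … ⊗ id ⊗ x ⊗ … ⊗ x)` with `x` inserted into the last `j` inputs
of `t`. -/
def Term.plugTail : ∀ (j : ℕ) {n : ℕ} {p : ZMod 2}, Term k (AdjGen O) (n + j) p →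
    Term k (AdjGen O) n p
  | 0, _, _, t => t
  | j + 1, n, p, t =>
    Term.plugTail j (.comp (add_zero (n + j + 1)) (add_zero p) (Fin.last (n + j)) t (.gen .x))

theorem Term.xOrder_plugTail (j : ℕ) {n : ℕ} {p : ZMod 2} (t : Term k (AdjGen O) (n + j) p) :
    xOrder (t.plugTail j) = xOrder t + j := by
  induction j with
  | zero => simp [Term.plugTail]
  | succ j ih =>
    rw [Term.plugTail, ih]
    simp only [xOrder, Nat.cast_add, Nat.cast_one]
    ring

theorem AdjPres.cls_plugTail (N j : ℕ) {n : ℕ} {p : ZMod 2} (t : Term k (AdjGen O) (n + j) p) :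
    (AdjPres O N).cls (t.plugTail j) =
      (AdjPres O N).operad.plugTail ((AdjPres O N).cls (.gen .x)) j ((AdjPres O N).cls t) := by
  induction j with
  | zero => rfl
  | succ j ih => rw [Term.plugTail, ih]; rfl

/-- Inserting `x` into the last open input just removes this input from the domain of the embedding.
-/
theorem graft_last {n m : ℕ} (e : Fin (n + 1) ↪ Fin m) :
    graft (add_zero (n + 1)) (rfl : m + 1 = m + 1) (Fin.last n) e (.ofIsEmpty : Fin 0 ↪ Fin 1) =
      Fin.castSuccEmb.trans e := by
  refine (isGraft_graft (add_zero (n + 1)) rfl (Fin.last n) e _).unique (add_zero (n + 1)) ⟨fun t => t.elim0, fun t s ht hs => ?_⟩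
  rw [outerPos_one (e.injective.ne ht)]
  obtain ⟨t, rfl⟩ := Fin.exists_castSucc_eq.2 ht
  have : s = t := Fin.ext (by rw [hs]; simp [outerPos])
  rw [this]
  rfl

theorem Term.monomials_plugTail (j : ℕ) {n m : ℕ} {p : ZMod 2} (t : Term k (AdjGen O) (n + j) p)
    (e : Fin (n + j) ↪ Fin m) (f : O.Op m p) (ht : t.monomials = .single (.op e f) 1) :
    (t.plugTail j).monomials = .single (.op ((Fin.castAddEmb j).trans e) f) 1 := by
  induction j with
  | zero => exact ht
  | succ j ih =>
    refine ih (Term.comp (add_zero (n + j + 1)) (add_zero p) (Fin.last (n + j)) t (.gen .x))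
      (Fin.castSuccEmb.trans e) ?_
    rw [Term.monomials, ht, Term.monomials, MonSpace.comp_single, Mon.comp_var, mul_one, ← graft_last]

/-- The element `f ∘ (id ⊗ … ⊗ id ⊗ x ⊗ … ⊗ x)` of `O[x] / (x)^N`. -/
def AdjPres.tail (O : GradedOperad.{u, v} k) (N j : ℕ) {n : ℕ} {p : ZMod 2} :
    O.Op (n + j) p →ₗ[k] (AdjPres O N).operad.Op n p :=
  (AdjPres O N).operad.plugTail ((AdjPres O N).cls (.gen .x)) j ∘ₗ AdjPres.incl O N

theorem AdjPres.tail_eq_cls (N j : ℕ) {n : ℕ} {p : ZMod 2} (f : O.Op (n + j) p) :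
    AdjPres.tail O N j f = (AdjPres O N).cls (Term.plugTail j (.gen (.incl f))) :=
  (AdjPres.cls_plugTail N j _).symm

theorem AdjPres.tail_eq_zero {N j : ℕ} (h : N ≤ j) {n : ℕ} {p : ZMod 2} (f : O.Op (n + j) p) :
    AdjPres.tail O N j f = 0 := by
  rw [AdjPres.tail_eq_cls]
  refine AdjPres.cls_eq_zero O N _ ?_
  rw [Term.xOrder_plugTail]
  exact le_add_left (by exact_mod_cast h)

theorem AdjPres.incl_act (N : ℕ) {n : ℕ} {p : ZMod 2} (σ : Equiv.Perm (Fin n)) (f : O.Op n p) :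
    AdjPres.incl O N (O.act σ f) = (AdjPres O N).operad.act σ (AdjPres.incl O N f) :=
  (AdjPres O N).cls_eq.2 (.rel (AdjRel.incl_act σ f))

theorem AdjPres.incl_comp (N : ℕ) {a b c : ℕ} {p q r : ZMod 2} (h : a + b = c + 1) (hr : p + q = r)
    (i : Fin a) (f : O.Op a p) (g : O.Op b q) :
    AdjPres.incl O N (O.comp h hr i f g) =
      (AdjPres O N).operad.comp h hr i (AdjPres.incl O N f) (AdjPres.incl O N g) :=
  (AdjPres O N).cls_eq.2 (.rel (AdjRel.incl_comp h hr i f g))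

/-- Hence `tail` factors through the coinvariants of the permutations of the last `j` inputs. -/
theorem AdjPres.tail_act (N j : ℕ) {n : ℕ} {p : ZMod 2} (f : O.Op (n + j) p)
    (σ : Equiv.Perm (Fin (n + j))) (hσ : ∀ t : Fin n, σ (t.castAdd j) = t.castAdd j) :
    AdjPres.tail O N j (O.act σ f) = AdjPres.tail O N j f := by
  change (AdjPres O N).operad.plugTail _ j (AdjPres.incl O N _) = _
  rw [AdjPres.incl_act, GradedOperad.plugTail_act _ _ j _ σ hσ]
  rfl

/-- The new insertion is commuted past the old ones and its input is then moved to the end by a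
permutation, which is absorbed into `f`. -/
theorem AdjPres.exists_comp_tail (N j : ℕ) {n : ℕ} {p : ZMod 2} (f : O.Op (n + 1 + j) p)
    (i : Fin (n + 1)) : ∃ f' : O.Op (n + (j + 1)) p,
      (AdjPres O N).operad.comp (add_zero _) (add_zero p) i (AdjPres.tail O N j f)
        ((AdjPres O N).cls (.gen .x)) = AdjPres.tail O N (j + 1) f' := by
  have h : n + 1 + j + 0 = n + j + 1 := by omega
  obtain ⟨e, σ, hσ⟩ := (AdjPres O N).operad.exists_act_comp_last
    ((AdjPres O N).cls (.gen .x)) h (i.castAdd j)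
  refine ⟨O.act σ (e ▸ f), ?_⟩
  change (AdjPres O N).operad.comp _ _ i ((AdjPres O N).operad.plugTail _ j (AdjPres.incl O N f)) _ =
    (AdjPres O N).operad.plugTail _ (j + 1) (AdjPres.incl O N (O.act σ (e ▸ f)))
  rw [GradedOperad.plugTail_comp _ _ j _ i (i.castAdd j) rfl h, GradedOperad.plugTail_succ]
  congr 1
  rw [hσ]
  congr 2
  refine Eq.trans ?_ (AdjPres.incl_act N σ _).symm
  congr 1
  clear hσ
  generalize n + j + 1 = m at e
  subst e
  rfl

/-- The scalar multiples of the variable. -/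
inductive AdjPres.IsVar (O : GradedOperad.{u, v} k) (N : ℕ) :
    ∀ {n : ℕ} {p : ZMod 2}, k → (AdjPres O N).operad.Op n p → Prop
  -- Needed because `x` exists only in arity zero and even parity, while normal forms are stated in
  -- all arities and parities.
  | zero {n : ℕ} {p : ZMod 2} : IsVar O N 0 (0 : (AdjPres O N).operad.Op n p)
  | var (c : k) : IsVar O N c (c • (AdjPres O N).cls (.gen .x))

theorem AdjPres.IsVar.add {N n : ℕ} {p : ZMod 2} {c c' : k} {y y' : (AdjPres O N).operad.Op n p}
    (h : AdjPres.IsVar O N c y) (h' : AdjPres.IsVar O N c' y') :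
    AdjPres.IsVar O N (c + c') (y + y') := by
  cases h with
  | zero => rwa [zero_add, zero_add]
  | var c =>
    cases h' with
    | zero => rw [add_zero, add_zero]; exact .var c
    | var c' => rw [← add_smul]; exact .var _

theorem AdjPres.IsVar.smul {N n : ℕ} {p : ZMod 2} {c : k} {y : (AdjPres O N).operad.Op n p}
    (h : AdjPres.IsVar O N c y) (s : k) : AdjPres.IsVar O N (s * c) (s • y) := by
  cases h with
  | zero => rw [mul_zero, smul_zero]; exact .zero
  | var c => rw [smul_smul]; exact .var _

theorem AdjPres.IsVar.eq_zero {N n : ℕ} {p : ZMod 2} {y : (AdjPres O N).operad.Op n p}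
    (h : AdjPres.IsVar O N 0 y) : y = 0 := by
  generalize hc : (0 : k) = c at h
  cases h with
  | zero => rfl
  | var c => rw [← hc, zero_smul]

theorem AdjPres.IsVar.eq_zero_of_ne {N n : ℕ} (hn : n ≠ 0) {p : ZMod 2} {c : k}
    {y : (AdjPres O N).operad.Op n p} (h : AdjPres.IsVar O N c y) : y = 0 := by
  cases h with
  | zero => rfl
  | var c => exact absurd rfl hn

/-- Modulo `(x)^1` the variable vanishes, so it contributes nothing to the layer without occurrences
of `x`. -/
theorem AdjPres.IsVar.eq_zero_of_le_one {N n : ℕ} (hN : N ≤ 1) {p : ZMod 2} {c : k}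
    {y : (AdjPres O N).operad.Op n p} (h : AdjPres.IsVar O N c y) : y = 0 := by
  cases h with
  | zero => rfl
  | var c =>
    rw [AdjPres.cls_eq_zero O N (.gen .x) (by simpa [xOrder] using hN), smul_zero]

/-- Operations of `O` and `x`, with `x` inserted successively into some of their inputs. -/
inductive AdjPres.IsMon (O : GradedOperad.{u, v} k) (N : ℕ) :
    ∀ {n : ℕ} {p : ZMod 2}, (AdjPres O N).operad.Op n p → Prop
  | incl {n : ℕ} {p : ZMod 2} (f : O.Op n p) : IsMon O N (AdjPres.incl O N f)
  | var : IsMon O N ((AdjPres O N).cls (.gen .x))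
  | plug {n : ℕ} {p : ZMod 2} (i : Fin (n + 1)) {y : (AdjPres O N).operad.Op (n + 1) p}
      (h : IsMon O N y) : IsMon O N ((AdjPres O N).operad.comp (add_zero _) (add_zero p) i y
        ((AdjPres O N).cls (.gen .x)))

theorem AdjPres.IsMon.act {N n : ℕ} {p : ZMod 2} {y : (AdjPres O N).operad.Op n p}
    (h : AdjPres.IsMon O N y) (σ : Equiv.Perm (Fin n)) :
    AdjPres.IsMon O N ((AdjPres O N).operad.act σ y) := by
  induction h with
  | incl f => rw [← AdjPres.incl_act]; exact .incl _
  | var =>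
    rw [Subsingleton.elim σ 1, GradedOperad.act_one]
    exact .var
  | @plug n p i y h ih =>
    -- `τ` extends `σ` to the inputs before the insertion by fixing `i`.
    obtain ⟨τ, hi, hτ⟩ : ∃ τ : Equiv.Perm (Fin (n + 1)), τ i = i ∧
        ∀ s : Fin n, τ (i.succAbove s) = i.succAbove (σ s) :=
      ⟨(finSuccEquiv' i).trans ((Equiv.optionCongr σ).trans (finSuccEquiv' i).symm), by simp,
        by simp⟩
    have := (AdjPres O N).operad.comp_act (add_zero (n + 1)) (add_zero p) i τ 1 σ
      (fun t => t.elim0) ?_ y ((AdjPres O N).cls (.gen .x))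
    · rw [← this, hi, GradedOperad.act_one]
      exact .plug i (ih τ)
    · intro t s ht hs
      obtain ⟨t, rfl⟩ := Fin.exists_succAbove_eq ht
      rw [outerPos_zero_succAbove] at hs
      rw [Fin.ext hs, hi, hτ, outerPos_zero_succAbove]

/-- The span of the operations `IsMon`. -/
def AdjPres.monSpan (O : GradedOperad.{u, v} k) (N n : ℕ) (p : ZMod 2) :
    Submodule k ((AdjPres O N).operad.Op n p) :=
  Submodule.span k {y | AdjPres.IsMon O N y}

/-- All insertions of `x` can be carried out last: those in `z` move outwards by the nested axiom,
those in `y` by the parallel one. What remains is a composition in `O`. -/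
theorem AdjPres.IsMon.comp {N a b c : ℕ} {p q r : ZMod 2} (h : a + b = c + 1) (hr : p + q = r)
    (i : Fin a) {y : (AdjPres O N).operad.Op a p} {z : (AdjPres O N).operad.Op b q}
    (hy : AdjPres.IsMon O N y) (hz : AdjPres.IsMon O N z) :
    (AdjPres O N).operad.comp h hr i y z ∈ AdjPres.monSpan O N c r := by
  have plug : ∀ {n : ℕ} {p : ZMod 2} (i : Fin (n + 1)) {y : (AdjPres O N).operad.Op (n + 1) p},
      y ∈ AdjPres.monSpan O N (n + 1) p → (AdjPres O N).operad.comp (add_zero _) (add_zero p) i y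
        ((AdjPres O N).cls (.gen .x)) ∈ AdjPres.monSpan O N n p := by
    intro n p i y hy
    suffices h : AdjPres.monSpan O N (n + 1) p ≤ (AdjPres.monSpan O N n p).comap
        (((AdjPres O N).operad.comp (add_zero _) (add_zero p) i).flip
          ((AdjPres O N).cls (.gen .x))) from h hy
    exact Submodule.span_le.2 fun y hy => Submodule.subset_span (.plug i hy)
  induction hz generalizing c r with
  | var =>
    obtain rfl : a = c + 1 := h
    obtain rfl : p = r := by simpa using hr
    exact Submodule.subset_span (.plug i hy)
  | @plug n q j z hz ih =>
    have ha := i.isLt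
    have hj := j.isLt
    rw [← (AdjPres O N).operad.comp_nested (ab := c + 1) (by omega) (add_zero (n + 1)) (add_zero _)
      (by omega) hr (add_zero q) (add_zero r) hr i j ⟨i + j, by omega⟩ rfl]
    exact plug _ (ih (by omega) hr)
  | @incl b q g =>
    induction hy generalizing b c q r with
    | var => exact i.elim0
    | incl f =>
      rw [← AdjPres.incl_comp]
      exact Submodule.subset_span (.incl _)
    | @plug n p j y hy ih =>
      have hn := i.pos
      -- The input `i` of `y ∘_j x` comes from an input `i' ≠ j` of `y`, because `x` has no inputs.
      obtain ⟨j', i', hne, hi', hj'⟩ : ∃ (j' : Fin (c + 1)) (i' : Fin (n + 1)), i' ≠ j ∧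
          (j' : ℕ) = outerPos b i' j ∧ (i : ℕ) = outerPos 0 j i' := by
        rcases inner_or_outer (add_zero (n + 1)) j i with ⟨t, _⟩ | ⟨i', hi, h'⟩
        · exact t.elim0
        · exact ⟨⟨_, outerPos_lt (by omega) i' j hi.symm⟩, i', hi, rfl, h'⟩
      have e := (AdjPres O N).operad.comp_parallel_of_ne (add_zero (n + 1)) (by omega) h
        (add_zero (c + 1)) (add_zero p) hr hr (add_zero r) j i' hne.symm i j' hj' hi'
        y ((AdjPres O N).cls (.gen .x)) (AdjPres.incl O N g)
      rw [e, zero_mul, psign, if_pos rfl, one_smul]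
      exact plug _ (by apply ih)

theorem AdjPres.mem_monSpan (N : ℕ) {n : ℕ} {p : ZMod 2} (y : (AdjPres O N).operad.Op n p) :
    y ∈ AdjPres.monSpan O N n p := by
  obtain ⟨t, rfl⟩ := (AdjPres O N).cls_surj y
  induction t with
  | gen y =>
    cases y with
    | incl f => exact Submodule.subset_span (.incl f)
    | x => exact Submodule.subset_span .var
  | zero => exact zero_mem _
  | add s t hs ht => exact add_mem hs ht
  | smul c s hs => exact Submodule.smul_mem _ c hs
  | @act n p σ s hs =>
    suffices h : AdjPres.monSpan O N n p ≤ (AdjPres.monSpan O N n p).comap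
        ((AdjPres O N).operad.act σ) from h hs
    exact Submodule.span_le.2 fun y hy => Submodule.subset_span (hy.act σ)
  | @comp a b c p q r h hr i s t hs ht =>
    have key : ∀ {y}, AdjPres.IsMon O N y → ∀ {z}, z ∈ AdjPres.monSpan O N b q →
        (AdjPres O N).operad.comp h hr i y z ∈ AdjPres.monSpan O N c r := by
      intro y hy z hz
      suffices h' : AdjPres.monSpan O N b q ≤ (AdjPres.monSpan O N c r).comap
        ((AdjPres O N).operad.comp h hr i y) from h' hz
      exact Submodule.span_le.2 fun z hz => hy.comp h hr i hz
    suffices h' : AdjPres.monSpan O N a p ≤ (AdjPres.monSpan O N c r).comap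
        (((AdjPres O N).operad.comp h hr i).flip ((AdjPres O N).cls t)) from h' hs
    exact Submodule.span_le.2 fun y hy => key hy ht

/-- Successive insertions are collected in the last inputs, one at a time. -/
theorem AdjPres.IsMon.eq_tail {N n : ℕ} {p : ZMod 2} {y : (AdjPres O N).operad.Op n p}
    (h : AdjPres.IsMon O N y) :
    (∃ (j : ℕ) (f : O.Op (n + j) p), y = AdjPres.tail O N j f) ∨ AdjPres.IsVar O N 1 y := by
  induction h with
  | incl f => exact .inl ⟨0, f, rfl⟩
  | var => exact .inr (by rw [← one_smul k ((AdjPres O N).cls (.gen .x))]; exact .var 1)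
  | @plug n p i y h ih =>
    rcases ih with ⟨j, f, rfl⟩ | ih
    · obtain ⟨f', hf'⟩ := AdjPres.exists_comp_tail N j f i
      exact .inl ⟨j + 1, f', hf'⟩
    -- A multiple of `x` in positive arity is zero, and zero is a tail.
    · refine .inl ⟨0, 0, ?_⟩
      rw [ih.eq_zero_of_ne n.succ_ne_zero]
      simp

/-- Each element of `O[x] / (x)^N` is a sum of elements `f ∘ (id ⊗ … ⊗ id ⊗ x ⊗ … ⊗ x)` and of a
multiple of `x`. -/
theorem AdjPres.exists_eq_sum_tail (N : ℕ) {n : ℕ} {p : ZMod 2} (y : (AdjPres O N).operad.Op n p) :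
    ∃ (f : ∀ j, O.Op (n + j) p) (c : k) (z : (AdjPres O N).operad.Op n p),
      AdjPres.IsVar O N c z ∧ y = ∑ j ∈ Finset.range N, AdjPres.tail O N j (f j) + z := by
  refine Submodule.span_induction ?_ ?_ ?_ ?_ (AdjPres.mem_monSpan N y)
  · intro y hy
    rcases hy.eq_tail with ⟨j, f, rfl⟩ | hy
    · by_cases hj : j < N
      · refine ⟨Pi.single j f, 0, 0, .zero, ?_⟩
        rw [add_zero, Finset.sum_eq_single j, Pi.single_eq_same]
        · intro i _ hi
          rw [Pi.single_eq_of_ne hi, map_zero]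
        · intro h
          exact absurd (Finset.mem_range.2 hj) h
      · exact ⟨0, 0, 0, .zero, by simp [AdjPres.tail_eq_zero (not_lt.1 hj)]⟩
    · exact ⟨0, 1, y, hy, by simp⟩
  · exact ⟨0, 0, 0, .zero, by simp⟩
  · rintro _ _ _ _ ⟨f, c, z, hz, rfl⟩ ⟨f', c', z', hz', rfl⟩
    refine ⟨f + f', _, _, hz.add hz', ?_⟩
    simp only [Pi.add_apply, map_add, Finset.sum_add_distrib]
    exact add_add_add_comm _ _ _ _
  · rintro s _ _ ⟨f, c, z, hz, rfl⟩
    refine ⟨s • f, _, _, hz.smul s, ?_⟩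
    simp only [Pi.smul_apply, map_smul, smul_add, Finset.smul_sum]

/-! ### Symmetrisation over the inserted inputs, and uniqueness of the normal form. -/

open Classical in
/-- The sum of `σ f` over the permutations `σ` of the last `j` inputs. -/
noncomputable def GradedOperad.tailSum (O : GradedOperad.{u, v} k) {n : ℕ} (j : ℕ) {p : ZMod 2}
    (f : O.Op (n + j) p) : O.Op (n + j) p :=
  ∑ σ : Equiv.Perm (Fin (n + j)) with ∀ t : Fin n, σ (t.castAdd j) = t.castAdd j, O.act σ f

/-- Invariance under the permutations of the last `j` inputs. -/
def GradedOperad.TailInvariant (O : GradedOperad.{u, v} k) {n : ℕ} (j : ℕ) {p : ZMod 2}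
    (f : O.Op (n + j) p) : Prop :=
  ∀ σ : Equiv.Perm (Fin (n + j)), (∀ t : Fin n, σ (t.castAdd j) = t.castAdd j) → O.act σ f = f

theorem GradedOperad.tailInvariant_tailSum (O : GradedOperad.{u, v} k) {n : ℕ} (j : ℕ) {p : ZMod 2}
    (f : O.Op (n + j) p) : O.TailInvariant j (O.tailSum j f) := by
  classical
  intro τ hτ
  rw [GradedOperad.tailSum, map_sum]
  refine Finset.sum_equiv (Equiv.mulLeft τ) ?_ ?_
  · intro σ
    simp only [Finset.mem_filter, Finset.mem_univ, true_and, Equiv.coe_mulLeft,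
      Equiv.Perm.mul_apply]
    refine forall_congr' fun t => ?_
    rw [← τ.injective.eq_iff, hτ]
  · intro σ _
    rw [Equiv.coe_mulLeft, O.act_mul]

/-- The scalar is the number of permutations that fix the first `n` inputs; it is nonzero in
characteristic zero and independent of `f`. -/
theorem GradedOperad.TailInvariant.exists_tailSum_eq [CharZero k] (O : GradedOperad.{u, v} k)
    (n j : ℕ) : ∃ c : k, c ≠ 0 ∧ ∀ {p : ZMod 2} (f : O.Op (n + j) p), O.TailInvariant j f →
      O.tailSum j f = c • f := by
  classical
  refine ⟨((Finset.univ.filter fun σ : Equiv.Perm (Fin (n + j)) =>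
    ∀ t : Fin n, σ (t.castAdd j) = t.castAdd j).card : k), ?_, fun f hf => ?_⟩
  · rw [Nat.cast_ne_zero, Finset.card_ne_zero]
    exact ⟨1, by simp⟩
  · rw [GradedOperad.tailSum, Finset.sum_congr rfl fun σ hσ => hf σ (Finset.mem_filter.1 hσ).2,
      Finset.sum_const, Nat.cast_smul_eq_nsmul]

/-- `tail` takes the same value on all summands. With the preceding lemma this identifies
coinvariants and invariants, up to an invertible scalar. -/
theorem AdjPres.exists_tail_tailSum [CharZero k] (O : GradedOperad.{u, v} k) (n j : ℕ) :
    ∃ c : k, c ≠ 0 ∧ ∀ (N : ℕ) {p : ZMod 2} (f : O.Op (n + j) p),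
      AdjPres.tail O N j (O.tailSum j f) = c • AdjPres.tail O N j f := by
  classical
  refine ⟨((Finset.univ.filter fun σ : Equiv.Perm (Fin (n + j)) =>
    ∀ t : Fin n, σ (t.castAdd j) = t.castAdd j).card : k), ?_, fun N p f => ?_⟩
  · rw [Nat.cast_ne_zero, Finset.card_ne_zero]
    exact ⟨1, by simp⟩
  · rw [GradedOperad.tailSum, map_sum, Finset.sum_congr rfl fun σ hσ =>
      AdjPres.tail_act N j f σ (Finset.mem_filter.1 hσ).2, Finset.sum_const, Nat.cast_smul_eq_nsmul]

theorem AdjPres.exists_tailInvariant [CharZero k] (N : ℕ) {n j : ℕ} {p : ZMod 2}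
    (f : O.Op (n + j) p) :
    ∃ f' : O.Op (n + j) p, O.TailInvariant j f' ∧ AdjPres.tail O N j f' = AdjPres.tail O N j f := by
  obtain ⟨c, hc, h⟩ := AdjPres.exists_tail_tailSum O n j
  refine ⟨c⁻¹ • O.tailSum j f, fun σ hσ => ?_, ?_⟩
  · rw [map_smul, O.tailInvariant_tailSum j f σ hσ]
  · rw [map_smul, h, smul_smul, inv_mul_cancel₀ hc, one_smul]

theorem AdjPres.monomials_tail {j : ℕ} {n : ℕ} {p : ZMod 2} (f : O.Op (n + j) p) :
    (Term.plugTail j (.gen (.incl f) : Term k (AdjGen O) (n + j) p)).monomials =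
      .single (.op (Fin.castAddEmb j) f) 1 :=
  Term.monomials_plugTail j _ (.refl _) f rfl

/-- The summands of the normal form are unique up to permutations of the insertions of `x`. -/
theorem AdjPres.eq_zero_of_sum_tail {N n : ℕ} {p : ZMod 2} (f : ∀ j, O.Op (n + j) p) {c : k}
    {z : (AdjPres O N).operad.Op n p} (hz : AdjPres.IsVar O N c z)
    (h : ∑ j ∈ Finset.range N, AdjPres.tail O N j (f j) + z = 0) :
    (∀ j < N, O.tailSum j (f j) = 0) ∧ (2 ≤ N → c = 0) := by
  constructor
  · intro j hj
    -- The functional with `e₀` the inclusion of the first `n` inputs isolates the summand `j`: it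
    -- kills `x` and the other weights, and on `tail f` it is the sum over the permutations that fix
    -- these inputs.
    have e : ∀ (M : ℕ) (g : O.Op (n + M) p), AdjPres.functional (N := N)
        (Finsupp.linearCombination k (Mon.orbitSum (O := O) (p := p) (Fin.castAddEmb j)))
        (MonRel.orbitSum_eq_zero (by omega) _) (AdjPres.tail O N M g) =
          Mon.orbitSum (Fin.castAddEmb j) (.op (Fin.castAddEmb M) g) := by
      intro M g
      rw [AdjPres.tail_eq_cls, AdjPres.functional_cls, AdjPres.monomials_tail,
        Finsupp.linearCombination_single, one_smul]
    have hz' : AdjPres.functional (N := N)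
        (Finsupp.linearCombination k (Mon.orbitSum (O := O) (p := p) (Fin.castAddEmb j)))
        (MonRel.orbitSum_eq_zero (by omega) _) z = 0 := by
      cases hz with
      | zero => exact map_zero _
      | var c =>
        rw [map_smul, AdjPres.functional_cls, Term.monomials, Finsupp.linearCombination_single,
          one_smul, Mon.orbitSum, smul_zero]
    have := congrArg (AdjPres.functional (N := N)
        (Finsupp.linearCombination k (Mon.orbitSum (O := O) (p := p) (Fin.castAddEmb j)))
        (MonRel.orbitSum_eq_zero (by omega) _)) h
    rw [map_add, hz', add_zero, map_sum, map_zero, Finset.sum_eq_single j, e, Mon.orbitSum_op] at this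
    · rw [GradedOperad.tailSum, Finset.sum_filter]
      exact this
    · intro i _ hij
      rw [e, Mon.orbitSum_of_ne _ _ _ (by omega)]
    · intro hn
      exact absurd (Finset.mem_range.2 hj) hn
  · intro hN
    -- The coefficient of `x` vanishes on all tails, so it isolates `c`.
    have e : ∀ (M : ℕ) (g : O.Op (n + M) p), AdjPres.functional (N := N)
        (Finsupp.linearCombination k (Mon.varCoeff (O := O) (n := n) (p := p)))
        (MonRel.varCoeff_eq_zero hN) (AdjPres.tail O N M g) = 0 := by
      intro M g
      rw [AdjPres.tail_eq_cls, AdjPres.functional_cls, AdjPres.monomials_tail,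
        Finsupp.linearCombination_single, Mon.varCoeff, smul_zero]
    have := congrArg (AdjPres.functional (N := N)
        (Finsupp.linearCombination k (Mon.varCoeff (O := O) (n := n) (p := p)))
        (MonRel.varCoeff_eq_zero hN)) h
    rw [map_add, map_sum, Finset.sum_eq_zero fun i _ => e i _, zero_add, map_zero] at this
    cases hz with
    | zero => rfl
    | var c =>
      rwa [map_smul, AdjPres.functional_cls, Term.monomials, Finsupp.linearCombination_single,
        one_smul, Mon.varCoeff, smul_eq_mul, mul_one] at this

end NormalForm

/-! ### Quasi-isomorphisms and towers of dg operads -/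

section Cone

variable {k : Type u} [Field k]

/-- The acyclicity of the mapping cones of a map of dg operads. -/
def DGOperad.Hom.ConeAcyclic {O : DGOperad.{u, v} k} {P : DGOperad.{u, w} k} (ρ : O.Hom P) :
    Prop :=
  ∀ {n : ℕ} {p q : ZMod 2} (hq : p + 1 = q) (hp : q + 1 = p) (x : O.Op n q) (y : P.Op n p),
    O.d hp x = 0 → ρ.map x = P.d hq y →
      ∃ (w : O.Op n p) (z : P.Op n q), O.d hq w = x ∧ ρ.map w - y = P.d hp z

theorem DGOperad.mem_cycles (O : DGOperad.{u, v} k) {n : ℕ} {p q : ZMod 2} (h : p + 1 = q)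
    {x : O.Op n p} : x ∈ O.cycles n p ↔ O.d h x = 0 := by
  subst h
  rfl

theorem DGOperad.mem_boundaries (O : DGOperad.{u, v} k) {n : ℕ} {p q : ZMod 2} (h : q + 1 = p)
    (x : O.cycles n p) : x ∈ O.boundaries n p ↔ ∃ y : O.Op n q, O.d h y = x := by
  obtain rfl : q = p + 1 := by
    have : ∀ p q : ZMod 2, q + 1 = p → q = p + 1 := by decide
    exact this p q h
  rfl

/-- A pair `(x, y)` as in `ConeAcyclic` is a cycle of the cone, and `(w, z)` bounds it. Injectivity
on homology gives a primitive of `x`, surjectivity corrects it by a cycle; conversely the case `x =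
0` is surjectivity and the component `w` alone is injectivity. -/
theorem DGOperad.Hom.isQuasiIso_iff_coneAcyclic {O : DGOperad.{u, v} k} {P : DGOperad.{u, w} k}
    (ρ : O.Hom P) : ρ.IsQuasiIso ↔ ρ.ConeAcyclic := by
  constructor
  · intro h n p q hq hp x y hx hxy
    have hx' := (O.mem_cycles hp).2 hx
    obtain ⟨w, hw⟩ : ∃ w : O.Op n p, O.d hq w = x := by
      refine (O.mem_boundaries hq ⟨x, hx'⟩).1 ((Submodule.Quotient.mk_eq_zero _).1 ?_)
      refine (h n q).1 ?_
      rw [map_zero]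
      exact (Submodule.Quotient.mk_eq_zero _).2 ((P.mem_boundaries hq _).2 ⟨y, hxy.symm⟩)
    have hy : ρ.map w - y ∈ P.cycles n p := by
      rw [P.mem_cycles hq, map_sub, ← ρ.map_d, hw, hxy, sub_self]
    -- The cycle `ρ w - y` is homologous to some `ρ v`, and `w - v` is then the right primitive.
    obtain ⟨⟨v⟩, hv⟩ := (h n p).2 (Submodule.Quotient.mk ⟨ρ.map w - y, hy⟩)
    obtain ⟨z, hz⟩ := (P.mem_boundaries hp _).1 ((Submodule.Quotient.eq _).1 hv)
    refine ⟨w - v.1, -z, ?_, ?_⟩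
    · rw [map_sub, hw, (O.mem_cycles hq).1 v.2, sub_zero]
    · have hz' : P.d hp z = ρ.map v.1 - (ρ.map w - y) := hz
      rw [map_neg, hz', map_sub]
      abel
  · intro h n p
    have hp : p + 1 + 1 = p := by revert p; decide
    constructor
    · rw [← LinearMap.ker_eq_bot, LinearMap.ker_eq_bot']
      rintro ⟨x⟩ hx
      have hx' : ρ.cyclesMap n p x ∈ P.boundaries n p := (Submodule.Quotient.mk_eq_zero _).1 hx
      obtain ⟨y, hy⟩ := (P.mem_boundaries hp _).1 hx'
      obtain ⟨w, z, hw, -⟩ := h hp rfl x.1 y x.2 hy.symm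
      exact (Submodule.Quotient.mk_eq_zero _).2 ((O.mem_boundaries hp _).2 ⟨w, hw⟩)
    · rintro ⟨y⟩
      obtain ⟨w, z, hw, hz⟩ := h rfl hp 0 y.1 (map_zero _) ((map_zero _).trans y.2.symm)
      refine ⟨Submodule.Quotient.mk ⟨w, hw⟩, (Submodule.Quotient.eq _).2 ?_⟩
      exact (P.mem_boundaries hp _).2 ⟨z, hz.symm⟩

/-- A bounding pair is built by induction on the level: lift it arbitrarily along the surjections;
the error is a cone cycle in the kernels, which is bounded there. The corrections do not change
lower levels, so the pairs form a compatible family. -/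
theorem DGOperad.limMap_coneAcyclic (T : ℕ → DGOperad.{u, v} k) (π : ∀ N, (T (N + 1)).Hom (T N))
    (T' : ℕ → DGOperad.{u, w} k) (π' : ∀ N, (T' (N + 1)).Hom (T' N)) (ρ : ∀ N, (T N).Hom (T' N))
    (h : ∀ (N n : ℕ) (p : ZMod 2) (f : (T (N + 1)).Op n p),
      (π' N).map ((ρ (N + 1)).map f) = (ρ N).map ((π N).map f))
    (hT : ∀ {n : ℕ} {p : ZMod 2} (f : (T 0).Op n p), f = 0)
    (hT' : ∀ {n : ℕ} {p : ZMod 2} (f : (T' 0).Op n p), f = 0)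
    (hπ : ∀ (N : ℕ) {n : ℕ} {p : ZMod 2} (f : (T N).Op n p), ∃ g, (π N).map g = f)
    (hπ' : ∀ (N : ℕ) {n : ℕ} {p : ZMod 2} (f : (T' N).Op n p), ∃ g, (π' N).map g = f)
    (hK : ∀ (N : ℕ) {n : ℕ} {p q : ZMod 2} (hq : p + 1 = q) (hp : q + 1 = p)
      (x : (T (N + 1)).Op n q) (y : (T' (N + 1)).Op n p), (π N).map x = 0 → (π' N).map y = 0 →
      (T (N + 1)).d hp x = 0 → (ρ (N + 1)).map x = (T' (N + 1)).d hq y →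
      ∃ (w : (T (N + 1)).Op n p) (z : (T' (N + 1)).Op n q), (π N).map w = 0 ∧ (π' N).map z = 0 ∧
        (T (N + 1)).d hq w = x ∧ (ρ (N + 1)).map w - y = (T' (N + 1)).d hp z) :
    (DGOperad.limMap T π T' π' ρ h).ConeAcyclic := by
  intro n p q hq hp x y hx hxy
  have hxN : ∀ N, (T N).d hp (x.1 N) = 0 := fun N => congrFun (congrArg Subtype.val hx) N
  have hxyN : ∀ N, (ρ N).map (x.1 N) = (T' N).d hq (y.1 N) :=
    fun N => congrFun (congrArg Subtype.val hxy) N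
  -- The bounding pairs at level `N`.
  let S : ℕ → Type (max v w) := fun N => {s : (T N).Op n p × (T' N).Op n q //
    (T N).d hq s.1 = x.1 N ∧ (ρ N).map s.1 - y.1 N = (T' N).d hp s.2}
  have step : ∀ (N : ℕ) (s : S N), ∃ s' : S (N + 1),
      (π N).map s'.1.1 = s.1.1 ∧ (π' N).map s'.1.2 = s.1.2 := by
    rintro N ⟨⟨w, z⟩, hw, hz⟩
    obtain ⟨w, rfl⟩ := hπ N w
    obtain ⟨z, rfl⟩ := hπ' N z
    -- The defects of the lifted pair project to zero, since the pair was a solution at level `N`.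
    have h1 : (π N).map (x.1 (N + 1) - (T (N + 1)).d hq w) = 0 := by
      rw [map_sub, (π N).map_d, hw, x.2, sub_self]
    have h2 : (π' N).map (y.1 (N + 1) - (ρ (N + 1)).map w + (T' (N + 1)).d hp z) = 0 := by
      rw [map_add, map_sub, (π' N).map_d, ← hz, y.2, h]
      exact sub_add_sub_cancel _ _ _ |>.trans (sub_self _)
    have h3 : (T (N + 1)).d hp (x.1 (N + 1) - (T (N + 1)).d hq w) = 0 := by
      rw [map_sub, hxN, DGOperad.d_d, sub_zero]
    have h4 : (ρ (N + 1)).map (x.1 (N + 1) - (T (N + 1)).d hq w) =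
        (T' (N + 1)).d hq (y.1 (N + 1) - (ρ (N + 1)).map w + (T' (N + 1)).d hp z) := by
      rw [map_sub, map_add, map_sub, hxyN, (ρ (N + 1)).map_d, DGOperad.d_d, add_zero]
    obtain ⟨w', z', hw', hz', e1, e2⟩ := hK N hq hp _ _ h1 h2 h3 h4
    refine ⟨⟨(w + w', z + z'), ?_, ?_⟩, ?_, ?_⟩
    · simp [e1]
    · simp only [map_add, ← e2]
      abel
    · simp [hw']
    · simp [hz']
  choose next hnext using step
  -- At level `0` everything is zero, so the pair `(0, 0)` starts the recursion.
  let s : ∀ N, S N := fun N => Nat.rec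
    ⟨(0, 0), by rw [hT (x.1 0), map_zero], by rw [hT' (y.1 0), map_zero, map_zero, sub_zero]⟩ next N
  refine ⟨⟨fun N => (s N).1.1, fun N => (hnext N (s N)).1⟩,
    ⟨fun N => (s N).1.2, fun N => (hnext N (s N)).2⟩, ?_, ?_⟩
  · exact Subtype.ext (funext fun N => (s N).2.1)
  · exact Subtype.ext (funext fun N => (s N).2.2)

end Cone

/-! ### The graded pieces of the Maurer–Cartan operad -/

section Filtration

variable {k : Type u} [Field k]

/-- The image of `(x) ^ K` in `O[x] / (x)^N`. -/
def AdjPres.filtration (O : GradedOperad.{u, v} k) (N K n : ℕ) (p : ZMod 2) :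
    Submodule k ((AdjPres O N).operad.Op n p) where
  carrier := {y | ∃ t, (AdjPres O N).cls t = y ∧ K ≤ xOrder t}
  zero_mem' := ⟨.zero, rfl, le_top⟩
  add_mem' := by
    rintro _ _ ⟨s, rfl, hs⟩ ⟨t, rfl, ht⟩
    exact ⟨s.add t, rfl, le_min hs ht⟩
  smul_mem' := by
    rintro c _ ⟨s, rfl, hs⟩
    exact ⟨s.smul c, rfl, hs⟩

variable {O : GradedOperad.{u, v} k} {N : ℕ}

theorem AdjPres.filtration_mono {K L n : ℕ} {p : ZMod 2} (h : L ≤ K)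
    {y : (AdjPres O N).operad.Op n p} (hy : y ∈ AdjPres.filtration O N K n p) :
    y ∈ AdjPres.filtration O N L n p := by
  obtain ⟨t, rfl, ht⟩ := hy
  exact ⟨t, rfl, le_trans (by exact_mod_cast h) ht⟩

theorem AdjPres.eq_zero_of_mem_filtration {K n : ℕ} {p : ZMod 2} (h : N ≤ K)
    {y : (AdjPres O N).operad.Op n p} (hy : y ∈ AdjPres.filtration O N K n p) : y = 0 := by
  obtain ⟨t, rfl, ht⟩ := AdjPres.filtration_mono h hy
  exact AdjPres.cls_eq_zero O N t ht

theorem AdjPres.comp_mem_filtration {a b c K L : ℕ} {p q r : ZMod 2} (h : a + b = c + 1)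
    (hr : p + q = r) (i : Fin a) {y : (AdjPres O N).operad.Op a p}
    {z : (AdjPres O N).operad.Op b q} (hy : y ∈ AdjPres.filtration O N K a p)
    (hz : z ∈ AdjPres.filtration O N L b q) :
    (AdjPres O N).operad.comp h hr i y z ∈ AdjPres.filtration O N (K + L) c r := by
  obtain ⟨s, rfl, hs⟩ := hy
  obtain ⟨t, rfl, ht⟩ := hz
  exact ⟨.comp h hr i s t, rfl, by rw [Nat.cast_add]; exact add_le_add hs ht⟩

theorem AdjPres.plugTail_mem_filtration (j : ℕ) {n K : ℕ} {p : ZMod 2}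
    {y : (AdjPres O N).operad.Op (n + j) p} (hy : y ∈ AdjPres.filtration O N K (n + j) p) :
    (AdjPres O N).operad.plugTail ((AdjPres O N).cls (.gen .x)) j y ∈
      AdjPres.filtration O N (K + j) n p := by
  obtain ⟨t, rfl, ht⟩ := hy
  rw [← AdjPres.cls_plugTail]
  exact ⟨_, rfl, by rw [Term.xOrder_plugTail, Nat.cast_add]; gcongr⟩

theorem AdjPres.var_mem_filtration :
    (AdjPres O N).cls (.gen .x) ∈ AdjPres.filtration O N 1 0 0 :=
  ⟨_, rfl, le_rfl⟩

end Filtration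

/-! ### The differential on the layers. -/

section MCPres

variable {k : Type u} [Field k] [CharZero k] {O : DGOperad.{u, v} k} {P : DGOperad.{u, w} k}

/-- The essential use of `m_1 = 0`: the term of index `0` is the linear one, and all others contain
`x` at least twice. -/
theorem MCPres.d_var_mem_filtration (φ : (LInfty k).Hom O) (hφ : φ.map (LInfty.m k 0) = 0)
    (N : ℕ) : (MCPres φ N).operad.d rfl ((MCPres φ N).cls (.gen .x)) ∈
      AdjPres.filtration O.toGradedOperad N 2 0 (0 + 1) := by
  change (AdjPres O.toGradedOperad N).cls (curvature φ N) ∈ _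
  rw [curvature, Presentation.cls_sum]
  refine Submodule.sum_mem _ fun n _ => ?_
  rw [Presentation.cls_smul]
  refine Submodule.smul_mem _ _ ?_
  rcases n with - | n
  · rw [AdjPres.cls_plugX, hφ]
    have : (AdjPres O.toGradedOperad N).cls (.gen (.incl (0 : O.Op (0 + 1) 1))) = 0 :=
      map_zero (AdjPres.incl O.toGradedOperad N)
    rw [this, map_zero]
    exact zero_mem _
  · exact ⟨_, rfl, by rw [xOrder_plugX]; exact le_add_left (by exact_mod_cast (by omega))⟩

theorem DGOperad.d_plugTail_succ {k : Type u} [Field k] (Q : DGOperad.{u, v} k) (x : Q.Op 0 0)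
    (j : ℕ) {n : ℕ} {p : ZMod 2} (y : Q.Op (n + (j + 1)) p) :
    Q.d rfl (Q.plugTail x (j + 1) y) - Q.plugTail x (j + 1) (Q.d rfl y) =
      Q.d rfl (Q.plugTail x j (Q.comp (add_zero (n + j + 1)) (add_zero p) (Fin.last (n + j)) y x)) -
        Q.plugTail x j
          (Q.d rfl (Q.comp (add_zero (n + j + 1)) (add_zero p) (Fin.last (n + j)) y x)) +
        psign p • Q.plugTail x j (Q.comp (add_zero (n + j + 1)) (by ring) (Fin.last (n + j)) y
          (Q.d rfl x)) := by
  rw [Q.d_comp (add_zero (n + j + 1)) (add_zero p) rfl rfl rfl (add_zero _) (by ring)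
    (Fin.last (n + j)) y x, map_add, map_zsmul, ← sub_sub, sub_add_cancel, Q.plugTail_succ,
    Q.plugTail_succ]

/-- By the Leibniz rule the error is a sum of terms with one inserted `x` replaced by `d x`, which
has at least one more occurrence of `x`. -/
theorem MCPres.d_plugTail (φ : (LInfty k).Hom O) (hφ : φ.map (LInfty.m k 0) = 0) (N j : ℕ)
    {n K : ℕ} {p : ZMod 2} (y : (MCPres φ N).operad.Op (n + j) p)
    (hy : y ∈ AdjPres.filtration O.toGradedOperad N K (n + j) p) :
    (MCPres φ N).operad.d rfl ((MCPres φ N).operad.plugTail ((MCPres φ N).cls (.gen .x)) j y) -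
      (MCPres φ N).operad.plugTail ((MCPres φ N).cls (.gen .x)) j ((MCPres φ N).operad.d rfl y) ∈
      AdjPres.filtration O.toGradedOperad N (K + j + 1) n (p + 1) := by
  induction j generalizing K with
  | zero => 
    change (MCPres φ N).operad.d rfl y - (MCPres φ N).operad.d rfl y ∈ _
    rw [sub_self]
    exact zero_mem _
  | succ j ih =>
    have h1 := ih _ (AdjPres.comp_mem_filtration (add_zero (n + j + 1)) (add_zero p)
      (Fin.last (n + j)) hy AdjPres.var_mem_filtration)
    have h2 := AdjPres.plugTail_mem_filtration j (AdjPres.comp_mem_filtration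
      (add_zero (n + j + 1)) (by ring : p + (0 + 1) = p + 1) (Fin.last (n + j)) hy
        (MCPres.d_var_mem_filtration φ hφ N))
    have h3 := add_mem (AdjPres.filtration_mono (by omega : K + (j + 1) + 1 ≤ _) h1)
      (zsmul_mem (AdjPres.filtration_mono (by omega : K + (j + 1) + 1 ≤ _) h2) (psign p))
    exact (congrArg (· ∈ AdjPres.filtration O.toGradedOperad N (K + (j + 1) + 1) n (p + 1))
      ((MCPres φ N).operad.d_plugTail_succ _ j y)).mpr h3

/-- With `N` insertions the error lies in `(x)^(N + 1)`, which is zero here: the top layer carries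
only the differential of `O`. -/
theorem MCPres.d_tail (φ : (LInfty k).Hom O) (hφ : φ.map (LInfty.m k 0) = 0) (N : ℕ)
    {n : ℕ} {p q : ZMod 2} (hq : p + 1 = q) (f : O.Op (n + N) p) :
    (MCPres φ (N + 1)).operad.d hq (AdjPres.tail O.toGradedOperad (N + 1) N f) =
      AdjPres.tail O.toGradedOperad (N + 1) N (O.d hq f) := by
  subst hq
  exact sub_eq_zero.1 (AdjPres.eq_zero_of_mem_filtration (by omega)
    (MCPres.d_plugTail φ hφ (N + 1) N (K := 0) (AdjPres.incl _ _ f) ⟨_, rfl, zero_le⟩))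

theorem MCPres.proj_tail (φ : (LInfty k).Hom O) (N j : ℕ) {n : ℕ} {p : ZMod 2}
    (f : O.Op (n + j) p) :
    (MCPres.proj φ N).map (AdjPres.tail O.toGradedOperad (N + 1) j f) =
      AdjPres.tail O.toGradedOperad N j f := by
  rw [AdjPres.tail_eq_cls, AdjPres.tail_eq_cls]
  exact MCPres.proj_cls φ N _

theorem MCPres.map_tail (φ : (LInfty k).Hom O) (ψ : (LInfty k).Hom P) (ρ : O.Hom P)
    (h : ρ.comp φ = ψ) (N j : ℕ) {n : ℕ} {p : ZMod 2} (f : O.Op (n + j) p) :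
    (MCPres.map φ ψ ρ h N).map (AdjPres.tail O.toGradedOperad N j f) =
      AdjPres.tail P.toGradedOperad N j (ρ.map f) := by
  refine ((MCPres.map φ ψ ρ h N).toHom.map_plugTail _ j _).trans ?_
  refine congrArg₂ (fun x y => (AdjPres P.toGradedOperad N).operad.plugTail x j y) ?_ ?_
  · exact MCPres.map_cls φ ψ ρ h N _
  · exact MCPres.map_cls φ ψ ρ h N _

theorem MCPres.proj_isVar (φ : (LInfty k).Hom O) (N : ℕ) {n : ℕ} {p : ZMod 2} {c : k}
    {y : (AdjPres O.toGradedOperad (N + 1)).operad.Op n p}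
    (hy : AdjPres.IsVar O.toGradedOperad (N + 1) c y) :
    AdjPres.IsVar O.toGradedOperad N c ((MCPres.proj φ N).map y) := by
  cases hy with
  | zero => erw [map_zero]; exact .zero
  | var c => erw [map_smul, MCPres.proj_cls]; exact .var c

theorem MCPres.map_isVar (φ : (LInfty k).Hom O) (ψ : (LInfty k).Hom P) (ρ : O.Hom P)
    (h : ρ.comp φ = ψ) (N : ℕ) {n : ℕ} {p : ZMod 2} {c : k}
    {y : (AdjPres O.toGradedOperad N).operad.Op n p}
    (hy : AdjPres.IsVar O.toGradedOperad N c y) :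
    AdjPres.IsVar P.toGradedOperad N c ((MCPres.map φ ψ ρ h N).map y) := by
  cases hy with
  | zero => erw [map_zero]; exact .zero
  | var c => erw [map_smul, MCPres.map_cls]; exact .var c

theorem MCPres.exists_map_isVar (φ : (LInfty k).Hom O) (ψ : (LInfty k).Hom P) (ρ : O.Hom P)
    (h : ρ.comp φ = ψ) (N : ℕ) {n : ℕ} {p : ZMod 2} {c : k}
    {y : (AdjPres P.toGradedOperad N).operad.Op n p}
    (hy : AdjPres.IsVar P.toGradedOperad N c y) :
    ∃ y', AdjPres.IsVar O.toGradedOperad N c y' ∧ (MCPres.map φ ψ ρ h N).map y' = y := by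
  cases hy with
  | zero => exact ⟨0, .zero, map_zero _⟩
  | var c => exact ⟨_, .var c, by erw [map_smul, MCPres.map_cls]; rfl⟩

theorem MCPres.d_isVar (φ : (LInfty k).Hom O) (hφ : φ.map (LInfty.m k 0) = 0) {N : ℕ}
    (hN : N ≤ 2) {n : ℕ} {p q : ZMod 2} (hq : p + 1 = q) {c : k}
    {y : (AdjPres O.toGradedOperad N).operad.Op n p}
    (hy : AdjPres.IsVar O.toGradedOperad N c y) : (MCPres φ N).operad.d hq y = 0 := by
  subst hq
  cases hy with
  | zero => exact map_zero _
  | var c =>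
    refine (map_smul _ _ _).trans ?_
    exact (congrArg (c • ·) (AdjPres.eq_zero_of_mem_filtration hN
      (MCPres.d_var_mem_filtration φ hφ N))).trans
        (smul_zero (A := (AdjPres O.toGradedOperad N).operad.Op 0 (0 + 1)) c)

end MCPres

section Invariants

variable {k : Type u} [Field k]

theorem DGOperad.tailInvariant_d (O : DGOperad.{u, v} k) {n j : ℕ} {p q : ZMod 2} (hq : p + 1 = q)
    {f : O.Op (n + j) p} (hf : O.TailInvariant j f) : O.TailInvariant j (O.d hq f) := by
  intro σ hσ
  rw [← O.d_act, hf σ hσ]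

theorem GradedOperad.Hom.tailInvariant_map {O : GradedOperad.{u, v} k} {P : GradedOperad.{u, w} k}
    (ρ : O.Hom P) {n j : ℕ} {p : ZMod 2} {f : O.Op (n + j) p} (hf : O.TailInvariant j f) :
    P.TailInvariant j (ρ.map f) := by
  intro σ hσ
  rw [← ρ.map_act, hf σ hσ]

theorem GradedOperad.TailInvariant.sub {O : GradedOperad.{u, v} k} {n j : ℕ} {p : ZMod 2}
    {f g : O.Op (n + j) p} (hf : O.TailInvariant j f) (hg : O.TailInvariant j g) :
    O.TailInvariant j (f - g) := by
  intro σ hσ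
  rw [map_sub, hf σ hσ, hg σ hσ]

end Invariants

theorem lInfty.proj_m_zero (k : Type u) [Field k] :
    (lInfty.proj k).map (LInfty.m k 0) = 0 :=
  (Presentation.cls_eq _).2 (.rel (LRel.unary trivial))

/-! ### Acyclicity on the layers, and the theorem. -/

section MCPres

variable {k : Type u} [Field k] [CharZero k] {O : DGOperad.{u, v} k} {P : DGOperad.{u, w} k}

/-- By uniqueness of the normal form the symmetrisation of `f` vanishes, and for invariant `f` this
is a nonzero multiple of `f`. -/
theorem AdjPres.TailInvariant.eq_zero {O : GradedOperad.{u, v} k} {N j n : ℕ} (hj : j < N)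
    {p : ZMod 2} {f : O.Op (n + j) p} (hf : O.TailInvariant j f) {c : k}
    {z : (AdjPres O N).operad.Op n p} (hz : AdjPres.IsVar O N c z)
    (h : AdjPres.tail O N j f + z = 0) : f = 0 ∧ (2 ≤ N → c = 0) := by
  have e : ∑ i ∈ Finset.range N, AdjPres.tail O N i ((Pi.single j f : ∀ i, O.Op (n + i) p) i) =
      AdjPres.tail O N j f := by
    rw [Finset.sum_eq_single j, Pi.single_eq_same]
    · intro i _ hi
      rw [Pi.single_eq_of_ne hi, map_zero]
    · intro h
      exact absurd (Finset.mem_range.2 hj) h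
  obtain ⟨h1, h2⟩ := AdjPres.eq_zero_of_sum_tail (Pi.single j f) hz (by rw [e, h])
  refine ⟨?_, h2⟩
  obtain ⟨s, hs, hs'⟩ := GradedOperad.TailInvariant.exists_tailSum_eq O n j
  have := h1 j hj
  rw [Pi.single_eq_same, hs' f hf] at this
  exact (smul_eq_zero.1 this).resolve_left hs

/-- The elements of the kernel of the projection from `O[x] / (x)^(N + 1)` to `O[x] / (x)^N`. -/
theorem MCPres.exists_eq_tail_of_proj_eq_zero (φ : (LInfty k).Hom O) (N : ℕ) {n : ℕ} {p : ZMod 2}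
    {y : (AdjPres O.toGradedOperad (N + 1)).operad.Op n p} (hy : (MCPres.proj φ N).map y = 0) :
    ∃ (f : O.Op (n + N) p) (c : k) (z : (AdjPres O.toGradedOperad (N + 1)).operad.Op n p),
      O.TailInvariant N f ∧ AdjPres.IsVar O.toGradedOperad (N + 1) c z ∧ (2 ≤ N → z = 0) ∧
        y = AdjPres.tail O.toGradedOperad (N + 1) N f + z := by
  obtain ⟨f, c, z, hz, rfl⟩ := AdjPres.exists_eq_sum_tail (N + 1) y
  obtain ⟨z', e'⟩ : ∃ z' : (AdjPres O.toGradedOperad N).operad.Op n p,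
      (MCPres.proj φ N).map z = z' := ⟨_, rfl⟩
  have e : ∑ j ∈ Finset.range N, AdjPres.tail O.toGradedOperad N j (f j) =
      ∑ j ∈ Finset.range (N + 1), AdjPres.tail O.toGradedOperad N j (f j) := by
    rw [Finset.sum_range_succ, AdjPres.tail_eq_zero (le_refl N), add_zero]
  have h1 : ∑ j ∈ Finset.range N, AdjPres.tail O.toGradedOperad N j (f j) + z' = 0 := by
    refine Eq.trans ?_ hy
    refine Eq.trans ?_ (map_add _ _ _).symm
    refine congrArg₂ (· + ·) ?_ e'.symm
    refine Eq.trans ?_ (map_sum (MCPres.proj φ N).map _ _).symm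
    exact e.trans (Finset.sum_congr rfl fun j _ => (MCPres.proj_tail φ N j (f j)).symm)
  -- Uniqueness is applied one level lower, where the summand with `N` insertions has disappeared.
  obtain ⟨h2, h3⟩ := AdjPres.eq_zero_of_sum_tail f (e' ▸ MCPres.proj_isVar φ N hz) h1
  -- The top coefficient is averaged, which does not change its tail.
  obtain ⟨f', hf', e⟩ := AdjPres.exists_tailInvariant (N + 1) (f N)
  refine ⟨f', c, z, hf', hz, fun hN => ?_, ?_⟩
  · rw [h3 hN] at hz
    exact hz.eq_zero
  · rw [Finset.sum_range_succ, Finset.sum_eq_zero, zero_add, e]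
    intro j hj
    -- For `j < N` the symmetrisation of `f j` vanishes, so the tail vanishes at level `N + 1` as
    -- well.
    obtain ⟨s, hs, hs'⟩ := AdjPres.exists_tail_tailSum O.toGradedOperad n j
    have := hs' (N + 1) (f j)
    rw [h2 j (Finset.mem_range.1 hj), map_zero] at this
    exact (smul_eq_zero.1 this.symm).resolve_left hs

/-- The kernel consists of tails of invariant operations and, for `N = 1`, multiples of `x`. On the
first part the differential and the map are those of `O` and `ρ`; on the second the differential is
zero and the map preserves the coefficient. The cone problem thus splits into one for `ρ` and a
trivial one. -/
theorem MCPres.kernel_coneAcyclic (φ : (LInfty k).Hom O) (ψ : (LInfty k).Hom P) (ρ : O.Hom P)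
    (h : ρ.comp φ = ψ) (hφ : φ.map (LInfty.m k 0) = 0) (hρ : ρ.ConeAcyclic) (N : ℕ) {n : ℕ}
    {p q : ZMod 2} (hq : p + 1 = q) (hp : q + 1 = p)
    (x : (MCPres φ (N + 1)).operad.Op n q) (y : (MCPres ψ (N + 1)).operad.Op n p)
    (hx : (MCPres.proj φ N).map x = 0) (hy : (MCPres.proj ψ N).map y = 0)
    (hdx : (MCPres φ (N + 1)).operad.d hp x = 0)
    (hxy : (MCPres.map φ ψ ρ h (N + 1)).map x = (MCPres ψ (N + 1)).operad.d hq y) :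
    ∃ (w : (MCPres φ (N + 1)).operad.Op n p) (z : (MCPres ψ (N + 1)).operad.Op n q),
      (MCPres.proj φ N).map w = 0 ∧ (MCPres.proj ψ N).map z = 0 ∧
        (MCPres φ (N + 1)).operad.d hq w = x ∧
          (MCPres.map φ ψ ρ h (N + 1)).map w - y = (MCPres ψ (N + 1)).operad.d hp z := by
  have hψ : ψ.map (LInfty.m k 0) = 0 := by
    rw [← h]
    exact (congrArg ρ.map hφ).trans (map_zero _)
  obtain ⟨f, c, s, hf, hs, hs', rfl⟩ := MCPres.exists_eq_tail_of_proj_eq_zero φ N hx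
  obtain ⟨g, c', t, hg, ht, ht', rfl⟩ := MCPres.exists_eq_tail_of_proj_eq_zero ψ N hy
  have hds : (MCPres φ (N + 1)).operad.d hp s = 0 := by
    by_cases hN : 2 ≤ N
    · rw [hs' hN]; exact map_zero _
    · exact MCPres.d_isVar φ hφ (by omega) hp hs
  have hdt : (MCPres ψ (N + 1)).operad.d hq t = 0 := by
    by_cases hN : 2 ≤ N
    · rw [ht' hN]; exact map_zero _
    · exact MCPres.d_isVar ψ hψ (by omega) hq ht
  have hdf : O.d hp f = 0 := by
    refine (AdjPres.TailInvariant.eq_zero (N := N + 1) N.lt_succ_self (O.tailInvariant_d hp hf)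
      .zero ?_).1
    rw [add_zero, ← MCPres.d_tail φ hφ]
    refine Eq.trans ?_ hdx
    refine Eq.trans ?_ (map_add _ _ _).symm
    exact ((congrArg₂ (· + ·) rfl hds).trans (add_zero _)).symm
  -- Both `g` and `f` are invariant, so comparing normal forms in `ρ x = d y` gives an equation in
  -- `P` itself. As `d y` has no component along `x`, the coefficient `c` vanishes too.
  have hfg : ρ.map f - P.d hq g = 0 ∧ (2 ≤ N + 1 → c = 0) := by
    refine AdjPres.TailInvariant.eq_zero (N := N + 1) N.lt_succ_self
      ((ρ.tailInvariant_map hf).sub (P.tailInvariant_d hq hg))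
      (MCPres.map_isVar φ ψ ρ h (N + 1) hs) ?_
    have h1 := (MCPres.map φ ψ ρ h (N + 1)).map.map_add
      (AdjPres.tail O.toGradedOperad (N + 1) N f) s
    have h2 := ((MCPres ψ (N + 1)).operad.d hq).map_add
      (AdjPres.tail P.toGradedOperad (N + 1) N g) t
    have h3 := h1.symm.trans (hxy.trans h2)
    rw [MCPres.map_tail, MCPres.d_tail ψ hψ, hdt] at h3
    rw [map_sub]
    exact (sub_add_eq_add_sub _ _ _).trans (sub_eq_zero.2 (h3.trans (add_zero _)))
  obtain ⟨hfg, hc⟩ := hfg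
  -- For `N = 0` there is no information on `c`, but `x` itself is zero modulo `(x)^1`.
  obtain rfl : s = 0 := by
    by_cases hN : 2 ≤ N + 1
    · rw [hc hN] at hs
      exact hs.eq_zero
    · exact hs.eq_zero_of_le_one (by omega)
  -- No invariance of `w₀` and `z₀` is needed, since only their tails are used.
  obtain ⟨w₀, z₀, hw₀, hz₀⟩ := hρ hq hp f g hdf (sub_eq_zero.1 hfg)
  -- The part of `y` along `x` is matched by the same multiple of `x` on the side of `O`, a cycle as
  -- `d x` is in `(x)^2`.
  obtain ⟨t', e, hdt', hpt'⟩ : ∃ t' : (AdjPres O.toGradedOperad (N + 1)).operad.Op n p,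
      (MCPres.map φ ψ ρ h (N + 1)).map t' = t ∧ (MCPres φ (N + 1)).operad.d hq t' = 0 ∧
        (MCPres.proj φ N).map t' = 0 := by
    by_cases hN : 2 ≤ N
    · exact ⟨0, by rw [ht' hN]; exact map_zero _, map_zero _, map_zero _⟩
    · obtain ⟨t', ht', e⟩ := MCPres.exists_map_isVar φ ψ ρ h (N + 1) ht
      exact ⟨t', e, MCPres.d_isVar φ hφ (by omega) hq ht',
        (MCPres.proj_isVar φ N ht').eq_zero_of_le_one (by omega)⟩
  refine ⟨AdjPres.tail O.toGradedOperad (N + 1) N w₀ + t',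
    AdjPres.tail P.toGradedOperad (N + 1) N z₀, ?_, ?_, ?_, ?_⟩
  · refine (map_add _ _ _).trans ?_
    rw [hpt', MCPres.proj_tail, AdjPres.tail_eq_zero (le_refl N)]
    exact add_zero _
  · rw [MCPres.proj_tail, AdjPres.tail_eq_zero (le_refl N)]
    rfl
  · refine (map_add _ _ _).trans ?_
    rw [hdt', MCPres.d_tail φ hφ, hw₀]
    rfl
  · rw [MCPres.d_tail ψ hψ, ← hz₀, map_sub, ← MCPres.map_tail φ ψ ρ h, ← e]
    refine (congrArg₂ (· - ·) (map_add _ _ _) rfl).trans ?_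
    exact add_sub_add_right_eq_sub _ _ _

theorem MCPres.eq_zero_of_order_zero (φ : (LInfty k).Hom O) {n : ℕ} {p : ZMod 2}
    (y : (MCPres φ 0).operad.Op n p) : y = 0 := by
  obtain ⟨t, rfl⟩ := Presentation.cls_surj _ y
  exact AdjPres.cls_eq_zero _ 0 t (by simp)

theorem MCPres.proj_surjective (φ : (LInfty k).Hom O) (N : ℕ) {n : ℕ} {p : ZMod 2}
    (y : (MCPres φ N).operad.Op n p) : ∃ z, (MCPres.proj φ N).map z = y := by
  obtain ⟨t, rfl⟩ := Presentation.cls_surj _ y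
  exact ⟨_, MCPres.proj_cls φ N t⟩

/-- The construction `O_MC` preserves quasi-isomorphisms if `m_1` acts by zero. -/
theorem MC.map_isQuasiIso (φ : (LInfty k).Hom O) (ψ : (LInfty k).Hom P) (ρ : O.Hom P)
    (h : ρ.comp φ = ψ) (hφ : φ.map (LInfty.m k 0) = 0) (hρ : ρ.IsQuasiIso) :
    (MC.map φ ψ ρ h).IsQuasiIso := by
  rw [DGOperad.Hom.isQuasiIso_iff_coneAcyclic] at hρ ⊢
  exact DGOperad.limMap_coneAcyclic _ _ _ _ _ _ (MCPres.eq_zero_of_order_zero φ)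
    (MCPres.eq_zero_of_order_zero ψ) (MCPres.proj_surjective φ) (MCPres.proj_surjective ψ)
    fun N _ _ _ => MCPres.kernel_coneAcyclic φ ψ ρ h hφ hρ N

end MCPres

end OperadMC

theorem proposition6p4 {k : Type u} [Field k] [CharZero k]
    (O : OperadMC.DGOperad.{u, v} k) (P : OperadMC.DGOperad.{u, w} k)
    (φ : (OperadMC.lInfty k).Hom O) (ψ : (OperadMC.lInfty k).Hom P) (ρ : O.Hom P)
    (h : ρ.comp φ = ψ) (hρ : ρ.IsQuasiIso) :
    (OperadMC.MCl.map φ ψ ρ h).IsQuasiIso :=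
  OperadMC.MC.map_isQuasiIso _ _ ρ _
    -- The composite with `L_∞ → l_∞` kills `m_1`, as the general statement requires.
    ((congrArg φ.map (OperadMC.lInfty.proj_m_zero k)).trans (map_zero _)) hρ
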